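/- Let $b_{in}:\mathbb R\to\mathbb R$ be a $C^2$ function. For $\nu>0$ let $b_t(y)=b(t,y)$, $t\ge 0$, be the solution of the heat equation $\partial_t b=\nu\,\partial_{yy}b$, $b(0,y)=b_{in}(y)$, given by the heat kernel, that is, $b_0=b_{in}$ and $b_t(y)=\frac1{\sqrt{4\pi\nu t}}\int_{\mathbb R}e^{-(z-y)^2/(4\nu t)}\,b_{in}(z)\,dz$ for $t>0$. Consider the following assumptions: * $b_{in}(0)=0$; * (monotone) there is $0<c_m<1$ with $c_m\le b_{in}'(y)\le c_m^{-1}$ for all $y\in\mathbb R$; * (linear growth) there are $c_m\le C_-\le C_+\le c_m^{-1}$ with $\lim_{y\to\pm\infty}b_{in}'(y)=C_\pm$; * (regularity and decay) $b_{in}''\in W^{1,1}(\mathbb R)\cap H^3(\mathbb R)$ and $(1+y^2)^{1/4}\,b_{in}''\in H^1(\mathbb R)$; * (stability) for every $t\ge0$ and every $k\in\mathbb Z\setminus\{0\}$ the Rayleigh operator $\mathcal R_{t,k}=b_t\,\mathrm{Id}-b_t''\,\Delta_k^{-1}$ on $L^2(\mathbb R;\mathbb C)$, where $\Delta_k=\partial_{yy}-k^2$,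 has no eigenvalue in $\mathbb C$, embedded in the continuous spectrum or not. For $s\ge0$, $k\in\mathbb Z\setminus\{0\}$ and $y'\in\mathbb R$ let $\phi_{s,1}(k,\cdot,y')$ be the solution of $$\partial_y\big((b_s(y)-b_s(y'))^2\,\partial_y\phi\big)-k^2(b_s(y)-b_s(y'))^2\phi=0,\qquad \phi(y')=1,\quad \partial_y\phi(y')=0,$$ and put $$\Pi_{s,1}(y')=\mathrm{P.V.}\!\int_{\mathbb R}\frac{b_s'(y')-b_s'(y)}{(b_s(y)-b_s(y'))^2}\,dy,\qquad \Pi_{s,2}(k,y')=\int_{\mathbb R}\frac{1}{(b_s(y)-b_s(y'))^2}\Big(\frac1{\phi_{s,1}(k,y,y')^2}-1\Big)dy,$$ $$\mathcal J_{s,1}(k,y')=\frac{1}{b_s'(y')}\,\Pi_{s,1}(y')+\Pi_{s,2}(k,y'),\qquad \mathcal J_{s,2}(y')=\pi\,\frac{b_s''(y')}{b_s'(y')^3}.$$ Then for every $b_{in}$ there is a constant $\delta>0$, depending on $b_{in}$ only (so independent of $k,y',s,\nu$), such that for every $\nu>0$ for which the assumptions above hold and for all $s\ge0$, $k\in\mathbb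 Z\setminus\{0\}$ and $y'\in\mathbb R$, these quantities are well defined ($b_s$ is $C^2$ with $b_s'>0$, $\phi_{s,1}(k,\cdot,y')$ exists, is unique and has no zeros, the principal value exists and the integral defining $\Pi_{s,2}$ converges absolutely), and $$\mathcal J_{s,1}(k,y')^2+\mathcal J_{s,2}(y')^2\ \ge\ \delta\,k^2 .$$ -/

import Mathlib

open MeasureTheory Filter Topology Set
open scoped ENNReal ContDiff

noncomputable section

namespace ShearFlow

/-- `g` is the weak (distributional) derivative of `f` on the real line. -/
def HasWeakDeriv {E : Type*} [NormedAddCommGroup E] [NormedSpace ℝ E] (f g : ℝ → E) : Prop :=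
  LocallyIntegrable f volume ∧ LocallyIntegrable g volume ∧
    ∀ φ : ℝ → ℝ, ContDiff ℝ ∞ φ → HasCompactSupport φ →
      ∫ y, deriv φ y • f y = -∫ y, φ y • g y

/-- The Sobolev space `W^{n,p}(ℝ)`, for integer `n` and `1 ≤ p`, through weak derivatives; `H^n(ℝ)` is the case `p = 2`. -/
def MemSobolev {E : Type*} [NormedAddCommGroup E] [NormedSpace ℝ E] :
    ℕ → ℝ≥0∞ → (ℝ → E) → Prop
  | 0, p, f => MemLp f p volume
  | n + 1, p, f => MemLp f p volume ∧ ∃ g : ℝ → E, HasWeakDeriv f g ∧ MemSobolev n p g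

/-- The solution `b(t,y)` of the heat equation `∂ₜ b = ν ∂_yy b`, `b(0,y) = bin(y)`, given by the
heat kernel: the integral of `bin` against the Gaussian of mean `y` and variance `2νt`, which has
density `z ↦ (4πνt)^(-1/2) exp (-(z-y)²/(4νt))` for `t > 0` and is the Dirac mass at `y` for
`t = 0`. -/
def heatFlow (ν : ℝ) (bin : ℝ → ℝ) (t y : ℝ) : ℝ :=
  ∫ z, bin z ∂(ProbabilityTheory.gaussianReal y (2 * ν * t).toNNReal)

theorem heatFlow_zero (ν : ℝ) (bin : ℝ → ℝ) (y : ℝ) : heatFlow ν bin 0 y = bin y := by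
  simp [heatFlow]

theorem heatFlow_of_pos {ν t : ℝ} (hν : 0 < ν) (ht : 0 < t) (bin : ℝ → ℝ) (y : ℝ) :
    heatFlow ν bin t y =
      (√(4 * Real.pi * ν * t))⁻¹ * ∫ z, Real.exp (-(z - y) ^ 2 / (4 * ν * t)) * bin z := by
  have h2 : 0 < 2 * ν * t := by positivity
  have hne : (2 * ν * t).toNNReal ≠ 0 := by
    rw [ne_eq, Real.toNNReal_eq_zero]; linarith
  rw [heatFlow, ProbabilityTheory.integral_gaussianReal_eq_integral_smul hne,
    ← integral_const_mul]
  refine integral_congr_ae (Eventually.of_forall fun z => ?_)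
  simp only [ProbabilityTheory.gaussianPDFReal, Real.coe_toNNReal _ h2.le, smul_eq_mul]
  rw [show 2 * Real.pi * (2 * ν * t) = 4 * Real.pi * ν * t by ring,
    show 2 * (2 * ν * t) = 4 * ν * t by ring, mul_assoc]

/-- `ψ = Δ_k⁻¹ w`, where `Δ_k = ∂_yy - k²`: the function `ψ` is in `H²(ℝ)` and `ψ'' - k² ψ = w`. -/
def IsInvLaplacian (k : ℤ) (w ψ : ℝ → ℂ) : Prop :=
  ∃ ψ₁ ψ₂ : ℝ → ℂ, HasWeakDeriv ψ ψ₁ ∧ HasWeakDeriv ψ₁ ψ₂ ∧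
    MemLp ψ 2 volume ∧ MemLp ψ₁ 2 volume ∧ MemLp ψ₂ 2 volume ∧
    ∀ᵐ y, ψ₂ y - (k : ℂ) ^ 2 * ψ y = w y

/-- `c` is an eigenvalue (embedded in the continuous spectrum or not) of the Rayleigh operator
`R_k = b Id - b'' Δ_k⁻¹` on `L²(ℝ; ℂ)`. -/
def IsRayleighEigenvalue (b : ℝ → ℝ) (k : ℤ) (c : ℂ) : Prop :=
  ∃ w ψ : ℝ → ℂ, MemLp w 2 volume ∧ ¬ (w =ᵐ[volume] 0) ∧ IsInvLaplacian k w ψ ∧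
    ∀ᵐ y, (b y : ℂ) * w y - ((deriv (deriv b) y : ℝ) : ℂ) * ψ y = c * w y

/-- The standing assumptions on the shear flow `(bin(y), 0)` at viscosity `ν`. -/
structure FlowAssumption (ν : ℝ) (bin : ℝ → ℝ) : Prop where
  normalized : bin 0 = 0
  contDiff : ContDiff ℝ 2 bin
  /-- monotonicity and linear growth -/
  monotone_growth : ∃ c : ℝ, 0 < c ∧ c < 1 ∧ (∀ y, c ≤ deriv bin y ∧ deriv bin y ≤ c⁻¹) ∧
    ∃ Cminus Cplus : ℝ, c ≤ Cminus ∧ Cminus ≤ Cplus ∧ Cplus ≤ c⁻¹ ∧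
      Tendsto (deriv bin) atBot (𝓝 Cminus) ∧ Tendsto (deriv bin) atTop (𝓝 Cplus)
  /-- regularity and decay -/
  memW11 : MemSobolev 1 1 (deriv (deriv bin))
  memH3 : MemSobolev 3 2 (deriv (deriv bin))
  weighted_memH1 :
    MemSobolev 1 2 (fun y : ℝ => (1 + y ^ 2) ^ (1 / 4 : ℝ) * deriv (deriv bin) y)
  /-- stability -/
  stable : ∀ t : ℝ, 0 ≤ t → ∀ k : ℤ, k ≠ 0 → ∀ c : ℂ,
    ¬ IsRayleighEigenvalue (heatFlow ν bin t) k c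

/-- `φ = φ₁(k, ·, y')` is a classical solution of
`((b - b(y'))² φ')' - k² (b - b(y'))² φ = 0`, `φ(y') = 1`, `φ'(y') = 0`. -/
def IsPhi1 (b : ℝ → ℝ) (k : ℤ) (y' : ℝ) (φ : ℝ → ℝ) : Prop :=
  ContDiff ℝ 1 φ ∧
    (∀ y, HasDerivAt (fun z => (b z - b y') ^ 2 * deriv φ z)
      ((k : ℝ) ^ 2 * (b y - b y') ^ 2 * φ y) y) ∧
    φ y' = 1 ∧ deriv φ y' = 0

/-- The function `φ₁(k, ·, y')`. -/
def phi1 (b : ℝ → ℝ) (k : ℤ) (y' : ℝ) : ℝ → ℝ :=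
  Classical.epsilon (IsPhi1 b k y')

/-- `I` is the principal value at `a` of the integral of `f` over the real line. -/
def HasPV (f : ℝ → ℝ) (a I : ℝ) : Prop :=
  (∀ ε : ℝ, 0 < ε → IntegrableOn f {y | ε < |y - a|} volume) ∧
    Tendsto (fun ε : ℝ => ∫ y in {y | ε < |y - a|}, f y) (𝓝[>] 0) (𝓝 I)

/-- The principal value at `a` of the integral of `f`. -/
def pvIntegral (f : ℝ → ℝ) (a : ℝ) : ℝ :=
  limUnder (𝓝[>] (0 : ℝ)) (fun ε : ℝ => ∫ y in {y | ε < |y - a|}, f y)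

/-- The integrand of `Π₁`. -/
def Pi1Integrand (b : ℝ → ℝ) (y' y : ℝ) : ℝ :=
  (deriv b y' - deriv b y) / (b y - b y') ^ 2

/-- The integrand of `Π₂`. -/
def Pi2Integrand (b : ℝ → ℝ) (k : ℤ) (y' y : ℝ) : ℝ :=
  1 / (b y - b y') ^ 2 * (1 / phi1 b k y' y ^ 2 - 1)

def Pi1 (b : ℝ → ℝ) (y' : ℝ) : ℝ := pvIntegral (Pi1Integrand b y') y'

def Pi2 (b : ℝ → ℝ) (k : ℤ) (y' : ℝ) : ℝ := ∫ y, Pi2Integrand b k y' y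

def J1 (b : ℝ → ℝ) (k : ℤ) (y' : ℝ) : ℝ := 1 / deriv b y' * Pi1 b y' + Pi2 b k y'

def J2 (b : ℝ → ℝ) (y' : ℝ) : ℝ := Real.pi * deriv (deriv b) y' / deriv b y' ^ 3

/-- All the ingredients of `J1` and `J2` are meaningful: `b` is twice continuously differentiable
with positive derivative, `φ₁` exists and is unique and never vanishes, and the principal value
`Π₁` and the integral `Π₂` converge. -/
def JWellDefined (b : ℝ → ℝ) (k : ℤ) (y' : ℝ) : Prop :=
  ContDiff ℝ 2 b ∧ (∀ y, 0 < deriv b y) ∧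
    (∃! φ : ℝ → ℝ, IsPhi1 b k y' φ) ∧ (∀ y, phi1 b k y' y ≠ 0) ∧
    (∃ I : ℝ, HasPV (Pi1Integrand b y') y' I) ∧
    Integrable (Pi2Integrand b k y') volume

end ShearFlow

end

/-! Recentre at the critical point: `B z = b_s (y' + z) - b_s y'`. The heat kernel makes `b_s` the
Gaussian average of `bin` at scale `σ = √(2νs)`, so every profile lies in one family indexed by `(σ,
y')` in which `ν` and `s` no longer appear separately. This is why `δ` does not depend on `ν`.
Averaging preserves `c ≤ B' ≤ c⁻¹`, `|B''| ≤ M` and the Lipschitz constant `L` of `B''` (Sobolev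
embedding gives `M` and `L`), so all estimates are uniform over the family
(`profile_diffusedProfile`).

Coercivity. The function `φ₁` is the Neumann series of a Volterra operator with nonnegative terms,
so `φ₁ ≥ 1 + (c⁴/6)(kz)²`. Hence the integrand of `Π₂` is nonpositive, and the window `1/|k| < z ≤
2/|k|` alone gives `Π₂ ≤ -c₀|k|` with `c₀ = coerciveConst c` (`pi2_le`). Symmetrising the principal
value bounds `Π₁` uniformly. So `J₁² ≥ (c₀/2)² k²` as soon as `c⁻¹|Π₁| ≤ (c₀/2)|k|` (`le_J1_sq`),
which holds for `|k|` large. It also holds for every `k ≠ 0` once `(σ, y')` is far out: there a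
Gaussian gives little mass to bounded sets, `bin'` has limits at `±∞`, and so `Π₁ → 0`
(`tendsto_pi1_diffusedProfile`).

Compactness. There remain finitely many `k` and a compact set of `(σ, y')`, on which `J₁² + J₂²` is
continuous, so strict positivity suffices. Suppose both terms vanish. Then `B''(0) = 0`, and `u = B
φ₁` solves the Rayleigh equation at speed `B(0) = 0`. A second solution is `u` times a regularised
`∫_z^∞ u⁻²`; it decays at `+∞`, and `J₁` is exactly the obstruction to its decay at `-∞`. With `J₁ =
0` it decays on both sides and stays positive off the critical point, and its vorticity is a nonzero
`L²` eigenfunction (`isRayleighEigenvalue`), contradicting stability. -/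

namespace ShearFlow

/-! ### Weak derivatives and Sobolev bounds on the line -/

theorem exists_subset_Ioo_of_hasCompactSupport {φ : ℝ → ℝ} (h : HasCompactSupport φ) :
    ∃ R : ℝ, 0 < R ∧ ∀ y, φ y ≠ 0 → y ∈ Ioo (-R) R := by
  obtain ⟨R, hR⟩ := h.isCompact.isBounded.subset_closedBall 0
  refine ⟨max R 0 + 1, by positivity, fun y hy => ?_⟩
  have := hR (subset_tsupport φ hy)
  rw [Metric.mem_closedBall, dist_zero_right, Real.norm_eq_abs, abs_le] at this
  have h1 := le_max_left R 0
  constructor <;> linarith [this.1, this.2]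

theorem integral_eq_intervalIntegral_of_support {f : ℝ → ℝ} {R : ℝ}
    (h : ∀ y, f y ≠ 0 → y ∈ Ioo (-R) R) : ∫ y, f y = ∫ y in (-R)..R, f y := by
  refine (intervalIntegral.integral_eq_integral_of_support_subset fun y hy => ?_).symm
  exact Ioo_subset_Ioc_self (h y hy)

/-- A primitive of a locally integrable function has it as weak derivative. -/
theorem hasWeakDeriv_of_eq_integral {F g : ℝ → ℝ} (hg : LocallyIntegrable g volume)
    (hF : ∀ y, F y = F 0 + ∫ t in (0 : ℝ)..y, g t) : HasWeakDeriv F g := by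
  have hgi : ∀ a b, IntervalIntegrable g volume a b := fun a b =>
    (hg.integrableOn_isCompact isCompact_uIcc).intervalIntegrable
  have hFc : Continuous F := by
    have := (intervalIntegral.continuous_primitive hgi 0)
    rw [show F = fun y => F 0 + ∫ t in (0 : ℝ)..y, g t from funext hF]
    exact continuous_const.add this
  refine ⟨hFc.locallyIntegrable, hg, fun φ hφ hc => ?_⟩
  obtain ⟨R, hR, hsupp⟩ := exists_subset_Ioo_of_hasCompactSupport hc
  obtain ⟨R', hR', hsupp'⟩ := exists_subset_Ioo_of_hasCompactSupport hc.deriv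
  set r := max R R' with hr
  have hr0 : 0 < r := lt_max_of_lt_left hR
  have hs : ∀ y, φ y ≠ 0 → y ∈ Ioo (-r) r := fun y hy =>
    Ioo_subset_Ioo (neg_le_neg (le_max_left _ _)) (le_max_left _ _) (hsupp y hy)
  have hs' : ∀ y, deriv φ y ≠ 0 → y ∈ Ioo (-r) r := fun y hy =>
    Ioo_subset_Ioo (neg_le_neg (le_max_right _ _)) (le_max_right _ _) (hsupp' y hy)
  have hφr : ∀ y, y ∉ Ioo (-r) r → φ y = 0 := fun y hy => by
    by_contra h; exact hy (hs y h)
  have hFac : AbsolutelyContinuousOnInterval F (-r) r := by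
    have h0 : (0 : ℝ) ∈ uIcc (-r) r := by rw [uIcc_of_le (by linarith)]; constructor <;> linarith
    have h1 := (hgi (-r) r).absolutelyContinuousOnInterval_intervalIntegral h0
    have h2 : AbsolutelyContinuousOnInterval (fun _ : ℝ => F 0) (-r) r :=
      (contDiff_const (n := 1)).contDiffOn.absolutelyContinuousOnInterval
    have h3 := h2.add h1
    rwa [show F = (fun _ : ℝ => F 0) + fun y => ∫ t in (0 : ℝ)..y, g t from funext hF]
  have hφac : AbsolutelyContinuousOnInterval φ (-r) r :=
    ((hφ.of_le (by norm_num)).contDiffOn).absolutelyContinuousOnInterval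
  have key := hφac.integral_mul_deriv_eq_deriv_mul hFac
  rw [hφr r (by simp), hφr (-r) (by simp)] at key
  have hd : ∫ x in (-r)..r, φ x * deriv F x = ∫ x in (-r)..r, φ x * g x := by
    refine intervalIntegral.integral_congr_ae ?_
    filter_upwards [(hgi (-r) r).ae_hasDerivAt_integral] with x hx hxm
    have h0 : (0 : ℝ) ∈ uIcc (-r) r := by rw [uIcc_of_le (by linarith)]; constructor <;> linarith
    have h1 := (hx (uIoc_subset_uIcc hxm) 0 h0).const_add (F 0)
    rw [show F = fun y => F 0 + ∫ t in (0 : ℝ)..y, g t from funext hF, h1.deriv]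
  simp only [smul_eq_mul]
  rw [integral_eq_intervalIntegral_of_support (f := fun y => deriv φ y * F y)
      (fun y hy => hs' y (left_ne_zero_of_mul hy)),
    integral_eq_intervalIntegral_of_support (f := fun y => φ y * g y)
      (fun y hy => hs y (left_ne_zero_of_mul hy)), ← hd, key]
  ring

/-- The primitive of a test function of mean zero is a test function. -/
theorem exists_deriv_eq_of_integral_eq_zero {θ : ℝ → ℝ} (hθ : ContDiff ℝ ∞ θ)
    (hc : HasCompactSupport θ) (h0 : ∫ y, θ y = 0) :
    ∃ φ : ℝ → ℝ, ContDiff ℝ ∞ φ ∧ HasCompactSupport φ ∧ deriv φ = θ := by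
  obtain ⟨R, hR, hs⟩ := exists_subset_Ioo_of_hasCompactSupport hc
  have hz : ∀ y, y ∉ Ioo (-R) R → θ y = 0 := fun y hy => by
    by_contra h; exact hy (hs y h)
  have hd : ∀ y, HasDerivAt (fun y => ∫ t in (-R)..y, θ t) (θ y) y := fun y =>
    intervalIntegral.integral_hasDerivAt_right (hθ.continuous.intervalIntegrable _ _)
      (hθ.continuous.stronglyMeasurableAtFilter _ _) hθ.continuous.continuousAt
  have hd' : deriv (fun y => ∫ t in (-R)..y, θ t) = θ := funext fun y => (hd y).deriv
  refine ⟨fun y => ∫ t in (-R)..y, θ t, ?_, ?_, hd'⟩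
  · rw [contDiff_infty_iff_deriv, hd']
    exact ⟨fun y => (hd y).differentiableAt, hθ⟩
  · refine HasCompactSupport.intro (isCompact_Icc (a := -R) (b := R)) fun y hy => ?_
    rw [mem_Icc, not_and_or, not_le, not_le] at hy
    rcases hy with hy | hy
    · refine (intervalIntegral.integral_congr (g := fun _ => (0 : ℝ)) fun t ht => ?_).trans (by simp)
      rw [uIcc_of_ge hy.le] at ht
      exact hz t fun h => by linarith [h.1, ht.2]
    · have h1 : ∫ t in (-R)..R, θ t = 0 := by
        rw [← h0, integral_eq_intervalIntegral_of_support hs]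
      have h2 : ∫ t in R..y, θ t = 0 := by
        refine (intervalIntegral.integral_congr (g := fun _ => (0 : ℝ)) fun t ht => ?_).trans
          (by simp)
        rw [uIcc_of_le hy.le] at ht
        exact hz t fun h => by linarith [h.2, ht.1]
      rw [← intervalIntegral.integral_add_adjacent_intervals
        (hθ.continuous.intervalIntegrable (-R) R) (hθ.continuous.intervalIntegrable R y), h1, h2,
        add_zero]

/-- A function with weak derivative `g` is almost everywhere a primitive of `g`. -/
theorem HasWeakDeriv.exists_ae_eq {f g : ℝ → ℝ} (h : HasWeakDeriv f g) :
    ∃ C : ℝ, ∀ᵐ y, f y = C + ∫ t in (0 : ℝ)..y, g t := by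
  obtain ⟨hf, hg, hfg⟩ := h
  obtain ⟨hF, -, hFg⟩ := hasWeakDeriv_of_eq_integral (F := fun y => ∫ t in (0 : ℝ)..y, g t) hg
    (by simp)
  have hh := hf.sub hF
  let η : ContDiffBump (0 : ℝ) := ⟨1, 2, by norm_num, by norm_num⟩
  set e : ℝ → ℝ := η.normed volume with he
  have he1 : ContDiff ℝ ∞ e := η.contDiff_normed
  have he2 : HasCompactSupport e := η.hasCompactSupport_normed
  have he3 : ∫ y, e y = 1 := η.integral_normed
  set C := ∫ y, e y * (f y - ∫ t in (0 : ℝ)..y, g t) with hC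
  have hint : ∀ θ : ℝ → ℝ, ContDiff ℝ ∞ θ → HasCompactSupport θ →
      Integrable (fun y => θ y * (f y - ∫ t in (0 : ℝ)..y, g t)) := fun θ h1 h2 =>
    hh.integrable_smul_left_of_hasCompactSupport h1.continuous h2
  refine ⟨C, ?_⟩
  have := ae_eq_of_integral_contDiff_smul_eq (μ := volume) hh
    (f' := fun _ : ℝ => C) (continuous_const.locallyIntegrable) fun θ hθ hθc => ?_
  · filter_upwards [this] with y hy
    simp only [Pi.sub_apply] at hy
    linarith
  · set m := ∫ y, θ y with hm
    have hi : Integrable θ := hθ.continuous.integrable_of_hasCompactSupport hθc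
    have hie : Integrable e := he1.continuous.integrable_of_hasCompactSupport he2
    have hc2 : HasCompactSupport fun y => m * e y := he2.mul_left
    -- Subtracting `m * e` makes the test function mean-free, hence a derivative `φ'`. Both `f` and
    -- the primitive of `g` pair with `φ'` to `-∫ φ g`, so their difference pairs with `θ` as the
    -- constant `C` does.
    obtain ⟨φ, h1, h2, h3⟩ := exists_deriv_eq_of_integral_eq_zero (θ := fun y => θ y - m * e y)
      (hθ.sub (contDiff_const.mul he1))
      (by simpa [sub_eq_add_neg] using! hθc.add hc2.neg) (by
        rw [integral_sub hi (hie.const_mul m), integral_const_mul, he3]; simp [hm])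
    have k1 := hfg φ h1 h2
    have k2 := hFg φ h1 h2
    rw [h3] at k1 k2
    simp only [smul_eq_mul, Pi.sub_apply] at *
    have i1 := hint θ hθ hθc
    have i2 := hint e he1 he2
    have ia : Integrable fun y => (θ y - m * e y) * f y := by
      have := congrFun h3
      simp only [← this]
      exact hf.integrable_smul_left_of_hasCompactSupport (h1.continuous_deriv (by norm_num)) h2.deriv
    have ib : Integrable fun y => (θ y - m * e y) * ∫ t in (0 : ℝ)..y, g t := by
      have := congrFun h3
      simp only [← this]
      exact hF.integrable_smul_left_of_hasCompactSupport (h1.continuous_deriv (by norm_num)) h2.deriv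
    have k3 : ∫ y, (θ y * (f y - ∫ t in (0 : ℝ)..y, g t)
        - m * (e y * (f y - ∫ t in (0 : ℝ)..y, g t))) = 0 := by
      have k4 := integral_sub ia ib
      rw [k1, k2, sub_self] at k4
      exact (integral_congr_ae (Eventually.of_forall fun y => by ring)).trans k4
    rw [integral_sub i1 (i2.const_mul m), integral_const_mul, ← hC] at k3
    rw [integral_mul_const]
    linarith

/-- The pointwise bound `|g| ≤ 1 + g²`, integrated over a length of at most one. -/
theorem abs_intervalIntegral_le_of_sq_integrable {g : ℝ → ℝ} (hg : MemLp g 2 volume) {x y : ℝ}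
    (h1 : x ≤ y) (h2 : y ≤ x + 1) : ∫ t in x..y, |g t| ≤ 1 + ∫ t, g t ^ 2 := by
  have hs := hg.integrable_sq
  have hgl : LocallyIntegrable g volume := hg.locallyIntegrable (by norm_num)
  calc ∫ t in x..y, |g t| ≤ ∫ t in x..y, (1 + g t ^ 2) := by
        refine intervalIntegral.integral_mono_on h1
          (hgl.integrableOn_isCompact isCompact_uIcc).intervalIntegrable.abs
          (intervalIntegrable_const.add hs.intervalIntegrable) fun t _ => ?_
        nlinarith [sq_nonneg (|g t| - 1), sq_abs (g t), abs_nonneg (g t)]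
    _ = (y - x) + ∫ t in x..y, g t ^ 2 := by
        rw [intervalIntegral.integral_add intervalIntegrable_const hs.intervalIntegrable]; simp
    _ ≤ 1 + ∫ t, g t ^ 2 := by
        have : ∫ t in x..y, g t ^ 2 ≤ ∫ t, g t ^ 2 := by
          rw [intervalIntegral.integral_of_le h1]
          exact setIntegral_le_integral hs (Eventually.of_forall fun t => sq_nonneg _)
        linarith

/-- Functions in `H¹(ℝ)` are essentially bounded. -/
theorem HasWeakDeriv.exists_ae_abs_le {f g : ℝ → ℝ} (h : HasWeakDeriv f g) (hf : MemLp f 2 volume)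
    (hg : MemLp g 2 volume) : ∃ K : ℝ, ∀ᵐ y, |f y| ≤ K := by
  obtain ⟨C, hC⟩ := h.exists_ae_eq
  have hgl := h.2.1
  have hgi : ∀ a b, IntervalIntegrable g volume a b := fun a b =>
    (hgl.integrableOn_isCompact isCompact_uIcc).intervalIntegrable
  set F : ℝ → ℝ := fun y => C + ∫ t in (0 : ℝ)..y, g t with hF
  have hFc : Continuous F := continuous_const.add (intervalIntegral.continuous_primitive (μ := volume) hgi 0)
  have hF2 : MemLp F 2 volume := hf.ae_eq hC
  refine ⟨(1 + ∫ t, F t ^ 2) + (1 + ∫ t, g t ^ 2), ?_⟩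
  filter_upwards [hC] with x hx
  rw [hx]
  -- Over a unit interval the primitive moves by at most `1 + ∫ g²`, so `|F x|` is controlled by the
  -- mean of `|F|` over that interval, and this mean by the `L²` norm.
  have h1 : ∀ y ∈ Icc x (x + 1), |F x| - (1 + ∫ t, g t ^ 2) ≤ |F y| := fun y hy => by
    have e : F y - F x = ∫ t in x..y, g t := by
      simp only [hF, add_sub_add_left_eq_sub]
      rw [intervalIntegral.integral_interval_sub_left (hgi _ _) (hgi _ _)]
    have e2 : |F y - F x| ≤ 1 + ∫ t, g t ^ 2 := by
      rw [e]
      exact (intervalIntegral.abs_integral_le_integral_abs hy.1).trans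
        (abs_intervalIntegral_le_of_sq_integrable hg hy.1 hy.2)
    have := abs_sub_abs_le_abs_sub (F x) (F y)
    rw [abs_sub_comm] at this
    linarith
  have h2 := intervalIntegral.integral_mono_on (μ := volume) (by linarith : x ≤ x + 1) intervalIntegrable_const
    (hFc.abs.intervalIntegrable x (x + 1)) h1
  have h3 := abs_intervalIntegral_le_of_sq_integrable hF2 (x := x) (y := x + 1) (by linarith) le_rfl
  simp only [intervalIntegral.integral_const, add_sub_cancel_left, smul_eq_mul, one_mul] at h2
  linarith

theorem abs_le_of_ae_abs_le {f : ℝ → ℝ} (hf : Continuous f) {K : ℝ} (h : ∀ᵐ y, |f y| ≤ K) (y : ℝ) :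
    |f y| ≤ K := by
  have hd : Dense {y | |f y| ≤ K} := Measure.dense_of_ae h
  have hcl : IsClosed {y | |f y| ≤ K} := isClosed_le hf.abs continuous_const
  have := hd.closure_eq
  rw [hcl.closure_eq] at this
  exact (this ▸ mem_univ y : y ∈ {y | |f y| ≤ K})

/-- A continuous function in `H²(ℝ)` is bounded and Lipschitz. -/
theorem exists_bound_lipschitz_of_memSobolev {f : ℝ → ℝ} (hf : Continuous f)
    (h : MemSobolev 2 2 f) :
    ∃ M L : ℝ, (∀ y, |f y| ≤ M) ∧ ∀ x y, |f x - f y| ≤ L * |x - y| := by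
  obtain ⟨h0, g, hg, hg2, g', hg', hg'2⟩ := h
  obtain ⟨M, hM⟩ := hg.exists_ae_abs_le h0 hg2
  obtain ⟨L, hL⟩ := hg'.exists_ae_abs_le hg2 hg'2
  refine ⟨M, L, abs_le_of_ae_abs_le hf hM, fun x y => ?_⟩
  obtain ⟨C, hC⟩ := hg.exists_ae_eq
  have hgi : ∀ a b, IntervalIntegrable g volume a b := fun a b =>
    (hg.2.1.integrableOn_isCompact isCompact_uIcc).intervalIntegrable
  have hFc : Continuous fun y => C + ∫ t in (0 : ℝ)..y, g t :=
    continuous_const.add (intervalIntegral.continuous_primitive (μ := volume) hgi 0)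
  have e := hf.ae_eq_iff_eq volume hFc |>.1 hC
  rw [e]
  simp only [add_sub_add_left_eq_sub]
  rw [intervalIntegral.integral_interval_sub_left (hgi _ _) (hgi _ _)]
  have := intervalIntegral.norm_integral_le_of_norm_le_const_ae (f := g) (a := y) (b := x) (C := L)
    (hL.mono fun t ht _ => by simpa using ht)
  simpa using this

/-! ### Normalised profiles and the Neumann series for `φ₁` -/

/-- A shear profile normalised at the critical point `0`, with quantitative bounds. -/
structure Profile (c M L : ℝ) (B : ℝ → ℝ) : Prop where
  pos : 0 < c
  contDiff : ContDiff ℝ 2 B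
  zero : B 0 = 0
  le_deriv : ∀ z, c ≤ deriv B z
  deriv_le : ∀ z, deriv B z ≤ c⁻¹
  abs_deriv2_le : ∀ z, |deriv (deriv B) z| ≤ M
  lipschitz : ∀ x y, |deriv (deriv B) x - deriv (deriv B) y| ≤ L * |x - y|

/-- The difference quotient `B z / z`, written as an average of the derivative. -/
noncomputable def slopeFn (B : ℝ → ℝ) (z : ℝ) : ℝ := ∫ s in (0 : ℝ)..1, deriv B (z * s)

/-- The quotient `B (x s) / B x`, extended to `x = 0`. -/
noncomputable def ratioFn (B : ℝ → ℝ) (x s : ℝ) : ℝ := s * slopeFn B (x * s) / slopeFn B x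

/-- The operator `f ↦ B⁻² ∫_0^x B² f`, in rescaled form. -/
noncomputable def innerOp (B f : ℝ → ℝ) (x : ℝ) : ℝ :=
  x * ∫ s in (0 : ℝ)..1, ratioFn B x s ^ 2 * f (x * s)

/-- The Volterra operator `f ↦ κ² ∫_0^z B⁻² ∫_0^x B² f`, in rescaled form. -/
noncomputable def volterraOp (κ : ℝ) (B f : ℝ → ℝ) (z : ℝ) : ℝ :=
  κ ^ 2 * (z * ∫ s in (0 : ℝ)..1, innerOp B f (z * s))

/-- The iterates of the Volterra operator on the constant function `1`. -/
noncomputable def phiTerm (κ : ℝ) (B : ℝ → ℝ) : ℕ → ℝ → ℝ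
  | 0 => fun _ => 1
  | n + 1 => volterraOp κ B (phiTerm κ B n)

/-- The Neumann series solving `φ = 1 + volterraOp φ`. -/
noncomputable def phiFn (κ : ℝ) (B : ℝ → ℝ) (z : ℝ) : ℝ := ∑' n, phiTerm κ B n z

section Continuity

variable {X : Type*} [TopologicalSpace X] {B : X → ℝ → ℝ}

/-- The parameter space `X` is kept general so that one proof serves a single profile (`X = Unit`)
and the family indexed by scale and centre. -/
theorem continuous_slopeFn (hB : Continuous fun q : X × ℝ => deriv (B q.1) q.2) :
    Continuous fun q : X × ℝ => slopeFn (B q.1) q.2 := by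
  refine intervalIntegral.continuous_parametric_intervalIntegral_of_continuous'
    (f := fun (q : X × ℝ) s => deriv (B q.1) (q.2 * s)) ?_ 0 1
  exact hB.comp (f := fun r : (X × ℝ) × ℝ => (r.1.1, r.1.2 * r.2)) (by fun_prop)

theorem continuous_ratioFn (hB : Continuous fun q : X × ℝ => deriv (B q.1) q.2)
    (h0 : ∀ p z, slopeFn (B p) z ≠ 0) :
    Continuous fun r : (X × ℝ) × ℝ => ratioFn (B r.1.1) r.1.2 r.2 := by
  have h := continuous_slopeFn hB
  refine Continuous.div (continuous_snd.mul
    (h.comp (f := fun r : (X × ℝ) × ℝ => (r.1.1, r.1.2 * r.2)) (by fun_prop)))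
    (h.comp (f := fun r : (X × ℝ) × ℝ => r.1) (by fun_prop)) fun r => h0 _ _

theorem continuous_innerOp (hB : Continuous fun q : X × ℝ => deriv (B q.1) q.2)
    (h0 : ∀ p z, slopeFn (B p) z ≠ 0) {f : X → ℝ → ℝ} (hf : Continuous fun q : X × ℝ => f q.1 q.2) :
    Continuous fun q : X × ℝ => innerOp (B q.1) (f q.1) q.2 := by
  refine continuous_snd.mul (intervalIntegral.continuous_parametric_intervalIntegral_of_continuous'
    (f := fun (q : X × ℝ) s => ratioFn (B q.1) q.2 s ^ 2 * f q.1 (q.2 * s)) ?_ 0 1)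
  exact ((continuous_ratioFn hB h0).pow 2).mul
    (hf.comp (f := fun r : (X × ℝ) × ℝ => (r.1.1, r.1.2 * r.2)) (by fun_prop))

theorem continuous_volterraOp (κ : ℝ) (hB : Continuous fun q : X × ℝ => deriv (B q.1) q.2)
    (h0 : ∀ p z, slopeFn (B p) z ≠ 0) {f : X → ℝ → ℝ} (hf : Continuous fun q : X × ℝ => f q.1 q.2) :
    Continuous fun q : X × ℝ => volterraOp κ (B q.1) (f q.1) q.2 := by
  refine continuous_const.mul (continuous_snd.mul
    (intervalIntegral.continuous_parametric_intervalIntegral_of_continuous'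
    (f := fun (q : X × ℝ) s => innerOp (B q.1) (f q.1) (q.2 * s)) ?_ 0 1))
  exact (continuous_innerOp hB h0 hf).comp
    (f := fun r : (X × ℝ) × ℝ => (r.1.1, r.1.2 * r.2)) (by fun_prop)

theorem continuous_phiTerm (κ : ℝ) (hB : Continuous fun q : X × ℝ => deriv (B q.1) q.2)
    (h0 : ∀ p z, slopeFn (B p) z ≠ 0) (n : ℕ) :
    Continuous fun q : X × ℝ => phiTerm κ (B q.1) n q.2 := by
  induction n with
  | zero => exact continuous_const
  | succ n ih => exact continuous_volterraOp κ hB h0 (f := fun p => phiTerm κ (B p) n) ih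

end Continuity

namespace Profile

variable {c M L : ℝ} {B : ℝ → ℝ}

theorem continuous (h : Profile c M L B) : Continuous B := h.contDiff.continuous

theorem hasDerivAt (h : Profile c M L B) (z : ℝ) : HasDerivAt B (deriv B z) z :=
  (h.contDiff.differentiable (by norm_num) z).hasDerivAt

theorem contDiff_deriv (h : Profile c M L B) : ContDiff ℝ 1 (deriv B) :=
  (contDiff_succ_iff_deriv (n := 1) (𝕜 := ℝ) |>.1 h.contDiff).2.2

theorem continuous_deriv (h : Profile c M L B) : Continuous (deriv B) := h.contDiff_deriv.continuous

theorem hasDerivAt_deriv (h : Profile c M L B) (z : ℝ) :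
    HasDerivAt (deriv B) (deriv (deriv B) z) z :=
  (h.contDiff_deriv.differentiable (by norm_num) z).hasDerivAt

theorem continuous_deriv2 (h : Profile c M L B) : Continuous (deriv (deriv B)) :=
  h.contDiff_deriv.continuous_deriv le_rfl

theorem deriv_pos (h : Profile c M L B) (z : ℝ) : 0 < deriv B z := h.pos.trans_le (h.le_deriv z)

theorem strictMono (h : Profile c M L B) : StrictMono B := strictMono_of_deriv_pos h.deriv_pos

theorem eq_mul_slopeFn (h : Profile c M L B) (z : ℝ) : B z = z * slopeFn B z := by
  rw [slopeFn, intervalIntegral.mul_integral_comp_mul_left (f := deriv B), mul_zero, mul_one,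
    intervalIntegral.integral_eq_sub_of_hasDerivAt (fun x _ => h.hasDerivAt x)
      (h.continuous_deriv.intervalIntegrable _ _), h.zero, sub_zero]

theorem le_slopeFn (h : Profile c M L B) (z : ℝ) : c ≤ slopeFn B z := by
  have := intervalIntegral.integral_mono_on (μ := volume) zero_le_one intervalIntegrable_const
    ((h.continuous_deriv.comp (continuous_const.mul continuous_id)).intervalIntegrable 0 1)
    (fun s _ => h.le_deriv (z * s))
  simpa using! this

theorem slopeFn_le (h : Profile c M L B) (z : ℝ) : slopeFn B z ≤ c⁻¹ := by
  have := intervalIntegral.integral_mono_on (μ := volume) zero_le_one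
    ((h.continuous_deriv.comp (continuous_const.mul continuous_id)).intervalIntegrable 0 1)
    intervalIntegrable_const (fun s _ => h.deriv_le (z * s))
  simpa using! this

theorem slopeFn_pos (h : Profile c M L B) (z : ℝ) : 0 < slopeFn B z :=
  h.pos.trans_le (h.le_slopeFn z)

theorem sq_le (h : Profile c M L B) (z : ℝ) : c ^ 2 * z ^ 2 ≤ B z ^ 2 := by
  rw [h.eq_mul_slopeFn, mul_pow, mul_comm]
  have := pow_le_pow_left₀ h.pos.le (h.le_slopeFn z) 2
  gcongr

theorem abs_le (h : Profile c M L B) (z : ℝ) : |B z| ≤ c⁻¹ * |z| := by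
  rw [h.eq_mul_slopeFn, abs_mul, abs_of_pos (h.slopeFn_pos z), mul_comm]
  exact mul_le_mul_of_nonneg_right (h.slopeFn_le z) (abs_nonneg z)

theorem le_abs (h : Profile c M L B) (z : ℝ) : c * |z| ≤ |B z| := by
  rw [h.eq_mul_slopeFn, abs_mul, abs_of_pos (h.slopeFn_pos z), mul_comm]
  exact mul_le_mul_of_nonneg_left (h.le_slopeFn z) (abs_nonneg z)

theorem ne_zero (h : Profile c M L B) {z : ℝ} (hz : z ≠ 0) : B z ≠ 0 := by
  rw [h.eq_mul_slopeFn]; exact mul_ne_zero hz (h.slopeFn_pos z).ne'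

theorem c_le_one (h : Profile c M L B) : c ≤ 1 := by
  by_contra! hc
  have := (h.le_deriv 0).trans (h.deriv_le 0)
  have := inv_lt_one_of_one_lt₀ hc
  linarith

theorem mul_ratioFn (h : Profile c M L B) (x s : ℝ) : B x * ratioFn B x s = B (x * s) := by
  rw [h.eq_mul_slopeFn x, h.eq_mul_slopeFn (x * s), ratioFn]
  field_simp [(h.slopeFn_pos x).ne']

theorem ratioFn_nonneg (h : Profile c M L B) (x : ℝ) {s : ℝ} (hs : 0 ≤ s) : 0 ≤ ratioFn B x s :=
  div_nonneg (mul_nonneg hs (h.slopeFn_pos _).le) (h.slopeFn_pos x).le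

/-- Since `B` increases through `0`, the value `B (x s)` does not pass `B x`. At `x = 0` the ratio
is `s` itself. -/
theorem ratioFn_le_one (h : Profile c M L B) (x : ℝ) {s : ℝ} (hs1 : s ≤ 1) :
    ratioFn B x s ≤ 1 := by
  rcases eq_or_ne x 0 with rfl | hx
  · rw [ratioFn, zero_mul, mul_div_assoc, div_self (h.slopeFn_pos 0).ne', mul_one]; exact hs1
  · have e := h.mul_ratioFn x s
    rcases hx.lt_or_gt with hx | hx
    · have h1 : B x < 0 := h.zero ▸ h.strictMono hx
      have h2 : B x ≤ B (x * s) := h.strictMono.monotone (by nlinarith)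
      by_contra! h3
      nlinarith
    · have h1 : 0 < B x := h.zero ▸ h.strictMono hx
      have h2 : B (x * s) ≤ B x := h.strictMono.monotone (by nlinarith)
      by_contra! h3
      nlinarith

theorem le_ratioFn (h : Profile c M L B) (x : ℝ) {s : ℝ} (hs : 0 ≤ s) :
    c ^ 2 * s ≤ ratioFn B x s := by
  rw [ratioFn, le_div_iff₀ (h.slopeFn_pos x)]
  have h1 := h.le_slopeFn (x * s)
  have h2 := h.slopeFn_le x
  have h3 : c * slopeFn B x ≤ 1 := by
    calc c * slopeFn B x ≤ c * c⁻¹ := mul_le_mul_of_nonneg_left h2 h.pos.le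
      _ = 1 := mul_inv_cancel₀ h.pos.ne'
  calc c ^ 2 * s * slopeFn B x = c * s * (c * slopeFn B x) := by ring
    _ ≤ c * s * 1 := mul_le_mul_of_nonneg_left h3 (mul_nonneg h.pos.le hs)
    _ = s * c := by ring
    _ ≤ s * slopeFn B (x * s) := mul_le_mul_of_nonneg_left h1 hs

theorem continuous_const_param (h : Profile c M L B) :
    Continuous fun q : Unit × ℝ => deriv ((fun _ : Unit => B) q.1) q.2 :=
  h.continuous_deriv.comp continuous_snd

theorem continuous_ratioFn (h : Profile c M L B) (x : ℝ) : Continuous (ratioFn B x) :=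
  (ShearFlow.continuous_ratioFn h.continuous_const_param fun _ z => (h.slopeFn_pos z).ne').comp
    (Continuous.prodMk_right ((), x))

theorem continuous_innerOp (h : Profile c M L B) {f : ℝ → ℝ} (hf : Continuous f) :
    Continuous (innerOp B f) :=
  (ShearFlow.continuous_innerOp h.continuous_const_param (fun _ z => (h.slopeFn_pos z).ne')
    (f := fun _ => f) (hf.comp continuous_snd)).comp (Continuous.prodMk_right ())

theorem continuous_phiTerm (h : Profile c M L B) (κ : ℝ) (n : ℕ) : Continuous (phiTerm κ B n) :=
  (ShearFlow.continuous_phiTerm κ h.continuous_const_param (fun _ z => (h.slopeFn_pos z).ne')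
    n).comp (Continuous.prodMk_right ())

theorem abs_innerOp_le (h : Profile c M L B) {f : ℝ → ℝ} {a x : ℝ} {m : ℕ}
    (hf : ∀ y, |y| ≤ |x| → |f y| ≤ a * |y| ^ m) : |innerOp B f x| ≤ a / (m + 1) * |x| ^ (m + 1) := by
  rw [innerOp, abs_mul]
  have h1 : ‖∫ s in (0 : ℝ)..1, ratioFn B x s ^ 2 * f (x * s)‖
      ≤ ∫ s in (0 : ℝ)..1, a * |x| ^ m * s ^ m := by
    refine intervalIntegral.norm_integral_le_of_norm_le zero_le_one
      (Eventually.of_forall fun s hs => ?_) (Continuous.intervalIntegrable (by fun_prop) _ _)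
    rw [Real.norm_eq_abs, abs_mul, abs_of_nonneg (sq_nonneg _)]
    have hs0 := hs.1.le
    have h2 : ratioFn B x s ^ 2 ≤ 1 :=
      pow_le_one₀ (h.ratioFn_nonneg x hs0) (h.ratioFn_le_one x hs.2)
    have h3 := hf (x * s) (by
      rw [abs_mul, abs_of_nonneg hs0]; exact mul_le_of_le_one_right (abs_nonneg _) hs.2)
    rw [abs_mul x s, abs_of_nonneg hs0, mul_pow, ← mul_assoc] at h3
    calc ratioFn B x s ^ 2 * |f (x * s)| ≤ 1 * |f (x * s)| :=
          mul_le_mul_of_nonneg_right h2 (abs_nonneg _)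
      _ ≤ _ := by rw [one_mul]; exact h3
  rw [intervalIntegral.integral_const_mul, integral_pow, one_pow, zero_pow (by omega), sub_zero,
    Real.norm_eq_abs] at h1
  calc |x| * |∫ s in (0 : ℝ)..1, ratioFn B x s ^ 2 * f (x * s)|
      ≤ |x| * (a * |x| ^ m * (1 / (m + 1))) := mul_le_mul_of_nonneg_left h1 (abs_nonneg x)
    _ = _ := by ring

/-- Two integrations of a power raise its degree by two and gain `1/((m+1)(m+2))`; the weight
`ratioFn²` is at most one. This is the factor that turns the iterates into the terms of a cosh
series. -/
theorem abs_volterraOp_le (h : Profile c M L B) (κ : ℝ) {f : ℝ → ℝ} {a z : ℝ} {m : ℕ}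
    (hf : ∀ y, |y| ≤ |z| → |f y| ≤ a * |y| ^ m) :
    |volterraOp κ B f z| ≤ κ ^ 2 * a / ((m + 1) * (m + 2)) * |z| ^ (m + 2) := by
  rw [volterraOp, abs_mul, abs_mul, abs_of_nonneg (sq_nonneg κ)]
  have h1 : ‖∫ s in (0 : ℝ)..1, innerOp B f (z * s)‖
      ≤ ∫ s in (0 : ℝ)..1, a / (m + 1) * |z| ^ (m + 1) * s ^ (m + 1) := by
    refine intervalIntegral.norm_integral_le_of_norm_le zero_le_one
      (Eventually.of_forall fun s hs => ?_) (Continuous.intervalIntegrable (by fun_prop) _ _)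
    have hs0 := hs.1.le
    have h4 : |z * s| ≤ |z| := by
      rw [abs_mul, abs_of_nonneg hs0]; exact mul_le_of_le_one_right (abs_nonneg _) hs.2
    have h3 := h.abs_innerOp_le (x := z * s) fun y hy => hf y (hy.trans h4)
    rw [abs_mul z s, abs_of_nonneg hs0, mul_pow, ← mul_assoc] at h3
    exact h3
  rw [intervalIntegral.integral_const_mul, integral_pow, one_pow, zero_pow (by omega), sub_zero,
    Real.norm_eq_abs] at h1
  push_cast at h1
  calc κ ^ 2 * (|z| * |∫ s in (0 : ℝ)..1, innerOp B f (z * s)|)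
      ≤ κ ^ 2 * (|z| * (a / (m + 1) * |z| ^ (m + 1) * (1 / ((m : ℝ) + 1 + 1)))) := by gcongr
    _ = _ := by
      rw [show (m : ℝ) + 1 + 1 = m + 2 by ring]
      field_simp
      ring

/-- Stated for any sequence generated by the operator because it is used twice: on the iterates of
`1` for convergence, and on the constant sequence of a fixed point for uniqueness. -/
theorem abs_iterate_le (h : Profile c M L B) (κ : ℝ) {F : ℕ → ℝ → ℝ} {A R : ℝ}
    (h0 : ∀ y, |y| ≤ R → |F 0 y| ≤ A) (hs : ∀ n, F (n + 1) = volterraOp κ B (F n)) (n : ℕ) :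
    ∀ y, |y| ≤ R → |F n y| ≤ A * κ ^ (2 * n) / (2 * n).factorial * |y| ^ (2 * n) := by
  induction n with
  | zero => simpa using h0
  | succ n ih =>
    intro y hy
    rw [hs]
    refine (h.abs_volterraOp_le κ fun z hz => ih z (hz.trans hy)).trans (le_of_eq ?_)
    rw [show 2 * (n + 1) = 2 * n + 1 + 1 by ring, Nat.factorial_succ, Nat.factorial_succ]
    push_cast
    field_simp
    ring

theorem abs_phiTerm_le (h : Profile c M L B) (κ : ℝ) (n : ℕ) (y : ℝ) :
    |phiTerm κ B n y| ≤ (κ * |y|) ^ (2 * n) / (2 * n).factorial := by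
  have := h.abs_iterate_le κ (F := phiTerm κ B) (A := 1) (R := |y|) (by simp [phiTerm])
    (fun _ => rfl) n y le_rfl
  rwa [one_mul, div_mul_eq_mul_div, ← mul_pow] at this

theorem abs_phiTerm_le_of_le (h : Profile c M L B) (κ : ℝ) (n : ℕ) {y R : ℝ} (hy : |y| ≤ R) :
    |phiTerm κ B n y| ≤ (κ * R) ^ (2 * n) / (2 * n).factorial := by
  refine (h.abs_phiTerm_le κ n y).trans ?_
  rw [mul_pow, mul_pow]
  have : 0 ≤ κ ^ (2 * n) := by rw [pow_mul]; positivity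
  gcongr

theorem summable_phiTerm (h : Profile c M L B) (κ z : ℝ) : Summable fun n => phiTerm κ B n z :=
  Summable.of_norm_bounded (Real.hasSum_cosh (κ * |z|)).summable fun n => by
    simpa using h.abs_phiTerm_le κ n z

theorem abs_phiFn_le (h : Profile c M L B) (κ : ℝ) {z R : ℝ} (hz : |z| ≤ R) :
    |phiFn κ B z| ≤ Real.cosh (κ * R) := by
  rw [← Real.norm_eq_abs, phiFn]
  exact tsum_of_norm_bounded (Real.hasSum_cosh (κ * R)) fun n => by
    simpa using h.abs_phiTerm_le_of_le κ n hz

end Profile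

/-- Weierstrass test on `|z| < |z₀| + 1`: the cosh majorant is the same for every profile. -/
theorem continuous_phiFn {X : Type*} [TopologicalSpace X] {B : X → ℝ → ℝ} {c M L : ℝ} (κ : ℝ)
    (hp : ∀ p, Profile c M L (B p)) (hB : Continuous fun q : X × ℝ => deriv (B q.1) q.2) :
    Continuous fun q : X × ℝ => phiFn κ (B q.1) q.2 := by
  rw [continuous_iff_continuousAt]
  intro q
  have hU : {r : X × ℝ | |r.2| < |q.2| + 1} ∈ 𝓝 q :=
    (isOpen_lt (by fun_prop) continuous_const).mem_nhds (by simp)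
  refine ContinuousOn.continuousAt (s := {r : X × ℝ | |r.2| < |q.2| + 1}) ?_ hU
  refine continuousOn_tsum (fun n => (continuous_phiTerm κ hB
    (fun p z => ((hp p).slopeFn_pos z).ne') n).continuousOn)
    (Real.hasSum_cosh (κ * (|q.2| + 1))).summable fun n r hr => ?_
  simpa using (hp r.1).abs_phiTerm_le_of_le κ n (le_of_lt hr)

/-! ### The equation for `φ₁`: existence, uniqueness, growth -/

namespace Profile

variable {c M L : ℝ} {B : ℝ → ℝ}

theorem continuous_phiFn (h : Profile c M L B) (κ : ℝ) : Continuous (phiFn κ B) :=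
  (ShearFlow.continuous_phiFn κ (fun _ : Unit => h) h.continuous_const_param).comp
    (Continuous.prodMk_right ())

theorem abs_innerOp_le_mul (h : Profile c M L B) {f : ℝ → ℝ} {a x : ℝ}
    (hf : ∀ y, |y| ≤ |x| → |f y| ≤ a) : |innerOp B f x| ≤ a * |x| := by
  simpa using h.abs_innerOp_le (m := 0) (a := a) (x := x) (by simpa using hf)

theorem hasSum_innerOp (h : Profile c M L B) {F : ℕ → ℝ → ℝ} {u : ℕ → ℝ} {x : ℝ}
    (hF : ∀ n, Continuous (F n)) (hu : Summable u) (hb : ∀ n y, |y| ≤ |x| → |F n y| ≤ u n) :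
    HasSum (fun n => innerOp B (F n) x) (innerOp B (fun y => ∑' n, F n y) x) := by
  refine HasSum.mul_left x ?_
  refine intervalIntegral.hasSum_integral_of_dominated_convergence (fun n _ => u n)
    (fun n => (((h.continuous_ratioFn x).pow 2).mul
      ((hF n).comp (continuous_const.mul continuous_id))).aestronglyMeasurable)
    (fun n => Eventually.of_forall fun s hs => ?_) (Eventually.of_forall fun s _ => hu)
    intervalIntegrable_const (Eventually.of_forall fun s hs => ?_)
  all_goals
    rw [uIoc_of_le zero_le_one] at hs
    have h4 : |x * s| ≤ |x| := by
      rw [abs_mul, abs_of_nonneg hs.1.le]; exact mul_le_of_le_one_right (abs_nonneg _) hs.2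
  · have h2 : ratioFn B x s ^ 2 ≤ 1 :=
      pow_le_one₀ (h.ratioFn_nonneg x hs.1.le) (h.ratioFn_le_one x hs.2)
    rw [Real.norm_eq_abs, abs_mul, abs_of_nonneg (sq_nonneg _)]
    calc ratioFn B x s ^ 2 * |F n (x * s)| ≤ 1 * |F n (x * s)| :=
          mul_le_mul_of_nonneg_right h2 (abs_nonneg _)
      _ ≤ u n := by rw [one_mul]; exact hb n _ h4
  · have hs' : Summable fun n => F n (x * s) := Summable.of_norm_bounded hu fun n => hb n _ h4
    exact hs'.hasSum.mul_left (ratioFn B x s ^ 2)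

theorem hasSum_volterraOp (h : Profile c M L B) (κ : ℝ) {F : ℕ → ℝ → ℝ} {u : ℕ → ℝ} {z : ℝ}
    (hF : ∀ n, Continuous (F n)) (hu : Summable u) (hb : ∀ n y, |y| ≤ |z| → |F n y| ≤ u n) :
    HasSum (fun n => volterraOp κ B (F n) z) (volterraOp κ B (fun y => ∑' n, F n y) z) := by
  refine HasSum.mul_left (κ ^ 2) (HasSum.mul_left z ?_)
  refine intervalIntegral.hasSum_integral_of_dominated_convergence (fun n _ => u n * |z|)
    (fun n => ((h.continuous_innerOp (hF n)).comp
      (continuous_const.mul continuous_id)).aestronglyMeasurable)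
    (fun n => Eventually.of_forall fun s hs => ?_)
    (Eventually.of_forall fun s _ => hu.mul_right _)
    intervalIntegrable_const (Eventually.of_forall fun s hs => ?_)
  all_goals
    rw [uIoc_of_le zero_le_one] at hs
    have h4 : |z * s| ≤ |z| := by
      rw [abs_mul, abs_of_nonneg hs.1.le]; exact mul_le_of_le_one_right (abs_nonneg _) hs.2
  · refine (h.abs_innerOp_le_mul fun y hy => hb n y (hy.trans h4)).trans ?_
    exact mul_le_mul_of_nonneg_left h4 ((abs_nonneg _).trans (hb n 0 (by simp)))
  · exact h.hasSum_innerOp hF hu fun n y hy => hb n y (hy.trans h4)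

/-- Applying the operator termwise shifts the Neumann series by one index. -/
theorem phiFn_eq (h : Profile c M L B) (κ z : ℝ) :
    phiFn κ B z = 1 + volterraOp κ B (phiFn κ B) z := by
  have h1 := h.hasSum_volterraOp κ (z := z) (h.continuous_phiTerm κ)
    (Real.hasSum_cosh (κ * |z|)).summable fun n y hy => h.abs_phiTerm_le_of_le κ n hy
  rw [phiFn, (h.summable_phiTerm κ z).tsum_eq_zero_add]
  congr 1
  exact h1.tsum_eq

theorem hasDerivAt_volterraOp (h : Profile c M L B) (κ : ℝ) {f : ℝ → ℝ} (hf : Continuous f) (z : ℝ) :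
    HasDerivAt (volterraOp κ B f) (κ ^ 2 * innerOp B f z) z := by
  have e : volterraOp κ B f = fun z => κ ^ 2 * ∫ x in (0 : ℝ)..z, innerOp B f x := by
    funext z
    rw [volterraOp, intervalIntegral.mul_integral_comp_mul_left (f := innerOp B f), mul_zero,
      mul_one]
  have hc := h.continuous_innerOp hf
  rw [e]
  exact (intervalIntegral.integral_hasDerivAt_right (hc.intervalIntegrable _ _)
    (hc.stronglyMeasurableAtFilter _ _) hc.continuousAt).const_mul _

/-- Undoes the rescaling `u = x s`, which was there to avoid dividing by `B x` at `x = 0`. -/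
theorem sq_mul_innerOp (h : Profile c M L B) (f : ℝ → ℝ) (x : ℝ) :
    B x ^ 2 * innerOp B f x = ∫ u in (0 : ℝ)..x, B u ^ 2 * f u := by
  have e := intervalIntegral.mul_integral_comp_mul_left (f := fun u => B u ^ 2 * f u)
    (a := 0) (b := 1) (c := x)
  rw [mul_zero, mul_one] at e
  rw [← e, innerOp, mul_left_comm, ← intervalIntegral.integral_const_mul]
  simp only [← h.mul_ratioFn x]
  congr 1
  exact intervalIntegral.integral_congr fun s _ => by ring

theorem hasDerivAt_phiFn (h : Profile c M L B) (κ z : ℝ) :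
    HasDerivAt (phiFn κ B) (κ ^ 2 * innerOp B (phiFn κ B) z) z := by
  have := (h.hasDerivAt_volterraOp κ (h.continuous_phiFn κ) z).const_add 1
  exact this.congr_of_eventuallyEq (Eventually.of_forall fun y => h.phiFn_eq κ y)

theorem deriv_phiFn (h : Profile c M L B) (κ : ℝ) :
    deriv (phiFn κ B) = fun z => κ ^ 2 * innerOp B (phiFn κ B) z :=
  funext fun z => (h.hasDerivAt_phiFn κ z).deriv

theorem continuous_deriv_phiFn (h : Profile c M L B) (κ : ℝ) : Continuous (deriv (phiFn κ B)) := by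
  rw [h.deriv_phiFn]; exact continuous_const.mul (h.continuous_innerOp (h.continuous_phiFn κ))

theorem phiFn_zero (h : Profile c M L B) (κ : ℝ) : phiFn κ B 0 = 1 := by
  rw [h.phiFn_eq]; simp [volterraOp]

theorem isPhi1_phiFn (h : Profile c M L B) (k : ℤ) : IsPhi1 B k 0 (phiFn k B) := by
  refine ⟨contDiff_one_iff_deriv.2 ⟨fun z => (h.hasDerivAt_phiFn k z).differentiableAt,
    h.continuous_deriv_phiFn k⟩, fun y => ?_, h.phiFn_zero k, by simp [h.deriv_phiFn, innerOp]⟩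
  have hc : Continuous fun u => B u ^ 2 * phiFn k B u :=
    (h.continuous.pow 2).mul (h.continuous_phiFn k)
  have e : (fun z => (B z - B 0) ^ 2 * deriv (phiFn k B) z) =
      fun z => (k : ℝ) ^ 2 * ∫ u in (0 : ℝ)..z, B u ^ 2 * phiFn k B u := by
    funext z
    rw [← h.sq_mul_innerOp, h.deriv_phiFn, h.zero]; ring
  rw [e, h.zero, sub_zero, mul_assoc]
  exact (intervalIntegral.integral_hasDerivAt_right (hc.intervalIntegrable _ _)
    (hc.stronglyMeasurableAtFilter _ _) hc.continuousAt).const_mul _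

/-- Integrate the divergence form from `0` and divide by `B²` away from `0`; at `0` itself `φ' = 0`
is part of the initial data. Then integrate once more. -/
theorem eq_add_volterraOp_of_isPhi1 (h : Profile c M L B) {k : ℤ} {φ : ℝ → ℝ}
    (hφ : IsPhi1 B k 0 φ) (z : ℝ) : φ z = 1 + volterraOp k B φ z := by
  obtain ⟨h1, h2, h3, h4⟩ := hφ
  simp only [h.zero, sub_zero] at h2
  have hc := h1.continuous
  have hd : ∀ x, deriv φ x = (k : ℝ) ^ 2 * innerOp B φ x := fun x => by
    rcases eq_or_ne x 0 with rfl | hx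
    · rw [h4]; simp [innerOp]
    · have e := intervalIntegral.integral_eq_sub_of_hasDerivAt (a := 0) (b := x)
        (fun y _ => h2 y) (Continuous.intervalIntegrable
          ((continuous_const.mul (h.continuous.pow 2)).mul hc) _ _)
      simp only [mul_assoc] at e
      rw [intervalIntegral.integral_const_mul, ← h.sq_mul_innerOp, h4, mul_zero, sub_zero] at e
      have := pow_ne_zero 2 (h.ne_zero hx)
      apply mul_left_cancel₀ this
      rw [← e]; ring
  have hD : ∀ x, HasDerivAt (fun x => φ x - volterraOp k B φ x) 0 x := fun x => by
    have := ((h1.differentiable (by norm_num) x).hasDerivAt).sub (h.hasDerivAt_volterraOp k hc x)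
    rwa [hd, sub_self] at this
  have := is_const_of_deriv_eq_zero (fun x => (hD x).differentiableAt) (fun x => (hD x).deriv) z 0
  simp only [h3, volterraOp, zero_mul, mul_zero, sub_zero] at this
  rw [volterraOp]
  linarith

theorem volterraOp_sub (h : Profile c M L B) (κ : ℝ) {f g : ℝ → ℝ} (hf : Continuous f)
    (hg : Continuous g) :
    volterraOp κ B (fun z => f z - g z) = fun z => volterraOp κ B f z - volterraOp κ B g z := by
  have hi : ∀ x, innerOp B (fun z => f z - g z) x = innerOp B f x - innerOp B g x := fun x => by
    have hr := (h.continuous_ratioFn x).pow 2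
    rw [innerOp, innerOp, innerOp, ← mul_sub, ← intervalIntegral.integral_sub]
    · simp only [mul_sub]
    · exact (hr.mul (hf.comp (continuous_const.mul continuous_id))).intervalIntegrable _ _
    · exact (hr.mul (hg.comp (continuous_const.mul continuous_id))).intervalIntegrable _ _
  funext z
  simp only [volterraOp, hi]
  rw [intervalIntegral.integral_sub]
  · ring
  · exact ((h.continuous_innerOp hf).comp
      (continuous_const.mul continuous_id)).intervalIntegrable _ _
  · exact ((h.continuous_innerOp hg).comp
      (continuous_const.mul continuous_id)).intervalIntegrable _ _

/-- The difference of two solutions is fixed by the Volterra operator, hence bounded on `|y| ≤ |z|`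
by `A (k|y|)^(2n)/(2n)!` for every `n`. -/
theorem eq_phiFn_of_isPhi1 (h : Profile c M L B) {k : ℤ} {φ : ℝ → ℝ} (hφ : IsPhi1 B k 0 φ) :
    φ = phiFn k B := by
  set d : ℝ → ℝ := fun z => φ z - phiFn k B z with hd
  have hφc := hφ.1.continuous
  have hdc : Continuous d := hφc.sub (h.continuous_phiFn k)
  have hfix : volterraOp k B d = d := by
    rw [hd, h.volterraOp_sub k hφc (h.continuous_phiFn k)]
    funext z
    rw [h.eq_add_volterraOp_of_isPhi1 hφ z, h.phiFn_eq k z]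
    ring
  funext z
  obtain ⟨A, hA⟩ := (isCompact_Icc (a := -|z|) (b := |z|)).exists_bound_of_continuousOn
    hdc.continuousOn
  have hb := fun n => h.abs_iterate_le k (F := fun _ => d) (A := A) (R := |z|)
    (fun y hy => hA y (_root_.abs_le.1 hy)) (fun _ => hfix.symm) n z le_rfl
  have hlim : Tendsto (fun n => A * ((k * |z|) ^ (2 * n) / (2 * n).factorial)) atTop (𝓝 (A * 0)) :=
    (Real.hasSum_cosh (k * |z|)).summable.tendsto_atTop_zero.const_mul A
  rw [mul_zero] at hlim
  have : |d z| ≤ 0 := ge_of_tendsto' hlim fun n => (hb n).trans (le_of_eq (by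
    rw [mul_pow]; ring))
  exact sub_eq_zero.1 (abs_nonpos_iff.1 this)

theorem phi1_eq (h : Profile c M L B) (k : ℤ) : phi1 B k 0 = phiFn k B :=
  h.eq_phiFn_of_isPhi1 (Classical.epsilon_spec (p := IsPhi1 B k 0) ⟨_, h.isPhi1_phiFn k⟩)

theorem integral_nonneg_of_nonneg {f : ℝ → ℝ} (hf : ∀ s, 0 ≤ s → s ≤ 1 → 0 ≤ f s) :
    0 ≤ ∫ s in (0 : ℝ)..1, f s :=
  intervalIntegral.integral_nonneg zero_le_one fun s hs => hf s hs.1 hs.2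

theorem innerOp_integral_nonneg {f : ℝ → ℝ} (hf : ∀ y, 0 ≤ f y) (x : ℝ) :
    0 ≤ ∫ s in (0 : ℝ)..1, ratioFn B x s ^ 2 * f (x * s) :=
  integral_nonneg_of_nonneg fun _ _ _ => mul_nonneg (sq_nonneg _) (hf _)

theorem volterraOp_nonneg (κ : ℝ) {f : ℝ → ℝ} (hf : ∀ y, 0 ≤ f y) (z : ℝ) :
    0 ≤ volterraOp κ B f z := by
  refine mul_nonneg (sq_nonneg κ) ?_
  rw [← intervalIntegral.integral_const_mul]
  refine integral_nonneg_of_nonneg fun s hs _ => ?_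
  rw [innerOp, ← mul_assoc, ← mul_assoc]
  exact mul_nonneg (mul_nonneg (mul_self_nonneg z) hs) (innerOp_integral_nonneg hf _)

theorem phiTerm_nonneg (κ : ℝ) (n : ℕ) : ∀ z, 0 ≤ phiTerm κ B n z := by
  induction n with
  | zero => exact fun _ => zero_le_one
  | succ n ih => exact volterraOp_nonneg κ ih

theorem one_le_phiFn (h : Profile c M L B) (κ z : ℝ) : 1 ≤ phiFn κ B z := by
  have h0 : ∀ y, 0 ≤ phiFn κ B y := fun y => tsum_nonneg fun n => phiTerm_nonneg κ n y
  rw [h.phiFn_eq]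
  linarith [volterraOp_nonneg (B := B) κ h0 z]

theorem phiFn_pos (h : Profile c M L B) (κ z : ℝ) : 0 < phiFn κ B z :=
  zero_lt_one.trans_le (h.one_le_phiFn κ z)

theorem le_innerOp_integral (h : Profile c M L B) (κ x : ℝ) :
    c ^ 4 / 3 ≤ ∫ s in (0 : ℝ)..1, ratioFn B x s ^ 2 * phiFn κ B (x * s) := by
  -- The integrand is at least `(c² s)² · 1`, from `c² s ≤ ratioFn` and `1 ≤ phiFn`.
  have h1 : ∫ s in (0 : ℝ)..1, c ^ 4 * s ^ 2 = c ^ 4 / 3 := by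
    rw [intervalIntegral.integral_const_mul, integral_pow]; norm_num; ring
  rw [← h1]
  refine intervalIntegral.integral_mono_on zero_le_one
    (Continuous.intervalIntegrable (by fun_prop) _ _)
    ((((h.continuous_ratioFn x).pow 2).mul ((h.continuous_phiFn κ).comp
      (continuous_const.mul continuous_id))).intervalIntegrable _ _) fun s hs => ?_
  have h2 := pow_le_pow_left₀ (mul_nonneg (sq_nonneg c) hs.1) (h.le_ratioFn x hs.1) 2
  calc c ^ 4 * s ^ 2 = (c ^ 2 * s) ^ 2 * 1 := by ring
    _ ≤ _ := mul_le_mul h2 (h.one_le_phiFn κ _) zero_le_one (sq_nonneg _)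

theorem le_phiFn (h : Profile c M L B) (κ z : ℝ) : 1 + c ^ 4 / 6 * (κ * z) ^ 2 ≤ phiFn κ B z := by
  rw [h.phiFn_eq, volterraOp, ← intervalIntegral.integral_const_mul]
  have h1 : ∫ s in (0 : ℝ)..1, z ^ 2 * (c ^ 4 / 3) * s = z ^ 2 * (c ^ 4 / 6) := by
    rw [intervalIntegral.integral_const_mul, integral_id]; ring
  have h2 : z ^ 2 * (c ^ 4 / 6) ≤ ∫ s in (0 : ℝ)..1, z * innerOp B (phiFn κ B) (z * s) := by
    rw [← h1]
    refine intervalIntegral.integral_mono_on zero_le_one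
      (Continuous.intervalIntegrable (by fun_prop) _ _)
      ((continuous_const.mul ((h.continuous_innerOp (h.continuous_phiFn κ)).comp
        (continuous_const.mul continuous_id))).intervalIntegrable _ _) fun s hs => ?_
    rw [innerOp, ← mul_assoc]
    have := mul_le_mul_of_nonneg_left (h.le_innerOp_integral κ (z * s))
      (mul_nonneg (sq_nonneg z) hs.1)
    linarith
  have := mul_le_mul_of_nonneg_left h2 (sq_nonneg κ)
  linarith

/-- Quadratic flatness at the critical point, which compensates the factor `1 / B²` in the integrand
of `Π₂`. -/
theorem phiFn_sub_one_le (h : Profile c M L B) (κ : ℝ) {z : ℝ} (hz : |z| ≤ 1) :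
    phiFn κ B z - 1 ≤ κ ^ 2 * Real.cosh κ / 2 * z ^ 2 := by
  have h1 := h.abs_volterraOp_le κ (f := phiFn κ B) (a := Real.cosh κ) (m := 0) (z := z)
    fun y hy => by simpa using h.abs_phiFn_le κ (hy.trans hz)
  rw [h.phiFn_eq κ z]
  have := (le_abs_self _).trans h1
  norm_num at this
  linarith

theorem monotoneOn_phiFn (h : Profile c M L B) (κ : ℝ) : MonotoneOn (phiFn κ B) (Ici 0) := by
  refine monotoneOn_of_deriv_nonneg (convex_Ici 0) (h.continuous_phiFn κ).continuousOn
    (fun z _ => (h.hasDerivAt_phiFn κ z).differentiableAt.differentiableWithinAt) fun z hz => ?_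
  rw [interior_Ici, mem_Ioi] at hz
  simp only [h.deriv_phiFn, innerOp]
  have := innerOp_integral_nonneg (B := B) (fun y => (h.phiFn_pos κ y).le) z
  positivity

theorem antitoneOn_phiFn (h : Profile c M L B) (κ : ℝ) : AntitoneOn (phiFn κ B) (Iic 0) := by
  refine antitoneOn_of_deriv_nonpos (convex_Iic 0) (h.continuous_phiFn κ).continuousOn
    (fun z _ => (h.hasDerivAt_phiFn κ z).differentiableAt.differentiableWithinAt) fun z hz => ?_
  rw [interior_Iic, mem_Iio] at hz
  simp only [h.deriv_phiFn, innerOp]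
  have := innerOp_integral_nonneg (B := B) (fun y => (h.phiFn_pos κ y).le) z
  exact mul_nonpos_of_nonneg_of_nonpos (sq_nonneg κ) (mul_nonpos_of_nonpos_of_nonneg hz.le this)

theorem phiFn_le_of_abs_le (h : Profile c M L B) (κ : ℝ) {y z : ℝ} (h0 : 0 ≤ y * z)
    (hyz : |y| ≤ |z|) : phiFn κ B y ≤ phiFn κ B z := by
  rcases le_total 0 z with hz | hz
  · rcases le_or_gt 0 y with hy | hy
    · rw [abs_of_nonneg hz, abs_of_nonneg hy] at hyz
      exact h.monotoneOn_phiFn κ hy hz hyz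
    · have : z = 0 := le_antisymm (by nlinarith) hz
      rw [this, abs_zero, abs_nonpos_iff] at hyz
      rw [hyz, this]
  · rcases le_or_gt y 0 with hy | hy
    · rw [abs_of_nonpos hz, abs_of_nonpos hy] at hyz
      exact h.antitoneOn_phiFn κ hz hy (by linarith)
    · have : z = 0 := le_antisymm hz (by nlinarith)
      rw [this, abs_zero, abs_nonpos_iff] at hyz
      rw [hyz, this]

/-- On the segment from `0` to `z` the function is largest at `z`, because it grows away from `0` on
both sides. -/
theorem abs_deriv_phiFn_le (h : Profile c M L B) (κ z : ℝ) :
    |deriv (phiFn κ B) z| ≤ κ ^ 2 * (phiFn κ B z * |z|) := by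
  rw [h.deriv_phiFn, abs_mul, abs_of_nonneg (sq_nonneg κ)]
  refine mul_le_mul_of_nonneg_left ?_ (sq_nonneg κ)
  rw [innerOp, abs_mul, mul_comm]
  refine mul_le_mul_of_nonneg_right ?_ (abs_nonneg z)
  have := intervalIntegral.norm_integral_le_of_norm_le (μ := volume) (a := 0) (b := 1)
    (f := fun s => ratioFn B z s ^ 2 * phiFn κ B (z * s)) (g := fun _ => phiFn κ B z) zero_le_one
    (Eventually.of_forall fun s hs => ?_) intervalIntegrable_const
  · simpa using this
  · rw [Real.norm_eq_abs, abs_mul, abs_of_nonneg (sq_nonneg _), abs_of_pos (h.phiFn_pos κ _)]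
    have h2 : ratioFn B z s ^ 2 ≤ 1 :=
      pow_le_one₀ (h.ratioFn_nonneg z hs.1.le) (h.ratioFn_le_one z hs.2)
    have h3 : phiFn κ B (z * s) ≤ phiFn κ B z := by
      refine h.phiFn_le_of_abs_le κ ?_ ?_
      · nlinarith [mul_nonneg hs.1.le (mul_self_nonneg z)]
      · rw [abs_mul, abs_of_nonneg hs.1.le]; exact mul_le_of_le_one_right (abs_nonneg _) hs.2
    calc _ ≤ 1 * phiFn κ B (z * s) := mul_le_mul_of_nonneg_right h2 (h.phiFn_pos κ _).le
      _ ≤ _ := by rw [one_mul]; exact h3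

end Profile

/-! ### Convergence of `Π₁` and `Π₂`, and coercivity of `Π₂` -/

theorem abs_sub_le_of_abs_deriv_le {f f' : ℝ → ℝ} (hf : ∀ y, HasDerivAt f (f' y) y) {K z : ℝ}
    (h : ∀ y, |y| ≤ |z| → |f' y| ≤ K) : |f z - f 0| ≤ K * |z| := by
  have := (convex_Icc (-|z|) |z|).norm_image_sub_le_of_norm_hasDerivWithin_le (f := f) (f' := f')
    (C := K) (x := 0) (y := z) (fun y _ => (hf y).hasDerivWithinAt)
    (fun y hy => h y (abs_le.2 hy)) ⟨by simp, abs_nonneg z⟩ (abs_le.1 le_rfl)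
  simpa using this

/-- The symmetrisation of the integrand of the principal value `Π₁` at the critical point `0`. -/
noncomputable def symPi1 (B : ℝ → ℝ) (z : ℝ) : ℝ := Pi1Integrand B 0 z + Pi1Integrand B 0 (-z)

/-- The constant in the integrable bound for `symPi1`. -/
noncomputable def symConst (c M L : ℝ) : ℝ := 8 * M ^ 2 / c ^ 5 + 4 * L / c ^ 2 + 4 / c ^ 3

/-- The constant in the integrable bound for the integrand of `Π₂`. -/
noncomputable def pi2Const (c κ : ℝ) : ℝ := 2 * (κ ^ 2 * Real.cosh κ) / c ^ 2 + 2 / c ^ 2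

/-- The constant in the coercivity bound for `Π₂`. -/
noncomputable def coerciveConst (c : ℝ) : ℝ := c ^ 2 / 4 * (1 - 1 / (1 + c ^ 4 / 6) ^ 2)

theorem coerciveConst_pos {c : ℝ} (hc : 0 < c) : 0 < coerciveConst c := by
  have : 1 / (1 + c ^ 4 / 6) ^ 2 < 1 := by
    rw [div_lt_one (by positivity)]
    exact one_lt_pow₀ (by linarith [show 0 < c ^ 4 / 6 by positivity]) (by norm_num)
  unfold coerciveConst
  have h2 : 0 < 1 - 1 / (1 + c ^ 4 / 6) ^ 2 := by linarith
  positivity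

namespace Profile

variable {c M L : ℝ} {B : ℝ → ℝ}

theorem M_nonneg (h : Profile c M L B) : 0 ≤ M := (abs_nonneg _).trans (h.abs_deriv2_le 0)

theorem L_nonneg (h : Profile c M L B) : 0 ≤ L := by
  have := (abs_nonneg _).trans (h.lipschitz 1 0)
  simpa using this

theorem abs_deriv_sub_le (h : Profile c M L B) (z : ℝ) : |deriv B z - deriv B 0| ≤ M * |z| :=
  abs_sub_le_of_abs_deriv_le h.hasDerivAt_deriv fun y _ => h.abs_deriv2_le y

theorem abs_deriv_sub_linear_le (h : Profile c M L B) (z : ℝ) :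
    |deriv B z - deriv B 0 - deriv (deriv B) 0 * z| ≤ L * z ^ 2 := by
  have := abs_sub_le_of_abs_deriv_le (z := z) (K := L * |z|)
    (f := fun y => deriv B y - deriv (deriv B) 0 * y)
    (fun y => (h.hasDerivAt_deriv y).sub ((hasDerivAt_id y).const_mul (deriv (deriv B) 0)))
    (fun y hy => by
      have h1 := h.lipschitz y 0
      rw [sub_zero] at h1
      rw [mul_one]
      exact h1.trans (mul_le_mul_of_nonneg_left hy h.L_nonneg))
  rw [mul_assoc, ← sq, sq_abs] at this
  convert! this using 2
  ring

theorem abs_sub_linear_le (h : Profile c M L B) (z : ℝ) : |B z - deriv B 0 * z| ≤ M * z ^ 2 := by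
  have := abs_sub_le_of_abs_deriv_le (z := z) (K := M * |z|)
    (f := fun y => B y - deriv B 0 * y)
    (fun y => (h.hasDerivAt y).sub ((hasDerivAt_id y).const_mul (deriv B 0)))
    (fun y hy => by
      rw [mul_one]
      exact (h.abs_deriv_sub_le y).trans (mul_le_mul_of_nonneg_left hy h.M_nonneg))
  rw [mul_assoc, ← sq, sq_abs] at this
  simpa [h.zero] using this

theorem pi1Integrand_eq (h : Profile c M L B) (z : ℝ) :
    Pi1Integrand B 0 z = (deriv B 0 - deriv B z) / B z ^ 2 := by
  rw [Pi1Integrand, h.zero, sub_zero]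

theorem abs_pi1Integrand_le (h : Profile c M L B) {z : ℝ} (hz : z ≠ 0) :
    |Pi1Integrand B 0 z| ≤ 1 / c ^ 3 / z ^ 2 := by
  have hc := h.pos
  rw [h.pi1Integrand_eq, abs_div, abs_of_nonneg (sq_nonneg (B z))]
  have h1 : |deriv B 0 - deriv B z| ≤ c⁻¹ := by
    have a1 := h.deriv_pos 0
    have a2 := h.deriv_pos z
    have a3 := h.deriv_le 0
    have a4 := h.deriv_le z
    rw [_root_.abs_le]; constructor <;> linarith
  calc |deriv B 0 - deriv B z| / B z ^ 2 ≤ c⁻¹ / (c ^ 2 * z ^ 2) := by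
        gcongr
        exact h.sq_le z
    _ = _ := by field_simp

theorem symPi1_zero (h : Profile c M L B) : symPi1 B 0 = 0 := by
  rw [symPi1, h.pi1Integrand_eq]; simp [h.pi1Integrand_eq]

theorem abs_symPi1_le_of_bounded (h : Profile c M L B) (z : ℝ) :
    |symPi1 B z| ≤ 4 * M ^ 2 / c ^ 5 + 2 * L / c ^ 2 := by
  have hc := h.pos
  have hM := h.M_nonneg
  have hL := h.L_nonneg
  rcases eq_or_ne z 0 with rfl | hz
  · rw [h.symPi1_zero, abs_zero]; positivity
  have hz2 : 0 < z ^ 2 := by positivity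
  have hB1 := h.ne_zero hz
  have hB2 := h.ne_zero (neg_ne_zero.2 hz)
  set m := deriv (deriv B) 0 with hm
  -- Expand `B'` at `0`. The first two terms are Taylor remainders over `B²`. The linear parts `m z`
  -- combine into a multiple of `B(z)² - B(-z)²`, whose factor `B(z) + B(-z)` is `O(z²)`; this is
  -- the cancellation behind the principal value.
  have e : symPi1 B z = -(deriv B z - deriv B 0 - m * z) / B z ^ 2
      + -(deriv B (-z) - deriv B 0 - m * (-z)) / B (-z) ^ 2
      + m * z * (B z + B (-z)) * (B z - B (-z)) / (B z ^ 2 * B (-z) ^ 2) := by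
    rw [symPi1, h.pi1Integrand_eq, h.pi1Integrand_eq]
    field_simp
    ring
  have b1 := h.sq_le z
  have b2 := h.sq_le (-z)
  rw [neg_sq] at b2
  have t1 : |-(deriv B z - deriv B 0 - m * z) / B z ^ 2| ≤ L / c ^ 2 := by
    rw [abs_div, abs_neg, abs_of_nonneg (sq_nonneg (B z))]
    calc _ ≤ L * z ^ 2 / (c ^ 2 * z ^ 2) :=
          div_le_div₀ (by positivity) (h.abs_deriv_sub_linear_le z) (by positivity) b1
      _ = _ := by field_simp
  have t2 : |-(deriv B (-z) - deriv B 0 - m * (-z)) / B (-z) ^ 2| ≤ L / c ^ 2 := by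
    rw [abs_div, abs_neg, abs_of_nonneg (sq_nonneg (B (-z)))]
    have := h.abs_deriv_sub_linear_le (-z)
    rw [neg_sq] at this
    calc _ ≤ L * z ^ 2 / (c ^ 2 * z ^ 2) :=
          div_le_div₀ (by positivity) this (by positivity) b2
      _ = _ := by field_simp
  have t3 : |m * z * (B z + B (-z)) * (B z - B (-z)) / (B z ^ 2 * B (-z) ^ 2)|
      ≤ 4 * M ^ 2 / c ^ 5 := by
    rw [abs_div, abs_mul, abs_mul, abs_mul, abs_of_nonneg (by positivity : 0 ≤ B z ^ 2 * B (-z) ^ 2)]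
    have s1 : |B z + B (-z)| ≤ 2 * M * z ^ 2 := by
      have u1 := h.abs_sub_linear_le z
      have u2 := h.abs_sub_linear_le (-z)
      rw [neg_sq] at u2
      have := abs_add_le (B z - deriv B 0 * z) (B (-z) - deriv B 0 * (-z))
      rw [show B z - deriv B 0 * z + (B (-z) - deriv B 0 * -z) = B z + B (-z) by ring] at this
      linarith
    have s2 : |B z - B (-z)| ≤ 2 * c⁻¹ * |z| := by
      have u1 := h.abs_le z
      have u2 := h.abs_le (-z)
      rw [abs_neg] at u2
      have := abs_sub (B z) (B (-z))
      linarith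
    have s3 : |m| ≤ M := h.abs_deriv2_le 0
    calc _ ≤ M * |z| * (2 * M * z ^ 2) * (2 * c⁻¹ * |z|) / ((c ^ 2 * z ^ 2) * (c ^ 2 * z ^ 2)) := by
          gcongr
      _ = 4 * M ^ 2 * |z| ^ 2 * z ^ 2 / (c * (c ^ 2 * z ^ 2) * (c ^ 2 * z ^ 2)) := by
          field_simp; ring
      _ = _ := by rw [sq_abs]; field_simp
  rw [e]
  have := abs_add_three (-(deriv B z - deriv B 0 - m * z) / B z ^ 2)
    (-(deriv B (-z) - deriv B 0 - m * (-z)) / B (-z) ^ 2)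
    (m * z * (B z + B (-z)) * (B z - B (-z)) / (B z ^ 2 * B (-z) ^ 2))
  calc _ ≤ L / c ^ 2 + L / c ^ 2 + 4 * M ^ 2 / c ^ 5 := by linarith
    _ = _ := by ring

/-- Glues a bound near `0` and a `1/z²` bound far away into one integrable majorant, used throughout
for domination. -/
theorem le_mul_inv_one_add_sq {a K₁ K₂ z : ℝ} (h1 : |z| ≤ 1 → a ≤ K₁)
    (h2 : 1 ≤ |z| → a ≤ K₂ / z ^ 2) (hK₁ : 0 ≤ K₁) (hK₂ : 0 ≤ K₂) :
    a ≤ (2 * K₁ + 2 * K₂) * (1 + z ^ 2)⁻¹ := by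
  rw [← div_eq_mul_inv, le_div_iff₀ (by positivity)]
  rcases le_total |z| 1 with hz | hz
  · have := h1 hz
    have hz2 : z ^ 2 ≤ 1 := (sq_le_one_iff_abs_le_one z).2 hz
    nlinarith [sq_nonneg z]
  · have := h2 hz
    have hz2 : 1 ≤ z ^ 2 := (one_le_sq_iff_one_le_abs z).2 hz
    rw [le_div_iff₀ (by positivity)] at this
    have : K₂ * (1 + z ^ 2) ≤ 2 * K₂ * z ^ 2 := by nlinarith
    have h3 : a * z ^ 2 * (1 + z ^ 2) ≤ (2 * K₂) * z ^ 2 := by nlinarith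
    have h4 : a * (1 + z ^ 2) ≤ 2 * K₂ := by
      refine le_of_mul_le_mul_right (a := z ^ 2) ?_ (by positivity)
      linarith
    linarith

theorem abs_symPi1_le (h : Profile c M L B) (z : ℝ) :
    |symPi1 B z| ≤ symConst c M L * (1 + z ^ 2)⁻¹ := by
  have hc := h.pos
  have hL := h.L_nonneg
  refine (le_mul_inv_one_add_sq (z := z) (K₁ := 4 * M ^ 2 / c ^ 5 + 2 * L / c ^ 2) (K₂ := 2 / c ^ 3)
    (fun _ => h.abs_symPi1_le_of_bounded z) (fun hz => ?_) (by positivity) (by positivity)).trans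
    (le_of_eq ?_)
  · have hz0 : z ≠ 0 := by rintro rfl; norm_num at hz
    have h1 := h.abs_pi1Integrand_le hz0
    have h2 := h.abs_pi1Integrand_le (neg_ne_zero.2 hz0)
    rw [neg_sq] at h2
    have := abs_add_le (Pi1Integrand B 0 z) (Pi1Integrand B 0 (-z))
    rw [symPi1]
    calc _ ≤ 1 / c ^ 3 / z ^ 2 + 1 / c ^ 3 / z ^ 2 := by linarith
      _ = _ := by ring
  · rw [symConst]; ring

theorem measurable_pi1Integrand (h : Profile c M L B) : Measurable (Pi1Integrand B 0) := by
  have h1 := h.continuous.measurable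
  have h2 := h.continuous_deriv.measurable
  exact (measurable_const.sub h2).div ((h1.sub_const _).pow_const 2)

theorem measurable_symPi1 (h : Profile c M L B) : Measurable (symPi1 B) :=
  h.measurable_pi1Integrand.add (h.measurable_pi1Integrand.comp measurable_neg)

theorem integrable_symPi1 (h : Profile c M L B) : Integrable (symPi1 B) :=
  (integrable_inv_one_add_sq.const_mul (symConst c M L)).mono'
    h.measurable_symPi1.aestronglyMeasurable (Eventually.of_forall h.abs_symPi1_le)

theorem measurableSet_punctured (ε : ℝ) : MeasurableSet {y : ℝ | ε < |y - 0|} :=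
  measurableSet_lt measurable_const (by fun_prop)

theorem integrableOn_pi1Integrand (h : Profile c M L B) {ε : ℝ} (hε : 0 < ε) :
    IntegrableOn (Pi1Integrand B 0) {y | ε < |y - 0|} := by
  have hc := h.pos
  refine Integrable.mono'
    ((integrable_inv_one_add_sq.const_mul (1 / c ^ 3 * (1 + 1 / ε ^ 2))).integrableOn)
    h.measurable_pi1Integrand.aestronglyMeasurable ?_
  refine (ae_restrict_iff' (measurableSet_punctured ε)).2 (Eventually.of_forall fun z hz => ?_)
  rw [mem_ofPred_eq, sub_zero] at hz
  have hz0 : z ≠ 0 := by rintro rfl; rw [abs_zero] at hz; linarith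
  refine (h.abs_pi1Integrand_le hz0).trans ?_
  rw [mul_assoc, div_eq_mul_inv]
  refine mul_le_mul_of_nonneg_left ?_ (by positivity)
  have h1 : ε ^ 2 ≤ z ^ 2 := by rw [← sq_abs z]; gcongr
  rw [← div_eq_mul_inv, le_div_iff₀ (by positivity), mul_add, mul_one,
    inv_mul_cancel₀ (by positivity)]
  have : (z ^ 2)⁻¹ ≤ 1 / ε ^ 2 := by rw [one_div]; gcongr
  linarith

theorem hasPV (h : Profile c M L B) : HasPV (Pi1Integrand B 0) 0 (∫ z, symPi1 B z / 2) := by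
  refine ⟨fun ε hε => h.integrableOn_pi1Integrand hε, ?_⟩
  -- The truncation set is invariant under `z ↦ -z`, so the integrand may be replaced by its even
  -- part. That part is absolutely integrable, and the limit is then dominated convergence.
  have e : ∀ ε : ℝ, 0 < ε → ∫ y in {y | ε < |y - 0|}, Pi1Integrand B 0 y =
      ∫ z, {y : ℝ | ε < |y - 0|}.indicator (fun z => symPi1 B z / 2) z := fun ε hε => by
    have hS := measurableSet_punctured ε
    have hi := (integrable_indicator_iff hS).2 (h.integrableOn_pi1Integrand hε)
    set F := {y : ℝ | ε < |y - 0|}.indicator (Pi1Integrand B 0) with hF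
    have h1 : ∫ z, F (-z) = ∫ z, F z := integral_neg_eq_self F volume
    have h2 : Integrable fun z => F (-z) := hi.comp_neg
    rw [← integral_indicator hS]
    calc ∫ z, F z = ((∫ z, F z) + ∫ z, F (-z)) / 2 := by rw [h1]; ring
      _ = ∫ z, (F z + F (-z)) / 2 := by rw [integral_div, integral_add hi h2]
      _ = _ := by
        refine integral_congr_ae (Eventually.of_forall fun z => ?_)
        simp only [hF, indicator, mem_ofPred_eq, sub_zero, abs_neg, symPi1]
        split_ifs <;> ring
  have key : Tendsto (fun ε : ℝ => ∫ z, {y : ℝ | ε < |y - 0|}.indicator (fun z => symPi1 B z / 2) z)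
      (𝓝[>] 0) (𝓝 (∫ z, symPi1 B z / 2)) := by
    refine tendsto_integral_filter_of_dominated_convergence (fun z => |symPi1 B z / 2|)
      (Eventually.of_forall fun ε => ((h.measurable_symPi1.div_const 2).indicator
        (measurableSet_punctured ε)).aestronglyMeasurable)
      (Eventually.of_forall fun ε => Eventually.of_forall fun z => norm_indicator_le_norm_self _ _)
      (h.integrable_symPi1.div_const 2).abs (Eventually.of_forall fun z => ?_)
    rcases eq_or_ne z 0 with rfl | hz
    · refine tendsto_const_nhds.congr fun ε => ?_
      simp [indicator, h.symPi1_zero]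
    · refine tendsto_const_nhds.congr' ?_
      filter_upwards [Ioo_mem_nhdsGT (abs_pos.2 hz)] with ε hε
      rw [indicator_of_mem]
      simpa using hε.2
  exact key.congr' (by filter_upwards [self_mem_nhdsWithin] with ε hε using (e ε hε).symm)

theorem pi1_eq (h : Profile c M L B) : Pi1 B 0 = ∫ z, symPi1 B z / 2 := h.hasPV.2.limUnder_eq

theorem pi2Integrand_eq (h : Profile c M L B) (k : ℤ) (z : ℝ) :
    Pi2Integrand B k 0 z = -(1 / B z ^ 2 * (1 - 1 / phiFn k B z ^ 2)) := by
  rw [Pi2Integrand, h.zero, sub_zero, h.phi1_eq]; ring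

theorem one_sub_inv_sq_nonneg (h : Profile c M L B) (κ z : ℝ) : 0 ≤ 1 - 1 / phiFn κ B z ^ 2 := by
  have h1 := h.one_le_phiFn κ z
  rw [sub_nonneg, div_le_one (pow_pos (h.phiFn_pos κ z) 2)]
  exact one_le_pow₀ h1

theorem pi2Integrand_nonpos (h : Profile c M L B) (k : ℤ) (z : ℝ) :
    Pi2Integrand B k 0 z ≤ 0 := by
  rw [h.pi2Integrand_eq, neg_nonpos]
  exact mul_nonneg (by positivity) (h.one_sub_inv_sq_nonneg k z)

theorem abs_pi2Integrand_le (h : Profile c M L B) (k : ℤ) (z : ℝ) :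
    |Pi2Integrand B k 0 z| ≤ pi2Const c k * (1 + z ^ 2)⁻¹ := by
  have hc := h.pos
  have hch : 0 < Real.cosh (k : ℝ) := Real.cosh_pos _
  have hn := h.one_sub_inv_sq_nonneg k z
  have hB := h.sq_le z
  rw [h.pi2Integrand_eq, abs_neg, abs_of_nonneg (mul_nonneg (by positivity) hn)]
  refine (le_mul_inv_one_add_sq (z := z) (K₁ := (k : ℝ) ^ 2 * Real.cosh k / c ^ 2) (K₂ := 1 / c ^ 2)
    (fun hz => ?_) (fun hz => ?_) (by positivity) (by positivity)).trans (le_of_eq ?_)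
  · rcases eq_or_ne z 0 with rfl | hz0
    · rw [h.zero]; simp; positivity
    have h1 := h.phiFn_sub_one_le k hz
    have h2 := h.one_le_phiFn k z
    -- The tangent line at `p = 1` of the concave function `1 - p⁻²`.
    have h3 : 1 - 1 / phiFn k B z ^ 2 ≤ 2 * (phiFn k B z - 1) := by
      have : 0 < phiFn k B z ^ 2 := by positivity
      rw [sub_le_iff_le_add, ← sub_le_iff_le_add', le_div_iff₀ this]
      nlinarith [mul_nonneg (sub_nonneg.2 h2) (sub_nonneg.2 h2),
        mul_nonneg (mul_nonneg (sub_nonneg.2 h2) (sub_nonneg.2 h2)) (sub_nonneg.2 h2)]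
    calc 1 / B z ^ 2 * (1 - 1 / phiFn k B z ^ 2)
        ≤ 1 / (c ^ 2 * z ^ 2) * (2 * ((k : ℝ) ^ 2 * Real.cosh k / 2 * z ^ 2)) := by
          refine mul_le_mul (one_div_le_one_div_of_le (by positivity) hB) (by linarith) hn
            (by positivity)
      _ = _ := by field_simp
  · have hz0 : z ≠ 0 := by rintro rfl; norm_num at hz
    have h4 : 1 - 1 / phiFn k B z ^ 2 ≤ 1 := by
      have : 0 ≤ 1 / phiFn k B z ^ 2 := by positivity
      linarith
    calc 1 / B z ^ 2 * (1 - 1 / phiFn k B z ^ 2)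
        ≤ 1 / (c ^ 2 * z ^ 2) * 1 :=
          mul_le_mul (one_div_le_one_div_of_le (by positivity) hB) h4 hn (by positivity)
      _ = _ := by field_simp
  · rw [pi2Const]; ring

theorem measurable_pi2Integrand (h : Profile c M L B) (k : ℤ) :
    Measurable (Pi2Integrand B k 0) := by
  have h1 := h.continuous.measurable
  have h2 := (h.continuous_phiFn k).measurable
  rw [show Pi2Integrand B k 0 = fun z => -(1 / B z ^ 2 * (1 - 1 / phiFn k B z ^ 2)) from
    funext (h.pi2Integrand_eq k)]
  fun_prop

theorem integrable_pi2Integrand (h : Profile c M L B) (k : ℤ) :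
    Integrable (Pi2Integrand B k 0) :=
  (integrable_inv_one_add_sq.const_mul (pi2Const c k)).mono'
    (h.measurable_pi2Integrand k).aestronglyMeasurable
    (Eventually.of_forall (h.abs_pi2Integrand_le k))

/-- The integrand has one sign, so all but the window `(1/κ, 2/κ]` can be discarded. There `κ z ≥ 1`
keeps `1 - φ⁻²` away from `0`, and `κ z ≤ 2` gives `1/B² ≥ c²κ²/4`. The window has length `1/κ`,
leaving one power of `κ`. -/
theorem pi2_le (h : Profile c M L B) {k : ℤ} (hk : k ≠ 0) :
    Pi2 B k 0 ≤ -(coerciveConst c * |(k : ℝ)|) := by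
  have hc := h.pos
  set κ := |(k : ℝ)| with hκ
  have hk0 : 0 < κ := abs_pos.2 (by exact_mod_cast hk)
  have hcc := coerciveConst_pos hc
  have hS : MeasurableSet (Ioc (1 / κ) (2 / κ)) := measurableSet_Ioc
  have hvol : volume.real (Ioc (1 / κ) (2 / κ)) = 1 / κ := by
    rw [Real.volume_real_Ioc_of_le (by gcongr; norm_num)]; ring
  have h1 : ∫ z, (Ioc (1 / κ) (2 / κ)).indicator (fun _ => coerciveConst c * κ ^ 2) z
      ≤ ∫ z, -Pi2Integrand B k 0 z := by
    refine integral_mono ((integrable_indicator_iff hS).2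
      (integrableOn_const (by simp))) (h.integrable_pi2Integrand k).neg
      fun z => ?_
    by_cases hz : z ∈ Ioc (1 / κ) (2 / κ)
    · rw [indicator_of_mem hz, h.pi2Integrand_eq, neg_neg]
      have hz0 : 0 < z := lt_trans (by positivity) hz.1
      have a1 : 1 ≤ κ * z := by
        have := hz.1.le; rw [div_le_iff₀ hk0] at this; linarith
      have a2 : κ * z ≤ 2 := by
        have := hz.2; rw [le_div_iff₀ hk0] at this; linarith
      have a3 : 1 + c ^ 4 / 6 ≤ phiFn k B z := by
        refine le_trans ?_ (h.le_phiFn k z)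
        have : 1 ≤ ((k : ℝ) * z) ^ 2 := by
          rw [mul_pow, ← sq_abs (k : ℝ), ← mul_pow]; exact one_le_pow₀ a1
        nlinarith [show 0 < c ^ 4 / 6 by positivity]
      have a4 : c ^ 2 / 4 * κ ^ 2 ≤ 1 / B z ^ 2 := by
        have hBz : 0 < B z ^ 2 := pow_pos (h.zero ▸ h.strictMono hz0) 2
        rw [le_div_iff₀ hBz]
        have b1 : B z ^ 2 ≤ (c⁻¹ * z) ^ 2 := by
          have := h.abs_le z
          rw [abs_of_pos hz0] at this
          rw [← sq_abs (B z)]; gcongr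
        calc c ^ 2 / 4 * κ ^ 2 * B z ^ 2 ≤ c ^ 2 / 4 * κ ^ 2 * (c⁻¹ * z) ^ 2 := by gcongr
          _ = (κ * z) ^ 2 / 4 := by field_simp
          _ ≤ 2 ^ 2 / 4 := by gcongr
          _ = 1 := by norm_num
      have a5 : 1 - 1 / (1 + c ^ 4 / 6) ^ 2 ≤ 1 - 1 / phiFn k B z ^ 2 := by gcongr
      have a6 : 0 ≤ 1 - 1 / (1 + c ^ 4 / 6) ^ 2 := by
        rw [sub_nonneg, div_le_one (by positivity)]
        exact one_le_pow₀ (by linarith [show 0 < c ^ 4 / 6 by positivity])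
      calc coerciveConst c * κ ^ 2
          = c ^ 2 / 4 * κ ^ 2 * (1 - 1 / (1 + c ^ 4 / 6) ^ 2) := by rw [coerciveConst]; ring
        _ ≤ _ := mul_le_mul a4 a5 a6 (by positivity)
    · rw [indicator_of_notMem hz]
      simpa using h.pi2Integrand_nonpos k z
  rw [integral_indicator hS, setIntegral_const, hvol, integral_neg, smul_eq_mul] at h1
  rw [Pi2]
  have : 1 / κ * (coerciveConst c * κ ^ 2) = coerciveConst c * κ := by field_simp
  linarith

theorem J1_le (h : Profile c M L B) {k : ℤ} (hk : k ≠ 0) :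
    J1 B k 0 ≤ c⁻¹ * |Pi1 B 0| - coerciveConst c * |(k : ℝ)| := by
  have h1 := h.pi2_le hk
  have h2 : 1 / deriv B 0 * Pi1 B 0 ≤ c⁻¹ * |Pi1 B 0| := by
    have h3 : 1 / deriv B 0 ≤ c⁻¹ := by
      rw [← one_div]; exact one_div_le_one_div_of_le h.pos (h.le_deriv 0)
    have h4 : 0 < 1 / deriv B 0 := one_div_pos.2 (h.deriv_pos 0)
    exact (mul_le_mul_of_nonneg_left (le_abs_self _) h4.le).trans
      (mul_le_mul_of_nonneg_right h3 (abs_nonneg _))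
  rw [J1]; linarith

/-- Lower bound for `J₁²` once `Π₁` is small compared to the coercive part of `Π₂`. -/
theorem le_J1_sq (h : Profile c M L B) {k : ℤ} (hk : k ≠ 0)
    (hs : c⁻¹ * |Pi1 B 0| ≤ coerciveConst c / 2 * |(k : ℝ)|) :
    (coerciveConst c / 2) ^ 2 * (k : ℝ) ^ 2 ≤ J1 B k 0 ^ 2 := by
  have h1 := h.J1_le hk
  have h2 := coerciveConst_pos h.pos
  have h3 : coerciveConst c / 2 * |(k : ℝ)| ≤ -J1 B k 0 := by linarith
  rw [← sq_abs (k : ℝ), ← mul_pow, ← neg_sq (J1 B k 0)]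
  gcongr

end Profile

/-! ### Continuity of `J₁` along families of profiles -/

/-- Dominated convergence for `Π₁` along a family of profiles with uniform bounds. -/
theorem tendsto_integral_symPi1 {X : Type*} {l : Filter X} [l.IsCountablyGenerated]
    {B : X → ℝ → ℝ} {c M L : ℝ} {f : ℝ → ℝ} (hp : ∀ p, Profile c M L (B p))
    (hl : ∀ z, Tendsto (fun p => symPi1 (B p) z) l (𝓝 (f z))) :
    Tendsto (fun p => Pi1 (B p) 0) l (𝓝 (∫ z, f z / 2)) := by
  simp only [fun p => (hp p).pi1_eq]
  refine tendsto_integral_filter_of_dominated_convergence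
    (fun z => symConst c M L / 2 * (1 + z ^ 2)⁻¹)
    (Eventually.of_forall fun p => ((hp p).measurable_symPi1.div_const 2).aestronglyMeasurable)
    (Eventually.of_forall fun p => Eventually.of_forall fun z => ?_)
    (integrable_inv_one_add_sq.const_mul _)
    (Eventually.of_forall fun z => (hl z).div_const 2)
  rw [Real.norm_eq_abs, abs_div, abs_two]
  have := (hp p).abs_symPi1_le z
  linarith

section Continuity

variable {X : Type*} [TopologicalSpace X] {B : X → ℝ → ℝ} {c M L : ℝ}

theorem continuous_apply_of_profile (hp : ∀ p, Profile c M L (B p))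
    (hB : Continuous fun q : X × ℝ => deriv (B q.1) q.2) (z : ℝ) : Continuous fun p => B p z := by
  simp only [fun p => (hp p).eq_mul_slopeFn z]
  exact continuous_const.mul ((continuous_slopeFn hB).comp (Continuous.prodMk_left z))

theorem continuous_pi1 [FirstCountableTopology X] (hp : ∀ p, Profile c M L (B p))
    (hB : Continuous fun q : X × ℝ => deriv (B q.1) q.2) : Continuous fun p => Pi1 (B p) 0 := by
  rw [continuous_iff_continuousAt]
  intro p₀
  rw [ContinuousAt, (hp p₀).pi1_eq]
  refine tendsto_integral_symPi1 hp fun z => Continuous.tendsto ?_ p₀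
  -- At `z = 0` the quotients are `0/0`, and the symmetrised integrand is identically `0` there.
  rcases eq_or_ne z 0 with rfl | hz
  · simp only [fun p => (hp p).symPi1_zero]; exact continuous_const
  · simp only [symPi1, fun p => (hp p).pi1Integrand_eq]
    have hd : ∀ z, Continuous fun p => deriv (B p) z := fun z =>
      hB.comp (Continuous.prodMk_left z)
    have hc := continuous_apply_of_profile hp hB
    exact (((hd 0).sub (hd z)).div ((hc z).pow 2) fun p => pow_ne_zero 2 ((hp p).ne_zero hz)).add
      (((hd 0).sub (hd (-z))).div ((hc (-z)).pow 2) fun p =>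
        pow_ne_zero 2 ((hp p).ne_zero (neg_ne_zero.2 hz)))

theorem continuous_pi2 [FirstCountableTopology X] (hp : ∀ p, Profile c M L (B p))
    (hB : Continuous fun q : X × ℝ => deriv (B q.1) q.2) (k : ℤ) :
    Continuous fun p => Pi2 (B p) k 0 := by
  refine continuous_of_dominated (fun p => ((hp p).measurable_pi2Integrand k).aestronglyMeasurable)
    (fun p => Eventually.of_forall ((hp p).abs_pi2Integrand_le k))
    (integrable_inv_one_add_sq.const_mul _) (Eventually.of_forall fun z => ?_)
  simp only [fun p => (hp p).pi2Integrand_eq k]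
  rcases eq_or_ne z 0 with rfl | hz
  · simp only [fun p => (hp p).zero]; simp [continuous_const]
  · have hc := continuous_apply_of_profile hp hB z
    have hφ : Continuous fun p => phiFn k (B p) z :=
      (continuous_phiFn k hp hB).comp (Continuous.prodMk_left z)
    exact ((continuous_const.div (hc.pow 2) fun p => pow_ne_zero 2 ((hp p).ne_zero hz)).mul
      (continuous_const.sub (continuous_const.div (hφ.pow 2)
        fun p => pow_ne_zero 2 ((hp p).phiFn_pos k z).ne'))).neg

theorem continuous_J1 [FirstCountableTopology X] (hp : ∀ p, Profile c M L (B p))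
    (hB : Continuous fun q : X × ℝ => deriv (B q.1) q.2) (k : ℤ) :
    Continuous fun p => J1 (B p) k 0 :=
  ((continuous_const.div (hB.comp (Continuous.prodMk_left 0))
    fun p => ((hp p).deriv_pos 0).ne').mul (continuous_pi1 hp hB)).add (continuous_pi2 hp hB k)

end Continuity

/-! ### The embedded eigenvalue produced by `J₁ = J₂ = 0` -/

theorem memLp_two_of_sq_le {f : ℝ → ℝ} (hf : AEStronglyMeasurable f volume) {C : ℝ}
    (h : ∀ᵐ z, f z ^ 2 ≤ C * (1 + z ^ 2)⁻¹) : MemLp f 2 volume := by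
  rw [memLp_two_iff_integrable_sq hf]
  refine (integrable_inv_one_add_sq.const_mul C).mono' (hf.pow 2) ?_
  filter_upwards [h] with z hz
  rwa [Real.norm_eq_abs, abs_of_nonneg (sq_nonneg _)]

theorem hasWeakDeriv_ofReal {f g : ℝ → ℝ} (h : HasWeakDeriv f g) :
    HasWeakDeriv (fun y => (f y : ℂ)) (fun y => (g y : ℂ)) := by
  obtain ⟨h1, h2, h3⟩ := h
  refine ⟨fun x => ?_, fun x => ?_, fun φ hφ hc => ?_⟩
  · obtain ⟨s, hs, hi⟩ := h1 x
    exact ⟨s, hs, hi.ofReal⟩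
  · obtain ⟨s, hs, hi⟩ := h2 x
    exact ⟨s, hs, hi.ofReal⟩
  · have := congrArg (fun r : ℝ => (r : ℂ)) (h3 φ hφ hc)
    simp only [smul_eq_mul, Complex.ofReal_neg, ← integral_complex_ofReal,
      Complex.ofReal_mul] at this
    simpa only [Complex.real_smul] using this

/-- A positive tail `∫_z^∞ u⁻²` is controlled by a quadratic lower bound on `u²`. -/
theorem tail_pos_le {I u : ℝ → ℝ} {z K : ℝ} (hz : 0 < z) (hK : 0 < K)
    (hI : ∀ x, 0 < x → HasDerivAt I (-(1 / u x ^ 2)) x) (hu : ∀ x, 0 < x → u x ≠ 0)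
    (hlim : Tendsto I atTop (𝓝 0)) (hb : ∀ x, z ≤ x → K * x ^ 2 ≤ u x ^ 2) :
    0 < I z ∧ I z ≤ 1 / (K * z) := by
  have hpos : ∀ x ∈ Ici z, 0 < x := fun x hx => hz.trans_le hx
  have hanti : StrictAntiOn I (Ici z) := by
    refine strictAntiOn_of_deriv_neg (convex_Ici z)
      (fun x hx => (hI x (hpos x hx)).continuousAt.continuousWithinAt) fun x hx => ?_
    rw [interior_Ici] at hx
    have hx' := hz.trans hx
    have := hu x hx'
    rw [(hI x hx').deriv, neg_lt_zero]
    positivity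
  have hnonneg : ∀ x ∈ Ici z, 0 ≤ I x := fun x hx =>
    le_of_tendsto hlim ((eventually_ge_atTop x).mono fun y hy =>
      hanti.antitoneOn hx (le_trans (mem_Ici.1 hx) hy) hy)
  constructor
  · have h1 : I (z + 1) < I z := hanti (mem_Ici.2 le_rfl) (by simp) (by linarith)
    exact (hnonneg (z + 1) (by simp)).trans_lt h1
  · have hd : ∀ x, 0 < x →
        HasDerivAt (fun x => (K * x)⁻¹ - I x) (-(K * 1) / (K * x) ^ 2 - -(1 / u x ^ 2)) x :=
      fun x hx => (((hasDerivAt_id x).const_mul K).inv (mul_pos hK hx).ne').sub (hI x hx)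
    -- The comparison function `1/(K x)` is the exact tail of `1/(K x²)`. Its difference with `I` is
    -- decreasing with limit `0`, hence nonnegative.
    have hg : AntitoneOn (fun x => (K * x)⁻¹ - I x) (Ici z) := by
      refine antitoneOn_of_deriv_nonpos (convex_Ici z)
        (fun x hx => (hd x (hpos x hx)).continuousAt.continuousWithinAt)
        (fun x hx => ?_) fun x hx => ?_
      all_goals
        rw [interior_Ici] at hx
        have hx' := hz.trans hx
      · exact (hd x hx').differentiableAt.differentiableWithinAt
      · rw [(hd x hx').deriv]
        have h1 := hb x (le_of_lt hx)
        have h2 : 1 / u x ^ 2 ≤ 1 / (K * x ^ 2) := one_div_le_one_div_of_le (by positivity) h1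
        have h3 : -(K * 1) / (K * x) ^ 2 = -(1 / (K * x ^ 2)) := by field_simp
        rw [h3]; linarith
    have hglim : Tendsto (fun x => (K * x)⁻¹ - I x) atTop (𝓝 (0 - 0)) :=
      (tendsto_inv_atTop_zero.comp (tendsto_id.const_mul_atTop hK)).sub hlim
    rw [sub_zero] at hglim
    have := le_of_tendsto hglim ((eventually_ge_atTop z).mono fun y hy =>
      hg (mem_Ici.2 le_rfl) hy hy)
    rw [one_div]
    linarith

/-- The product of a differentiable function vanishing at a point and a function continuous there
is differentiable there. -/
theorem hasDerivAt_mul_of_eq_zero {u A : ℝ → ℝ} {u' z : ℝ} (hu : HasDerivAt u u' z) (h0 : u z = 0)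
    (hA : ContinuousAt A z) : HasDerivAt (fun x => u x * A x) (u' * A z) z := by
  rw [hasDerivAt_iff_tendsto_slope] at hu ⊢
  refine (hu.mul (hA.tendsto.mono_left nhdsWithin_le_nhds)).congr fun x => ?_
  simp only [slope_def_field, h0]
  ring

namespace Profile

variable {c M L : ℝ} {B : ℝ → ℝ} {k : ℤ}

/-- The integrand of `J₁` at a critical point where `B''` vanishes. -/
noncomputable def jIntegrand (B : ℝ → ℝ) (k : ℤ) (z : ℝ) : ℝ :=
  1 / deriv B 0 * Pi1Integrand B 0 z + Pi2Integrand B k 0 z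

/-- The tail `∫_z^∞` of `jIntegrand`. -/
noncomputable def jTail (B : ℝ → ℝ) (k : ℤ) (z : ℝ) : ℝ :=
  (∫ t in Ioi 0, jIntegrand B k t) - ∫ t in (0 : ℝ)..z, jIntegrand B k t

/-- The solution of the Rayleigh equation vanishing at the critical point. -/
noncomputable def regSol (B : ℝ → ℝ) (k : ℤ) (z : ℝ) : ℝ := B z * phiFn k B z

/-- The derivative of `regSol`. -/
noncomputable def regSolDeriv (B : ℝ → ℝ) (k : ℤ) (z : ℝ) : ℝ :=
  deriv B z * phiFn k B z + B z * deriv (phiFn k B) z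

/-- The stream function of the embedded eigenvalue. -/
noncomputable def eigenSol (B : ℝ → ℝ) (k : ℤ) (z : ℝ) : ℝ :=
  phiFn k B z / deriv B 0 + regSol B k z * jTail B k z

/-- The first derivative of `eigenSol`. -/
noncomputable def eigenSolDeriv (B : ℝ → ℝ) (k : ℤ) (z : ℝ) : ℝ :=
  deriv (phiFn k B) z / deriv B 0 + regSolDeriv B k z * jTail B k z
    - regSol B k z * jIntegrand B k z

/-- The ratio of `eigenSol` and `regSol`. -/
noncomputable def eigenRatio (B : ℝ → ℝ) (k : ℤ) (z : ℝ) : ℝ :=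
  (deriv B 0 * B z)⁻¹ + jTail B k z

/-- The vorticity of the embedded eigenvalue. -/
noncomputable def eigenVort (B : ℝ → ℝ) (k : ℤ) (z : ℝ) : ℝ :=
  deriv (deriv B) z / B z * eigenSol B k z

/-- With `B''(0) = 0` the numerator is already `O(z²)`, so the integral converges absolutely and can
be split into half-lines. -/
theorem abs_pi1Integrand_le_of_critical (h : Profile c M L B) (h2 : deriv (deriv B) 0 = 0) (z : ℝ) :
    |Pi1Integrand B 0 z| ≤ (2 * (L / c ^ 2) + 2 * (1 / c ^ 3)) * (1 + z ^ 2)⁻¹ := by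
  have hc := h.pos
  have hL := h.L_nonneg
  refine le_mul_inv_one_add_sq (fun _ => ?_) (fun hz => ?_) (by positivity) (by positivity)
  · rcases eq_or_ne z 0 with rfl | hz
    · rw [h.pi1Integrand_eq]; simp; positivity
    · have := h.abs_deriv_sub_linear_le z
      rw [h2, zero_mul, sub_zero, abs_sub_comm] at this
      rw [h.pi1Integrand_eq, abs_div, abs_of_nonneg (sq_nonneg (B z))]
      calc _ ≤ L * z ^ 2 / (c ^ 2 * z ^ 2) :=
            div_le_div₀ (by positivity) this (by positivity) (h.sq_le z)
        _ = _ := by field_simp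
  · have hz0 : z ≠ 0 := by rintro rfl; norm_num at hz
    exact h.abs_pi1Integrand_le hz0

theorem integrable_pi1Integrand_of_critical (h : Profile c M L B) (h2 : deriv (deriv B) 0 = 0) :
    Integrable (Pi1Integrand B 0) :=
  (integrable_inv_one_add_sq.const_mul _).mono' h.measurable_pi1Integrand.aestronglyMeasurable
    (Eventually.of_forall (h.abs_pi1Integrand_le_of_critical h2))

theorem pi1_eq_of_critical (h : Profile c M L B) (h2 : deriv (deriv B) 0 = 0) :
    Pi1 B 0 = ∫ z, Pi1Integrand B 0 z := by
  have hi := h.integrable_pi1Integrand_of_critical h2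
  have e : ∫ z, Pi1Integrand B 0 (-z) = ∫ z, Pi1Integrand B 0 z :=
    integral_neg_eq_self (Pi1Integrand B 0) volume
  rw [h.pi1_eq, integral_div]
  simp only [symPi1]
  rw [integral_add hi hi.comp_neg, e]
  ring

theorem integrable_jIntegrand (h : Profile c M L B) (h2 : deriv (deriv B) 0 = 0) (k : ℤ) :
    Integrable (jIntegrand B k) :=
  ((h.integrable_pi1Integrand_of_critical h2).const_mul _).add (h.integrable_pi2Integrand k)

theorem integral_jIntegrand (h : Profile c M L B) (h2 : deriv (deriv B) 0 = 0) (k : ℤ) :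
    ∫ z, jIntegrand B k z = J1 B k 0 := by
  simp only [jIntegrand]
  rw [integral_add ((h.integrable_pi1Integrand_of_critical h2).const_mul _)
    (h.integrable_pi2Integrand k), integral_const_mul, ← h.pi1_eq_of_critical h2, J1, Pi2]

theorem exists_abs_jIntegrand_le (h : Profile c M L B) (h2 : deriv (deriv B) 0 = 0) (k : ℤ) :
    ∃ K, ∀ z, |jIntegrand B k z| ≤ K := by
  refine ⟨|1 / deriv B 0| * (2 * (L / c ^ 2) + 2 * (1 / c ^ 3)) + pi2Const c k, fun z => ?_⟩
  have hc := h.pos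
  have hL := h.L_nonneg
  have hch : 0 < Real.cosh (k : ℝ) := Real.cosh_pos _
  have hz : (1 + z ^ 2)⁻¹ ≤ 1 := inv_le_one_of_one_le₀ (by nlinarith [sq_nonneg z])
  have a1 := h.abs_pi1Integrand_le_of_critical h2 z
  have a2 := h.abs_pi2Integrand_le k z
  have k1 : 0 ≤ 2 * (L / c ^ 2) + 2 * (1 / c ^ 3) := by positivity
  have k2 : 0 ≤ pi2Const c k := by rw [pi2Const]; positivity
  rw [jIntegrand]
  refine (abs_add_le _ _).trans (add_le_add ?_ ?_)
  · rw [abs_mul]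
    exact mul_le_mul_of_nonneg_left (a1.trans (mul_le_of_le_one_right k1 hz)) (abs_nonneg _)
  · exact a2.trans (mul_le_of_le_one_right k2 hz)

theorem regSol_ne_zero (h : Profile c M L B) {z : ℝ} (hz : z ≠ 0) : regSol B k z ≠ 0 :=
  mul_ne_zero (h.ne_zero hz) (h.phiFn_pos k z).ne'

/-- The subtracted term is minus the derivative of `1/(B'(0) B)`. So `jIntegrand` is `u⁻²` with its
singularity at the critical point removed by an exact derivative, and `eigenRatio` is the
regularised `∫_z^∞ u⁻²`. -/
theorem jIntegrand_eq (h : Profile c M L B) {z : ℝ} (hz : z ≠ 0) :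
    jIntegrand B k z = 1 / regSol B k z ^ 2 - deriv B z / (deriv B 0 * B z ^ 2) := by
  have h1 := h.ne_zero hz
  have h2 := (h.phiFn_pos k z).ne'
  have h3 := (h.deriv_pos 0).ne'
  rw [jIntegrand, h.pi1Integrand_eq, h.pi2Integrand_eq, regSol]
  field_simp
  ring

theorem continuous_regSol (h : Profile c M L B) : Continuous (regSol B k) :=
  h.continuous.mul (h.continuous_phiFn k)

theorem continuous_regSolDeriv (h : Profile c M L B) : Continuous (regSolDeriv B k) :=
  (h.continuous_deriv.mul (h.continuous_phiFn k)).add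
    (h.continuous.mul (h.continuous_deriv_phiFn k))

theorem continuousAt_jIntegrand (h : Profile c M L B) {z : ℝ} (hz : z ≠ 0) :
    ContinuousAt (jIntegrand B k) z := by
  have e : jIntegrand B k =ᶠ[𝓝 z]
      fun z => 1 / regSol B k z ^ 2 - deriv B z / (deriv B 0 * B z ^ 2) := by
    filter_upwards [isOpen_ne.mem_nhds hz] with y hy using h.jIntegrand_eq hy
  refine ContinuousAt.congr ?_ e.symm
  refine (continuousAt_const.div (h.continuous_regSol.continuousAt.pow 2)
    (pow_ne_zero 2 (h.regSol_ne_zero hz))).sub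
    (h.continuous_deriv.continuousAt.div (continuousAt_const.mul (h.continuous.continuousAt.pow 2))
      (mul_ne_zero (h.deriv_pos 0).ne' (pow_ne_zero 2 (h.ne_zero hz))))

theorem continuous_jTail (h : Profile c M L B) (h2 : deriv (deriv B) 0 = 0) :
    Continuous (jTail B k) :=
  continuous_const.sub (intervalIntegral.continuous_primitive
    (fun _ _ => (h.integrable_jIntegrand h2 k).intervalIntegrable) 0)

theorem hasDerivAt_jTail (h : Profile c M L B) (h2 : deriv (deriv B) 0 = 0) {z : ℝ} (hz : z ≠ 0) :
    HasDerivAt (jTail B k) (-jIntegrand B k z) z := by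
  have hi := h.integrable_jIntegrand h2 k
  exact (intervalIntegral.integral_hasDerivAt_right hi.intervalIntegrable
    ⟨univ, univ_mem, hi.aestronglyMeasurable.restrict⟩
    (h.continuousAt_jIntegrand hz)).const_sub _

theorem tendsto_jTail_atTop (h : Profile c M L B) (h2 : deriv (deriv B) 0 = 0) :
    Tendsto (jTail B k) atTop (𝓝 0) := by
  have := (intervalIntegral_tendsto_integral_Ioi 0
    (h.integrable_jIntegrand h2 k).integrableOn tendsto_id).const_sub
    (∫ t in Ioi 0, jIntegrand B k t)
  rwa [sub_self] at this

/-- The limit at `-∞` is the full integral of `jIntegrand`, that is `J₁`. This is where its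
vanishing makes the solution decay on both sides. -/
theorem tendsto_jTail_atBot (h : Profile c M L B) (h2 : deriv (deriv B) 0 = 0)
    (hJ : J1 B k 0 = 0) : Tendsto (jTail B k) atBot (𝓝 0) := by
  have hi := h.integrable_jIntegrand h2 k
  have := (intervalIntegral_tendsto_integral_Iic 0 hi.integrableOn tendsto_id).const_add
    (∫ t in Ioi 0, jIntegrand B k t)
  have e : (∫ t in Ioi 0, jIntegrand B k t) + ∫ t in Iic 0, jIntegrand B k t = 0 := by
    rw [add_comm, intervalIntegral.integral_Iic_add_Ioi hi.integrableOn hi.integrableOn,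
      h.integral_jIntegrand h2, hJ]
  rw [e] at this
  refine this.congr fun z => ?_
  rw [jTail, intervalIntegral.integral_symm 0 (id z)]
  exact (sub_eq_add_neg _ _).symm

theorem hasDerivAt_regSol (h : Profile c M L B) (z : ℝ) :
    HasDerivAt (regSol B k) (regSolDeriv B k z) z :=
  (h.hasDerivAt z).mul (h.deriv_phiFn k ▸ h.hasDerivAt_phiFn k z)

theorem hasDerivAt_deriv_phiFn (h : Profile c M L B) {z : ℝ} (hz : z ≠ 0) :
    HasDerivAt (deriv (phiFn k B))
      ((k : ℝ) ^ 2 * phiFn k B z - 2 * deriv B z * deriv (phiFn k B) z / B z) z := by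
  have hB := h.ne_zero hz
  have h1 := (h.isPhi1_phiFn k).2.1 z
  simp only [h.zero, sub_zero] at h1
  have h2 := h1.div ((h.hasDerivAt z).pow 2) (pow_ne_zero 2 hB)
  have e : deriv (phiFn k B) =ᶠ[𝓝 z]
      ((fun z => B z ^ 2 * deriv (phiFn k B) z) / (B ^ 2)) := by
    filter_upwards [isOpen_ne.mem_nhds hz] with y hy
    have := h.ne_zero hy
    simp only [Pi.div_apply, Pi.pow_apply]
    field_simp
  refine (h2.congr_of_eventuallyEq e).congr_deriv ?_
  simp only [Pi.pow_apply]
  field_simp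
  ring

/-- This is the Rayleigh equation at speed `0`: the substitution `u = B φ` removes the first-order
term of the equation for `φ`. -/
theorem hasDerivAt_regSolDeriv (h : Profile c M L B) {z : ℝ} (hz : z ≠ 0) :
    HasDerivAt (regSolDeriv B k)
      (((k : ℝ) ^ 2 + deriv (deriv B) z / B z) * regSol B k z) z := by
  have hB := h.ne_zero hz
  have hφ : HasDerivAt (phiFn k B) (deriv (phiFn k B) z) z :=
    h.deriv_phiFn k ▸ h.hasDerivAt_phiFn k z
  refine (((h.hasDerivAt_deriv z).mul hφ).add
    ((h.hasDerivAt z).mul (h.hasDerivAt_deriv_phiFn (k := k) hz))).congr_deriv ?_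
  rw [regSol]
  field_simp
  ring

theorem hasDerivAt_eigenRatio (h : Profile c M L B) (h2 : deriv (deriv B) 0 = 0) {z : ℝ}
    (hz : z ≠ 0) : HasDerivAt (eigenRatio B k) (-(1 / regSol B k z ^ 2)) z := by
  have hB := h.ne_zero hz
  have hβ := (h.deriv_pos 0).ne'
  refine ((((h.hasDerivAt z).const_mul (deriv B 0)).inv (mul_ne_zero hβ hB)).add
    (h.hasDerivAt_jTail (k := k) h2 hz)).congr_deriv ?_
  rw [h.jIntegrand_eq hz]
  field_simp
  ring

theorem eigenSol_eq (h : Profile c M L B) {z : ℝ} (hz : z ≠ 0) :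
    eigenSol B k z = regSol B k z * eigenRatio B k z := by
  have hB := h.ne_zero hz
  have hβ := (h.deriv_pos 0).ne'
  rw [eigenSol, eigenRatio, regSol]
  field_simp

theorem eigenSolDeriv_eq (h : Profile c M L B) {z : ℝ} (hz : z ≠ 0) :
    eigenSolDeriv B k z = regSolDeriv B k z * eigenRatio B k z - 1 / regSol B k z := by
  have hB := h.ne_zero hz
  have hβ := (h.deriv_pos 0).ne'
  have hφ := (h.phiFn_pos k z).ne'
  rw [eigenSolDeriv, eigenRatio, h.jIntegrand_eq hz, regSol, regSolDeriv]
  field_simp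
  ring

theorem hasDerivAt_eigenSol (h : Profile c M L B) (h2 : deriv (deriv B) 0 = 0) (z : ℝ) :
    HasDerivAt (eigenSol B k) (eigenSolDeriv B k z) z := by
  have hφ : HasDerivAt (phiFn k B) (deriv (phiFn k B) z) z :=
    h.deriv_phiFn k ▸ h.hasDerivAt_phiFn k z
  rcases eq_or_ne z 0 with rfl | hz
  -- The tail is only known to be continuous at the critical point, which is enough because its
  -- factor `regSol` vanishes there.
  · have h0 : regSol B k 0 = 0 := by rw [regSol, h.zero, zero_mul]
    refine ((hφ.div_const _).add (hasDerivAt_mul_of_eq_zero (h.hasDerivAt_regSol (k := k) 0) h0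
      (h.continuous_jTail (k := k) h2).continuousAt)).congr_deriv ?_
    rw [eigenSolDeriv, h0]
    ring
  · refine ((hφ.div_const _).add ((h.hasDerivAt_regSol (k := k) z).mul
      (h.hasDerivAt_jTail (k := k) h2 hz))).congr_deriv ?_
    rw [eigenSolDeriv]
    ring

theorem hasDerivAt_eigenSolDeriv (h : Profile c M L B) (h2 : deriv (deriv B) 0 = 0) {z : ℝ}
    (hz : z ≠ 0) :
    HasDerivAt (eigenSolDeriv B k) ((k : ℝ) ^ 2 * eigenSol B k z + eigenVort B k z) z := by
  have hu := h.regSol_ne_zero (k := k) hz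
  have e : eigenSolDeriv B k =ᶠ[𝓝 z]
      fun z => regSolDeriv B k z * eigenRatio B k z - (regSol B k z)⁻¹ := by
    filter_upwards [isOpen_ne.mem_nhds hz] with y hy
    rw [h.eigenSolDeriv_eq hy, one_div]
  refine ((((h.hasDerivAt_regSolDeriv hz).mul (h.hasDerivAt_eigenRatio h2 hz)).sub
    ((h.hasDerivAt_regSol z).inv hu)).congr_of_eventuallyEq e).congr_deriv ?_
  rw [eigenVort, h.eigenSol_eq hz]
  field_simp
  ring

theorem continuous_eigenSolDeriv (h : Profile c M L B) (h2 : deriv (deriv B) 0 = 0) :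
    Continuous (eigenSolDeriv B k) := by
  rw [continuous_iff_continuousAt]
  intro z
  rcases eq_or_ne z 0 with rfl | hz
  · refine (((h.continuous_deriv_phiFn k).div_const _).add
      (h.continuous_regSolDeriv.mul (h.continuous_jTail h2))).continuousAt.sub ?_
    obtain ⟨K, hK⟩ := h.exists_abs_jIntegrand_le h2 k
    have h0 : regSol B k 0 = 0 := by rw [regSol, h.zero, zero_mul]
    have hlim : Tendsto (regSol B k) (𝓝 0) (𝓝 0) := by
      have := h.continuous_regSol (k := k) |>.tendsto 0
      rwa [h0] at this
    rw [ContinuousAt, h0, zero_mul]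
    exact hlim.zero_mul_isBoundedUnder_le
      (isBoundedUnder_of ⟨K, fun z => by simpa using hK z⟩)
  · exact (h.hasDerivAt_eigenSolDeriv h2 hz).continuousAt

theorem tendsto_inv_mul_apply_cocompact (h : Profile c M L B) :
    Tendsto (fun z => (deriv B 0 * B z)⁻¹) (cocompact ℝ) (𝓝 0) := by
  refine tendsto_inv₀_cobounded.comp ?_
  rw [← tendsto_norm_atTop_iff_cobounded]
  have hβ := h.deriv_pos 0
  have h1 : Tendsto (fun z : ℝ => deriv B 0 * (c * ‖z‖)) (cocompact ℝ) atTop :=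
    (tendsto_norm_cocompact_atTop.const_mul_atTop h.pos).const_mul_atTop hβ
  refine tendsto_atTop_mono (fun z => ?_) h1
  rw [norm_mul, Real.norm_eq_abs (deriv B 0), abs_of_pos hβ]
  exact mul_le_mul_of_nonneg_left (h.le_abs z) hβ.le

theorem tendsto_eigenRatio_atTop (h : Profile c M L B) (h2 : deriv (deriv B) 0 = 0) :
    Tendsto (eigenRatio B k) atTop (𝓝 0) := by
  have := (h.tendsto_inv_mul_apply_cocompact.mono_left atTop_le_cocompact).add
    (h.tendsto_jTail_atTop (k := k) h2)
  rwa [add_zero] at this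

theorem tendsto_eigenRatio_atBot (h : Profile c M L B) (h2 : deriv (deriv B) 0 = 0)
    (hJ : J1 B k 0 = 0) : Tendsto (eigenRatio B k) atBot (𝓝 0) := by
  have := (h.tendsto_inv_mul_apply_cocompact.mono_left atBot_le_cocompact).add
    (h.tendsto_jTail_atBot h2 hJ)
  rwa [add_zero] at this

/-- Past `z` the factor `φ` only grows, so `u²` keeps the quadratic lower bound with the constant
frozen at `z`; this feeds `tail_pos_le`. -/
theorem le_regSol_sq (h : Profile c M L B) {x z : ℝ} (h0 : 0 ≤ z * x) (hzx : |z| ≤ |x|) :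
    c ^ 2 * phiFn k B z ^ 2 * x ^ 2 ≤ regSol B k x ^ 2 := by
  have h1 := h.phiFn_le_of_abs_le k h0 hzx
  have h2 := (h.phiFn_pos k z).le
  have h3 := h.sq_le x
  have h4 := h.pos
  calc c ^ 2 * phiFn k B z ^ 2 * x ^ 2 = (c ^ 2 * x ^ 2) * phiFn k B z ^ 2 := by ring
    _ ≤ B x ^ 2 * phiFn k B x ^ 2 := by gcongr
    _ = _ := by rw [regSol, mul_pow]

/-- The Rayleigh solution decaying on both sides keeps a sign and is quantitatively bounded. -/
theorem eigenRatio_sign_bound (h : Profile c M L B) (h2 : deriv (deriv B) 0 = 0)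
    (hJ : J1 B k 0 = 0) {z : ℝ} (hz : z ≠ 0) :
    0 < eigenRatio B k z * B z ∧ |eigenRatio B k z| ≤ 1 / (c ^ 2 * phiFn k B z ^ 2 * |z|) := by
  have hK : 0 < c ^ 2 * phiFn k B z ^ 2 := by
    have := h.pos; have := h.phiFn_pos k z; positivity
  rcases hz.lt_or_gt with hz | hz
  · have hz' : 0 < -z := by linarith
    -- The left half-line reduces to the right one by reflection, with a sign change because the
    -- derivative of `eigenRatio` keeps its sign.
    obtain ⟨a1, a2⟩ := tail_pos_le (I := fun x => -eigenRatio B k (-x))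
      (u := fun x => regSol B k (-x)) hz' hK
      (fun x hx => by
        have := ((h.hasDerivAt_eigenRatio (k := k) h2 (z := -x) (by linarith)).scomp x
          (hasDerivAt_neg x)).neg
        refine this.congr_deriv ?_
        simp)
      (fun x hx => h.regSol_ne_zero (by linarith))
      (by
        have := ((h.tendsto_eigenRatio_atBot h2 hJ).comp tendsto_neg_atTop_atBot).neg
        rwa [neg_zero] at this)
      (fun x hx => by
        have := h.le_regSol_sq (k := k) (x := -x) (z := z) (by nlinarith) (by
          rw [abs_neg, abs_of_neg hz, abs_of_pos (by linarith)]; exact hx)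
        rwa [neg_sq] at this)
    simp only [neg_neg] at a1 a2
    have hB : B z < 0 := h.zero ▸ h.strictMono hz
    refine ⟨by nlinarith, ?_⟩
    rw [abs_of_neg (by linarith), abs_of_neg hz]
    exact a2
  · obtain ⟨a1, a2⟩ := tail_pos_le (I := eigenRatio B k) (u := regSol B k) hz hK
      (fun x hx => h.hasDerivAt_eigenRatio h2 hx.ne') (fun x hx => h.regSol_ne_zero hx.ne')
      (h.tendsto_eigenRatio_atTop h2)
      (fun x hx => h.le_regSol_sq (by nlinarith) (by
        rw [abs_of_pos hz, abs_of_pos (by linarith)]; exact hx))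
    have hB : 0 < B z := h.zero ▸ h.strictMono hz
    refine ⟨by positivity, ?_⟩
    rw [abs_of_pos a1, abs_of_pos hz]
    exact a2

theorem eigenSol_pos (h : Profile c M L B) (h2 : deriv (deriv B) 0 = 0) (hJ : J1 B k 0 = 0)
    {z : ℝ} (hz : z ≠ 0) : 0 < eigenSol B k z := by
  rw [h.eigenSol_eq hz, regSol, mul_right_comm, mul_comm (B z)]
  exact mul_pos (h.eigenRatio_sign_bound h2 hJ hz).1 (h.phiFn_pos k z)

theorem le_phiFn' (h : Profile c M L B) (hk : k ≠ 0) (z : ℝ) :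
    c ^ 4 / 6 * (1 + z ^ 2) ≤ phiFn k B z := by
  refine le_trans ?_ (h.le_phiFn k z)
  have hc := h.pos
  have h1 : c ^ 4 ≤ 1 := pow_le_one₀ hc.le h.c_le_one
  have h2 : (1 : ℝ) ≤ (k : ℝ) ^ 2 := by
    have : (1 : ℤ) ≤ k ^ 2 := by have := sq_nonneg k; have := pow_ne_zero 2 hk; omega
    exact_mod_cast this
  have h3 : z ^ 2 ≤ ((k : ℝ) * z) ^ 2 := by rw [mul_pow]; nlinarith [sq_nonneg z]
  nlinarith [show 0 < c ^ 4 / 6 by positivity]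

/-- The tail bound carries `φ⁻²`, one power of which survives multiplication by `u = B φ`. The
quadratic growth of `φ` then gives decay like `z⁻²`. -/
theorem abs_eigenSol_le (h : Profile c M L B) (h2 : deriv (deriv B) 0 = 0) (hJ : J1 B k 0 = 0)
    (hk : k ≠ 0) {z : ℝ} (hz : z ≠ 0) : |eigenSol B k z| ≤ 6 / c ^ 7 * (1 + z ^ 2)⁻¹ := by
  have hc := h.pos
  have hφ := h.phiFn_pos k z
  have hz' : 0 < |z| := abs_pos.2 hz
  rw [h.eigenSol_eq hz, regSol, abs_mul, abs_mul, abs_of_pos hφ]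
  calc |B z| * phiFn k B z * |eigenRatio B k z|
      ≤ c⁻¹ * |z| * phiFn k B z * (1 / (c ^ 2 * phiFn k B z ^ 2 * |z|)) := by
        gcongr
        · exact h.abs_le z
        · exact (h.eigenRatio_sign_bound h2 hJ hz).2
    _ = 1 / c ^ 3 / phiFn k B z := by field_simp
    _ ≤ 1 / c ^ 3 / (c ^ 4 / 6 * (1 + z ^ 2)) := by
        gcongr
        exact h.le_phiFn' hk z
    _ = _ := by field_simp

theorem abs_eigenSolDeriv_le (h : Profile c M L B) (h2 : deriv (deriv B) 0 = 0)
    (hJ : J1 B k 0 = 0) (hk : k ≠ 0) {z : ℝ} (hz : z ≠ 0) :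
    |eigenSolDeriv B k z| ≤ (1 / c ^ 3 + 6 * (k : ℝ) ^ 2 / c ^ 7 + 1 / c) / |z| := by
  have hc := h.pos
  have hφ := h.phiFn_pos k z
  have hφ1 := h.one_le_phiFn k z
  have hz' : 0 < |z| := abs_pos.2 hz
  have hI := (h.eigenRatio_sign_bound h2 hJ hz).2
  have hq : z ^ 2 / phiFn k B z ≤ 6 / c ^ 4 := by
    rw [div_le_div_iff₀ hφ (by positivity)]
    have := h.le_phiFn' hk z
    nlinarith [show 0 < c ^ 4 by positivity]
  have hu' : |regSolDeriv B k z| ≤ c⁻¹ * phiFn k B z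
      + c⁻¹ * |z| * ((k : ℝ) ^ 2 * (phiFn k B z * |z|)) := by
    rw [regSolDeriv]
    refine (abs_add_le _ _).trans (add_le_add ?_ ?_)
    · rw [abs_mul, abs_of_pos hφ, abs_of_pos (h.deriv_pos z)]
      exact mul_le_mul_of_nonneg_right (h.deriv_le z) hφ.le
    · rw [abs_mul]
      exact mul_le_mul (h.abs_le z) (h.abs_deriv_phiFn_le k z) (abs_nonneg _) (by positivity)
  have hu : 1 / |regSol B k z| ≤ 1 / (c * |z|) := by
    rw [regSol, abs_mul, abs_of_pos hφ]
    refine one_div_le_one_div_of_le (by positivity) ?_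
    calc c * |z| = c * |z| * 1 := (mul_one _).symm
      _ ≤ _ := mul_le_mul (h.le_abs z) hφ1 zero_le_one (abs_nonneg _)
  rw [h.eigenSolDeriv_eq hz]
  refine (abs_sub _ _).trans ?_
  rw [abs_mul, abs_div, abs_one]
  have e1 : |regSolDeriv B k z| * |eigenRatio B k z|
      ≤ (1 / c ^ 3 + 6 * (k : ℝ) ^ 2 / c ^ 7) / |z| := by
    calc _ ≤ (c⁻¹ * phiFn k B z + c⁻¹ * |z| * ((k : ℝ) ^ 2 * (phiFn k B z * |z|)))
          * (1 / (c ^ 2 * phiFn k B z ^ 2 * |z|)) :=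
          mul_le_mul hu' hI (abs_nonneg _) (by positivity)
      _ = (1 / c ^ 3 * (1 / phiFn k B z)
          + (k : ℝ) ^ 2 / c ^ 3 * (|z| ^ 2 / phiFn k B z)) / |z| := by field_simp
      _ ≤ (1 / c ^ 3 * 1 + (k : ℝ) ^ 2 / c ^ 3 * (6 / c ^ 4)) / |z| := by
          rw [sq_abs]
          gcongr
          rw [div_le_one hφ]; exact hφ1
      _ = _ := by field_simp
  calc _ ≤ (1 / c ^ 3 + 6 * (k : ℝ) ^ 2 / c ^ 7) / |z| + 1 / (c * |z|) := add_le_add e1 hu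
    _ = _ := by field_simp

theorem continuous_eigenSol (h : Profile c M L B) (h2 : deriv (deriv B) 0 = 0) :
    Continuous (eigenSol B k) :=
  continuous_iff_continuousAt.2 fun z => (h.hasDerivAt_eigenSol h2 z).continuousAt

theorem memLp_eigenSol (h : Profile c M L B) (h2 : deriv (deriv B) 0 = 0) (hJ : J1 B k 0 = 0)
    (hk : k ≠ 0) : MemLp (eigenSol B k) 2 volume := by
  refine memLp_two_of_sq_le (C := (6 / c ^ 7) ^ 2) (h.continuous_eigenSol h2).aestronglyMeasurable ?_
  filter_upwards [compl_mem_ae_iff.2 (measure_singleton (0 : ℝ))] with z hz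
  have h1 := h.abs_eigenSol_le h2 hJ hk (z := z) (by simpa using hz)
  have h3 : (1 + z ^ 2)⁻¹ ≤ 1 := inv_le_one_of_one_le₀ (by nlinarith [sq_nonneg z])
  have h4 : 0 ≤ (1 + z ^ 2)⁻¹ := by positivity
  calc eigenSol B k z ^ 2 = |eigenSol B k z| ^ 2 := (sq_abs _).symm
    _ ≤ (6 / c ^ 7 * (1 + z ^ 2)⁻¹) ^ 2 := by gcongr
    _ = (6 / c ^ 7) ^ 2 * ((1 + z ^ 2)⁻¹ * (1 + z ^ 2)⁻¹) := by ring
    _ ≤ (6 / c ^ 7) ^ 2 * ((1 + z ^ 2)⁻¹ * 1) := by gcongr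
    _ = _ := by rw [mul_one]

theorem memLp_eigenSolDeriv (h : Profile c M L B) (h2 : deriv (deriv B) 0 = 0)
    (hJ : J1 B k 0 = 0) (hk : k ≠ 0) : MemLp (eigenSolDeriv B k) 2 volume := by
  obtain ⟨A, hA⟩ := (isCompact_Icc (a := (-1 : ℝ)) (b := 1)).exists_bound_of_continuousOn
    (h.continuous_eigenSolDeriv (k := k) h2).continuousOn
  refine memLp_two_of_sq_le (h.continuous_eigenSolDeriv h2).aestronglyMeasurable
    (Eventually.of_forall fun z => le_mul_inv_one_add_sq (K₁ := A ^ 2)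
    (K₂ := (1 / c ^ 3 + 6 * (k : ℝ) ^ 2 / c ^ 7 + 1 / c) ^ 2) (fun hz => ?_) (fun hz => ?_)
    (sq_nonneg _) (sq_nonneg _))
  · have := hA z (_root_.abs_le.1 hz)
    rw [Real.norm_eq_abs] at this
    rw [← sq_abs]; gcongr
  · have hz0 : z ≠ 0 := by rintro rfl; norm_num at hz
    have := h.abs_eigenSolDeriv_le h2 hJ hk hz0
    calc eigenSolDeriv B k z ^ 2 = |eigenSolDeriv B k z| ^ 2 := (sq_abs _).symm
      _ ≤ ((1 / c ^ 3 + 6 * (k : ℝ) ^ 2 / c ^ 7 + 1 / c) / |z|) ^ 2 := by gcongr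
      _ = _ := by rw [div_pow, sq_abs]

/-- A Lipschitz `B''` that vanishes at `0` is `O(|z|)`, and `|B| ≥ c|z|`. Hence the vorticity
inherits square integrability from the stream function. -/
theorem abs_deriv2_div_le (h : Profile c M L B) (h2 : deriv (deriv B) 0 = 0) (z : ℝ) :
    |deriv (deriv B) z / B z| ≤ L / c := by
  have hc := h.pos
  have hL := h.L_nonneg
  rcases eq_or_ne z 0 with rfl | hz
  · rw [h2, zero_div, abs_zero]; positivity
  · have hz' : 0 < |z| := abs_pos.2 hz
    have := h.lipschitz z 0
    rw [h2, sub_zero, sub_zero] at this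
    rw [abs_div]
    calc _ ≤ L * |z| / (c * |z|) := div_le_div₀ (by positivity) this (by positivity) (h.le_abs z)
      _ = _ := by field_simp

theorem memLp_eigenVort (h : Profile c M L B) (h2 : deriv (deriv B) 0 = 0) (hJ : J1 B k 0 = 0)
    (hk : k ≠ 0) : MemLp (eigenVort B k) 2 volume := by
  refine (h.memLp_eigenSol h2 hJ hk).of_le_mul (c := L / c) ?_ (Eventually.of_forall fun z => ?_)
  · exact ((h.continuous_deriv2.measurable.div h.continuous.measurable).mul
      (h.continuous_eigenSol h2).measurable).aestronglyMeasurable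
  · rw [eigenVort, norm_mul]
    exact mul_le_mul_of_nonneg_right (h.abs_deriv2_div_le h2 z) (norm_nonneg _)

/-- The stream function is positive off `0`, so zero vorticity forces `B'' = 0` everywhere. Then `Π₁
= 0` and the coercivity of `Π₂` makes `J₁` negative, against `J₁ = 0`. -/
theorem eigenVort_ne_zero (h : Profile c M L B) (h2 : deriv (deriv B) 0 = 0) (hJ : J1 B k 0 = 0)
    (hk : k ≠ 0) : ¬ (eigenVort B k =ᵐ[volume] 0) := by
  intro hw
  have h3 : deriv (deriv B) =ᵐ[volume] fun _ => (0 : ℝ) := by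
    filter_upwards [hw, compl_mem_ae_iff.2 (measure_singleton (0 : ℝ))] with z hz hz0
    have hz0 : z ≠ 0 := by simpa using hz0
    have h4 := (h.eigenSol_pos h2 hJ hz0).ne'
    have h5 := h.ne_zero hz0
    simpa [eigenVort, h4, h5] using hz
  have h4 : deriv (deriv B) = fun _ => 0 :=
    (h.continuous_deriv2.ae_eq_iff_eq volume continuous_const).1 h3
  have h5 : ∀ z, deriv B z = deriv B 0 := fun z =>
    is_const_of_deriv_eq_zero (h.contDiff_deriv.differentiable (by norm_num))
      (fun x => congrFun h4 x) z 0
  have h6 : Pi1 B 0 = 0 := by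
    rw [h.pi1_eq_of_critical h2]
    simp [h.pi1Integrand_eq, h5]
  have h7 := h.J1_le hk
  rw [hJ, h6, abs_zero, mul_zero, zero_sub] at h7
  have : 0 < coerciveConst c * |(k : ℝ)| :=
    mul_pos (coerciveConst_pos h.pos) (abs_pos.2 (by exact_mod_cast hk))
  linarith

/-- If `J₁` and `J₂` both vanish at the critical point, then its velocity is an embedded
eigenvalue. -/
theorem isRayleighEigenvalue (h : Profile c M L B) (h2 : deriv (deriv B) 0 = 0)
    (hJ : J1 B k 0 = 0) (hk : k ≠ 0) : IsRayleighEigenvalue B k 0 := by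
  have m0 := h.memLp_eigenSol h2 hJ hk
  have m1 := h.memLp_eigenSolDeriv h2 hJ hk
  have mw := h.memLp_eigenVort h2 hJ hk
  set ψ₂ : ℝ → ℝ := fun z => (k : ℝ) ^ 2 * eigenSol B k z + eigenVort B k z with hψ₂
  have m2 : MemLp ψ₂ 2 volume := (m0.const_mul ((k : ℝ) ^ 2)).add mw
  have l2 : LocallyIntegrable ψ₂ volume := m2.locallyIntegrable (by norm_num)
  have c1 := h.continuous_eigenSolDeriv (k := k) h2
  have w1 : HasWeakDeriv (eigenSol B k) (eigenSolDeriv B k) :=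
    hasWeakDeriv_of_eq_integral c1.locallyIntegrable fun y => by
      rw [intervalIntegral.integral_eq_sub_of_hasDerivAt (fun x _ => h.hasDerivAt_eigenSol h2 x)
        (c1.intervalIntegrable _ _)]
      ring
  have w2 : HasWeakDeriv (eigenSolDeriv B k) ψ₂ :=
    hasWeakDeriv_of_eq_integral l2 fun y => by
      -- The second derivative is only computed off the critical point; continuity of
      -- `eigenSolDeriv` there excludes a Dirac mass.
      rw [integral_eq_of_hasDerivAt_off_countable (eigenSolDeriv B k) ψ₂ (countable_singleton 0)
        c1.continuousOn (fun x hx => h.hasDerivAt_eigenSolDeriv h2 (by simpa using hx.2))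
        (l2.integrableOn_isCompact isCompact_uIcc).intervalIntegrable]
      ring
  refine ⟨fun y => (eigenVort B k y : ℂ), fun y => (eigenSol B k y : ℂ), mw.ofReal, fun hw => ?_,
    ⟨_, _, hasWeakDeriv_ofReal w1, hasWeakDeriv_ofReal w2, m0.ofReal, m1.ofReal, m2.ofReal,
      Eventually.of_forall fun y => ?_⟩, ?_⟩
  · refine h.eigenVort_ne_zero h2 hJ hk ?_
    filter_upwards [hw] with y hy
    simpa using hy
  · simp only [hψ₂]
    push_cast
    ring
  · filter_upwards [compl_mem_ae_iff.2 (measure_singleton (0 : ℝ))] with y hy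
    have hB : (B y : ℂ) ≠ 0 := by exact_mod_cast h.ne_zero (by simpa using hy)
    rw [eigenVort]
    push_cast
    field_simp
    ring

end Profile

/-! ### Eigenvalues under translation -/

theorem hasWeakDeriv_comp_sub {f g : ℝ → ℂ} (h : HasWeakDeriv f g) (a : ℝ)
    (hf : LocallyIntegrable (fun y => f (y - a)) volume)
    (hg : LocallyIntegrable (fun y => g (y - a)) volume) :
    HasWeakDeriv (fun y => f (y - a)) (fun y => g (y - a)) := by
  refine ⟨hf, hg, fun φ hφ hc => ?_⟩
  have h1 : ContDiff ℝ ∞ fun y => φ (y + a) := hφ.comp (contDiff_id.add contDiff_const)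
  have h2 : HasCompactSupport fun y => φ (y + a) := hc.comp_homeomorph (Homeomorph.addRight a)
  have := h.2.2 _ h1 h2
  have e1 := integral_sub_right_eq_self (μ := volume)
    (fun y => deriv (fun y => φ (y + a)) y • f y) a
  have e2 := integral_sub_right_eq_self (μ := volume) (fun y => φ (y + a) • g y) a
  rw [← e1, ← e2] at this
  simpa only [deriv_comp_add_const, sub_add_cancel] using this

/-- Eigenvalues of the Rayleigh operator under a Galilean change of frame. -/
theorem isRayleighEigenvalue_of_translate {b B : ℝ → ℝ} {k : ℤ} {a : ℝ}
    (hB : ∀ z, B z = b (a + z) - b a) (h : IsRayleighEigenvalue B k 0) :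
    IsRayleighEigenvalue b k (b a) := by
  obtain ⟨w, ψ, hw, hw0, ⟨ψ₁, ψ₂, d1, d2, m0, m1, m2, he⟩, hr⟩ := h
  have mp := measurePreserving_sub_right (volume : Measure ℝ) a
  have tr : ∀ {f : ℝ → ℂ}, MemLp f 2 volume → MemLp (fun y => f (y - a)) 2 volume :=
    fun hf => hf.comp_measurePreserving mp
  have loc : ∀ {f : ℝ → ℂ}, MemLp f 2 volume → LocallyIntegrable (fun y => f (y - a)) volume :=
    fun hf => (tr hf).locallyIntegrable (by norm_num)
  have hd : ∀ z, deriv (deriv B) z = deriv (deriv b) (a + z) := fun z => by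
    have h1 : deriv B = fun z => deriv b (a + z) := by
      funext z
      rw [show B = fun z => b (a + z) - b a from funext hB, deriv_sub_const, deriv_comp_const_add]
    rw [h1, deriv_comp_const_add]
  refine ⟨fun y => w (y - a), fun y => ψ (y - a), tr hw, fun h0 => hw0 ?_,
    ⟨fun y => ψ₁ (y - a), fun y => ψ₂ (y - a), hasWeakDeriv_comp_sub d1 a (loc m0) (loc m1),
      hasWeakDeriv_comp_sub d2 a (loc m1) (loc m2), tr m0, tr m1, tr m2,
      mp.quasiMeasurePreserving.ae he⟩, ?_⟩
  · have := (measurePreserving_add_right (volume : Measure ℝ) a).quasiMeasurePreserving.ae h0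
    filter_upwards [this] with y hy
    simpa using hy
  · filter_upwards [mp.quasiMeasurePreserving.ae hr] with y hy
    rw [hB, hd, add_sub_cancel] at hy
    push_cast at hy
    linear_combination hy

/-! ### Gaussian averages and diffused profiles -/

/-- The Gaussian average of `f` around `y` at scale `σ`. -/
noncomputable def gaussAvg (f : ℝ → ℝ) (σ y : ℝ) : ℝ :=
  ∫ x, f (y + σ * x) ∂(ProbabilityTheory.gaussianReal 0 1)

/-- Viscosity and time enter only through the standard deviation `√(2νt)`; the standard Gaussian is
pushed forward by `x ↦ y + √(2νt) x`. -/
theorem heatFlow_eq_gaussAvg {f : ℝ → ℝ} (hf : Continuous f) {ν t : ℝ} (hνt : 0 ≤ 2 * ν * t) :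
    heatFlow ν f t = gaussAvg f (√(2 * ν * t)) := by
  funext y
  have h1 : (ProbabilityTheory.gaussianReal 0 1).map (fun x => y + √(2 * ν * t) * x) =
      ProbabilityTheory.gaussianReal y (2 * ν * t).toNNReal := by
    have h2 := ProbabilityTheory.gaussianReal_map_const_mul (μ := 0) (v := 1) (√(2 * ν * t))
    have h3 := ProbabilityTheory.gaussianReal_map_const_add (μ := √(2 * ν * t) * 0)
      (v := NNReal.mk (√(2 * ν * t) ^ 2) (sq_nonneg _) * 1) y
    rw [← h2, Measure.map_map (by fun_prop) (by fun_prop)] at h3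
    rw [show (fun x => y + √(2 * ν * t) * x) = (fun x => y + x) ∘ fun x => √(2 * ν * t) * x from rfl,
      h3]
    congr 1
    · simp
    · ext
      simp [Real.sq_sqrt hνt, Real.coe_toNNReal _ hνt]
  rw [heatFlow, gaussAvg, ← h1, integral_map (by fun_prop) hf.aestronglyMeasurable]

theorem integrable_abs_gaussian : Integrable (fun x : ℝ => |x|)
    (ProbabilityTheory.gaussianReal 0 1) :=
  ((ProbabilityTheory.memLp_id_gaussianReal (μ := 0) (v := 1) 1).integrable (by simp)).abs

theorem integrable_of_bounded_gaussian {f : ℝ → ℝ} (hf : Continuous f) {K : ℝ}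
    (hK : ∀ y, |f y| ≤ K) (σ y : ℝ) :
    Integrable (fun x => f (y + σ * x)) (ProbabilityTheory.gaussianReal 0 1) :=
  Integrable.of_bound (hf.comp (by fun_prop)).aestronglyMeasurable K
    (Eventually.of_forall fun x => hK _)

theorem continuous_gaussAvg {f : ℝ → ℝ} (hf : Continuous f) {K : ℝ} (hK : ∀ y, |f y| ≤ K) :
    Continuous fun q : ℝ × ℝ => gaussAvg f q.1 q.2 := by
  refine continuous_of_dominated (bound := fun _ => K)
    (fun q => (hf.comp (by fun_prop)).aestronglyMeasurable)
    (fun q => Eventually.of_forall fun x => hK _) (integrable_const K)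
    (Eventually.of_forall fun x => hf.comp (by fun_prop))

theorem hasDerivAt_gaussAvg {f : ℝ → ℝ} (hf : ContDiff ℝ 1 f) {K : ℝ}
    (hK : ∀ y, |deriv f y| ≤ K) (σ y : ℝ) :
    HasDerivAt (gaussAvg f σ) (gaussAvg (deriv f) σ y) y := by
  have hfd : ∀ z, HasDerivAt f (deriv f z) z := fun z =>
    (hf.differentiable (by norm_num) z).hasDerivAt
  -- Here `f` need not be bounded: a bounded derivative gives linear growth, and the Gaussian has a
  -- finite first moment.
  have hint : Integrable (fun x => f (y + σ * x)) (ProbabilityTheory.gaussianReal 0 1) := by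
    refine ((integrable_const (|f 0| + K * |y|)).add
      (integrable_abs_gaussian.const_mul (K * |σ|))).mono'
      (hf.continuous.comp (by fun_prop)).aestronglyMeasurable (Eventually.of_forall fun x => ?_)
    have h1 := abs_sub_le_of_abs_deriv_le hfd (z := y + σ * x) fun z _ => hK z
    have h2 : |f (y + σ * x)| ≤ |f 0| + |f (y + σ * x) - f 0| := by
      have := abs_add_le (f 0) (f (y + σ * x) - f 0)
      rwa [add_sub_cancel] at this
    have h3 : |y + σ * x| ≤ |y| + |σ| * |x| := by
      rw [← abs_mul]; exact abs_add_le _ _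
    have hK0 : 0 ≤ K := (abs_nonneg _).trans (hK 0)
    have h4 := mul_le_mul_of_nonneg_left h3 hK0
    simp only [Pi.add_apply, Real.norm_eq_abs]
    linarith
  refine (hasDerivAt_integral_of_dominated_loc_of_deriv_le
    (F := fun z x => f (z + σ * x)) (F' := fun z x => deriv f (z + σ * x)) (bound := fun _ => K)
    univ_mem (Eventually.of_forall fun z => (hf.continuous.comp (by fun_prop)).aestronglyMeasurable)
    hint ((hf.continuous_deriv le_rfl).comp (by fun_prop)).aestronglyMeasurable
    (Eventually.of_forall fun x z _ => hK _) (integrable_const K)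
    (Eventually.of_forall fun x z _ => (hfd (z + σ * x)).comp_add_const z (σ * x))).2

theorem le_gaussAvg {f : ℝ → ℝ} (hf : Continuous f) {K a : ℝ} (hK : ∀ y, |f y| ≤ K)
    (ha : ∀ y, a ≤ f y) (σ y : ℝ) : a ≤ gaussAvg f σ y := by
  have := integral_mono (integrable_const a) (integrable_of_bounded_gaussian hf hK σ y)
    fun x => ha (y + σ * x)
  simpa [gaussAvg] using this

theorem gaussAvg_le {f : ℝ → ℝ} (hf : Continuous f) {K a : ℝ} (hK : ∀ y, |f y| ≤ K)
    (ha : ∀ y, f y ≤ a) (σ y : ℝ) : gaussAvg f σ y ≤ a := by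
  have := integral_mono (integrable_of_bounded_gaussian hf hK σ y) (integrable_const a)
    fun x => ha (y + σ * x)
  simpa [gaussAvg] using this

theorem abs_gaussAvg_le {f : ℝ → ℝ} (hf : Continuous f) {K : ℝ} (hK : ∀ y, |f y| ≤ K) (σ y : ℝ) :
    |gaussAvg f σ y| ≤ K :=
  abs_le.2 ⟨le_gaussAvg hf hK (fun y => (abs_le.1 (hK y)).1) σ y,
    gaussAvg_le hf hK (fun y => (abs_le.1 (hK y)).2) σ y⟩

theorem gaussAvg_add_sub {f : ℝ → ℝ} (hf : Continuous f) {K : ℝ} (hK : ∀ y, |f y| ≤ K)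
    (σ y z : ℝ) :
    gaussAvg f σ (y + z) - gaussAvg f σ y = gaussAvg (fun x => f (x + z) - f x) σ y := by
  rw [gaussAvg, gaussAvg, ← integral_sub (integrable_of_bounded_gaussian hf hK σ _)
    (integrable_of_bounded_gaussian hf hK σ _), gaussAvg]
  simp only [add_right_comm y z]

theorem abs_gaussAvg_sub_le {f : ℝ → ℝ} (hf : Continuous f) {K L : ℝ} (hK : ∀ y, |f y| ≤ K)
    (hL : ∀ x y, |f x - f y| ≤ L * |x - y|) (σ x y : ℝ) :
    |gaussAvg f σ x - gaussAvg f σ y| ≤ L * |x - y| := by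
  have h1 := gaussAvg_add_sub hf hK σ y (x - y)
  rw [add_sub_cancel] at h1
  rw [h1]
  exact abs_gaussAvg_le ((hf.comp (by fun_prop)).sub hf)
    (fun z => (hL _ _).trans (by rw [add_sub_cancel_left])) σ y

/-- The velocity profile after diffusion at scale `p.1`, seen from the point `p.2`. -/
noncomputable def diffusedProfile (f : ℝ → ℝ) (p : ℝ × ℝ) (z : ℝ) : ℝ :=
  gaussAvg f p.1 (p.2 + z) - gaussAvg f p.1 p.2

section DiffusedProfile

variable {b : ℝ → ℝ} {c M L : ℝ}

theorem abs_le_inv_of_mem {x c : ℝ} (hc : 0 < c) (h1 : c ≤ x) (h2 : x ≤ c⁻¹) : |x| ≤ c⁻¹ := by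
  rw [abs_of_pos (hc.trans_le h1)]; exact h2

theorem deriv_gaussAvg {f : ℝ → ℝ} (hf : ContDiff ℝ 1 f) {K : ℝ} (hK : ∀ y, |deriv f y| ≤ K)
    (σ : ℝ) : deriv (gaussAvg f σ) = gaussAvg (deriv f) σ :=
  funext fun y => (hasDerivAt_gaussAvg hf hK σ y).deriv

theorem deriv_diffusedProfile (hb : ContDiff ℝ 1 b) {K : ℝ} (hK : ∀ y, |deriv b y| ≤ K)
    (p : ℝ × ℝ) : deriv (diffusedProfile b p) = fun z => gaussAvg (deriv b) p.1 (p.2 + z) := by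
  funext z
  rw [show diffusedProfile b p = fun z => gaussAvg b p.1 (p.2 + z) - gaussAvg b p.1 p.2 from rfl,
    deriv_sub_const, deriv_comp_const_add, deriv_gaussAvg hb hK]

theorem deriv2_diffusedProfile (hb : ContDiff ℝ 2 b) {K : ℝ} (hK : ∀ y, |deriv b y| ≤ K)
    (hM : ∀ y, |deriv (deriv b) y| ≤ M) (p : ℝ × ℝ) :
    deriv (deriv (diffusedProfile b p)) =
      fun z => gaussAvg (deriv (deriv b)) p.1 (p.2 + z) := by
  have hb1 : ContDiff ℝ 1 (deriv b) := (contDiff_succ_iff_deriv (n := 1) (𝕜 := ℝ) |>.1 hb).2.2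
  funext z
  rw [deriv_diffusedProfile (hb.of_le (by norm_num)) hK, deriv_comp_const_add,
    deriv_gaussAvg hb1 hM]

/-- Averaging against a probability measure preserves pointwise bounds and Lipschitz constants, so
`c`, `M`, `L` serve every scale and centre. Scales of either sign are allowed, which keeps the
parameter space equal to `ℝ × ℝ`. -/
theorem profile_diffusedProfile (hc : 0 < c) (hb : ContDiff ℝ 2 b)
    (h1 : ∀ y, c ≤ deriv b y ∧ deriv b y ≤ c⁻¹) (hM : ∀ y, |deriv (deriv b) y| ≤ M)
    (hL : ∀ x y, |deriv (deriv b) x - deriv (deriv b) y| ≤ L * |x - y|) (p : ℝ × ℝ) :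
    Profile c M L (diffusedProfile b p) := by
  have hb0 : ContDiff ℝ 1 b := hb.of_le (by norm_num)
  have hb1 : ContDiff ℝ 1 (deriv b) := (contDiff_succ_iff_deriv (n := 1) (𝕜 := ℝ) |>.1 hb).2.2
  have hb2 : Continuous (deriv (deriv b)) := hb1.continuous_deriv le_rfl
  have hK : ∀ y, |deriv b y| ≤ c⁻¹ := fun y => abs_le_inv_of_mem hc (h1 y).1 (h1 y).2
  have d1 := deriv_diffusedProfile hb0 hK p
  have d2 := deriv2_diffusedProfile hb hK hM p
  have e1 : ∀ z, HasDerivAt (diffusedProfile b p) (deriv (diffusedProfile b p) z) z := fun z => by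
    rw [d1]
    exact ((hasDerivAt_gaussAvg hb0 hK p.1 (p.2 + z)).comp_const_add p.2 z).sub_const _
  have e2 : ∀ z, HasDerivAt (deriv (diffusedProfile b p))
      (deriv (deriv (diffusedProfile b p)) z) z := fun z => by
    rw [d2, d1]
    exact (hasDerivAt_gaussAvg hb1 hM p.1 (p.2 + z)).comp_const_add p.2 z
  refine ⟨hc, ?_, ?_, fun z => ?_, fun z => ?_, fun z => ?_, fun x y => ?_⟩
  · refine (contDiff_succ_iff_deriv (n := 1) (𝕜 := ℝ)).2 ⟨fun z => (e1 z).differentiableAt, by simp,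
      contDiff_one_iff_deriv.2 ⟨fun z => (e2 z).differentiableAt, ?_⟩⟩
    rw [d2]
    exact (continuous_gaussAvg hb2 hM).comp (f := fun z => (p.1, p.2 + z)) (by fun_prop)
  · simp [diffusedProfile]
  · rw [d1]; exact le_gaussAvg hb1.continuous hK (fun y => (h1 y).1) _ _
  · rw [d1]; exact gaussAvg_le hb1.continuous hK (fun y => (h1 y).2) _ _
  · rw [d2]; exact abs_gaussAvg_le hb2 hM _ _
  · rw [d2]
    have := abs_gaussAvg_sub_le hb2 hM hL p.1 (p.2 + x) (p.2 + y)
    rwa [add_sub_add_left_eq_sub] at this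

theorem continuous_deriv_diffusedProfile (hb : ContDiff ℝ 1 b) {K : ℝ}
    (hK : ∀ y, |deriv b y| ≤ K) :
    Continuous fun q : (ℝ × ℝ) × ℝ => deriv (diffusedProfile b q.1) q.2 := by
  simp only [deriv_diffusedProfile hb hK]
  exact (continuous_gaussAvg (hb.continuous_deriv le_rfl) hK).comp
    (f := fun q : (ℝ × ℝ) × ℝ => (q.1.1, q.1.2 + q.2)) (by fun_prop)

end DiffusedProfile

/-! ### Decay of `Π₁` at large scales and far centres -/

theorem gaussianReal_le_volume (s : Set ℝ) : ProbabilityTheory.gaussianReal 0 1 s ≤ volume s := by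
  rw [ProbabilityTheory.gaussianReal_apply 0 one_ne_zero]
  calc ∫⁻ x in s, ProbabilityTheory.gaussianPDF 0 1 x ≤ ∫⁻ _ in s, 1 := by
        refine lintegral_mono fun x => ?_
        rw [ProbabilityTheory.gaussianPDF, ENNReal.ofReal_le_one,
          ProbabilityTheory.gaussianPDFReal_def]
        have h1 : 1 ≤ √(2 * Real.pi * (1 : NNReal)) := by
          rw [Real.one_le_sqrt]
          have := Real.pi_gt_three
          simp; linarith
        have h2 : Real.exp (-(x - 0) ^ 2 / (2 * (1 : NNReal))) ≤ 1 := by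
          rw [Real.exp_le_one_iff]
          exact div_nonpos_of_nonpos_of_nonneg (neg_nonpos.2 (sq_nonneg _)) (by simp)
        exact mul_le_one₀ (inv_le_one_of_one_le₀ h1) (Real.exp_pos _).le h2
    _ = volume s := by simp

/-- The mass that a Gaussian with large mean or large variance gives to a bounded interval. -/
theorem gaussian_concentration_le {R : ℝ} (hR : 0 ≤ R) {p : ℝ × ℝ} (h1 : 1 ≤ ‖p‖)
    (h2 : 2 * R ≤ ‖p‖) :
    (ProbabilityTheory.gaussianReal 0 1).real {x | |p.2 + p.1 * x| ≤ R} ≤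
      (4 * R + ∫ x, |x| ∂(ProbabilityTheory.gaussianReal 0 1)) / √‖p‖ := by
  set γ := ProbabilityTheory.gaussianReal 0 1 with hγ
  set n := √‖p‖ with hn
  have hn2 : n ^ 2 = ‖p‖ := Real.sq_sqrt (norm_nonneg _)
  have hn1 : 1 ≤ n := Real.one_le_sqrt.2 h1
  have hn0 : 0 < n := by linarith
  have hC : 0 ≤ ∫ x, |x| ∂γ := integral_nonneg fun x => abs_nonneg x
  rw [add_div]
  -- Either the scale is at least `√‖p‖/2`, and the set is an interval of length `2R/|σ|` with
  -- Gaussian density at most one; or the centre has size `‖p‖`, and reaching `[-R, R]` needs `|x| ≥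
  -- √‖p‖`, which Markov's inequality makes unlikely.
  rcases le_or_gt (n / 2) |p.1| with hσ | hσ
  · have hσ0 : 0 < |p.1| := by linarith
    have hs : {x | |p.2 + p.1 * x| ≤ R} ⊆ Metric.closedBall (-p.2 / p.1) (R / |p.1|) := fun x hx => by
      rw [Metric.mem_closedBall, Real.dist_eq, le_div_iff₀ hσ0, ← abs_mul]
      have : p.1 ≠ 0 := abs_pos.1 hσ0
      rw [show (x - -p.2 / p.1) * p.1 = p.2 + p.1 * x by field_simp; ring]
      exact hx
    have h3 : γ.real {x | |p.2 + p.1 * x| ≤ R} ≤ 2 * (R / |p.1|) := by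
      have h4 := (measure_mono hs).trans (gaussianReal_le_volume _)
      rw [Real.volume_closedBall] at h4
      exact ENNReal.toReal_le_of_le_ofReal (by positivity) h4
    have h5 : 2 * (R / |p.1|) ≤ 4 * R / n := by
      rw [mul_div_assoc', div_le_div_iff₀ hσ0 hn0]
      nlinarith
    have : 0 ≤ (∫ x, |x| ∂γ) / n := by positivity
    linarith
  · have hy : |p.2| = ‖p‖ := by
      have e : ‖p‖ = max |p.1| |p.2| := rfl
      rcases max_choice |p.1| |p.2| with hm | hm
      · rw [e, hm] at hn2
        nlinarith
      · rw [e, hm]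
    have hs : {x | |p.2 + p.1 * x| ≤ R} ⊆ {x | n ≤ |x|} := fun x hx => by
      rw [mem_ofPred_eq] at hx ⊢
      have h3 : |p.2| - |p.1 * x| ≤ |p.2 + p.1 * x| := by
        have := abs_sub_abs_le_abs_sub p.2 (-(p.1 * x))
        rwa [abs_neg, sub_neg_eq_add] at this
      rw [hy, abs_mul] at h3
      by_contra! h4
      have h5 : |p.1| * |x| ≤ n / 2 * n := mul_le_mul hσ.le h4.le (abs_nonneg _) (by positivity)
      have h6 : n / 2 * n = ‖p‖ / 2 := by rw [← hn2]; ring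
      have h7 : |p.1| * |x| < n / 2 * n := by
        rcases eq_or_ne |p.1| 0 with h8 | h8
        · rw [h8, zero_mul]; positivity
        · exact mul_lt_mul hσ h4.le (lt_of_le_of_ne (abs_nonneg x) fun h9 => by
            rw [← h9, mul_zero] at h3; linarith) (by positivity)
      linarith
    have h3 := mul_meas_ge_le_integral_of_nonneg (μ := γ) (f := fun x => |x|)
      (Eventually.of_forall fun x => abs_nonneg x) integrable_abs_gaussian n
    have h4 : γ.real {x | |p.2 + p.1 * x| ≤ R} ≤ γ.real {x | n ≤ |x|} := measureReal_mono hs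
    have h5 : γ.real {x | n ≤ |x|} ≤ (∫ x, |x| ∂γ) / n := by
      rw [le_div_iff₀ hn0]; linarith
    have : 0 ≤ 4 * R / n := by positivity
    linarith

/-- Gaussian averages of a function vanishing at infinity vanish at infinity in both the scale and
the centre. -/
theorem tendsto_gaussAvg {g : ℝ → ℝ} {K : ℝ} (hK : ∀ y, |g y| ≤ K)
    (hlim : Tendsto g (cocompact ℝ) (𝓝 0)) :
    Tendsto (fun p : ℝ × ℝ => gaussAvg g p.1 p.2) (comap norm atTop) (𝓝 0) := by
  rw [Metric.tendsto_nhds]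
  intro ε hε
  have hK0 : 0 ≤ K := (abs_nonneg _).trans (hK 0)
  obtain ⟨R, hR0, hR⟩ : ∃ R : ℝ, 0 ≤ R ∧ ∀ y, R < |y| → |g y| ≤ ε / 2 := by
    have h1 := (Metric.tendsto_nhds.1 hlim) (ε / 2) (by linarith)
    rw [← Metric.cobounded_eq_cocompact, ← comap_norm_atTop, eventually_comap] at h1
    obtain ⟨R, hR⟩ := (eventually_atTop.1 h1)
    refine ⟨max R 0, le_max_right _ _, fun y hy => ?_⟩
    have := hR ‖y‖ ((le_max_left R 0).trans hy.le) y rfl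
    rw [Real.dist_eq, sub_zero] at this
    exact this.le
  set C := ∫ x, |x| ∂(ProbabilityTheory.gaussianReal 0 1) with hC
  have hl : Tendsto (fun r : ℝ => K * ((4 * R + C) / √r)) atTop (𝓝 (K * 0)) :=
    (tendsto_const_nhds.div_atTop Real.tendsto_sqrt_atTop).const_mul K
  rw [mul_zero] at hl
  have hev := (hl.eventually_lt_const (half_pos hε)).and
    ((eventually_ge_atTop 1).and (eventually_ge_atTop (2 * R)))
  have hev' : ∀ᶠ p : ℝ × ℝ in comap norm atTop, K * ((4 * R + C) / √‖p‖) < ε / 2 ∧ 1 ≤ ‖p‖ ∧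
      2 * R ≤ ‖p‖ := tendsto_comap.eventually hev
  filter_upwards [hev'] with p ⟨h1, h2, h3⟩
  rw [Real.dist_eq, sub_zero]
  have hT : MeasurableSet {x : ℝ | |p.2 + p.1 * x| ≤ R} :=
    measurableSet_le (by fun_prop) measurable_const
  have h4 : ‖∫ x, g (p.2 + p.1 * x) ∂(ProbabilityTheory.gaussianReal 0 1)‖ ≤
      ∫ x, (ε / 2 + {x : ℝ | |p.2 + p.1 * x| ≤ R}.indicator (fun _ => K) x)
        ∂(ProbabilityTheory.gaussianReal 0 1) := by
    refine norm_integral_le_of_norm_le ((integrable_const _).add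
      ((integrable_const K).indicator hT)) (Eventually.of_forall fun x => ?_)
    by_cases hx : |p.2 + p.1 * x| ≤ R
    · rw [indicator_of_mem (by exact hx)]
      have := hK (p.2 + p.1 * x)
      rw [Real.norm_eq_abs]; linarith
    · rw [indicator_of_notMem (by exact hx), add_zero]
      exact hR _ (not_le.1 hx)
  rw [integral_add (integrable_const _) ((integrable_const K).indicator hT),
    integral_indicator hT, setIntegral_const, integral_const] at h4
  simp only [probReal_univ, smul_eq_mul, one_mul] at h4
  have h5 := mul_le_mul_of_nonneg_left (gaussian_concentration_le hR0 h2 h3) hK0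
  rw [gaussAvg, ← Real.norm_eq_abs]
  linarith

/-- The principal value `Π₁` vanishes at large times and far away. -/
theorem tendsto_pi1_diffusedProfile {b : ℝ → ℝ} {c M L C₁ C₂ : ℝ} (hc : 0 < c)
    (hb : ContDiff ℝ 2 b) (h1 : ∀ y, c ≤ deriv b y ∧ deriv b y ≤ c⁻¹)
    (hM : ∀ y, |deriv (deriv b) y| ≤ M)
    (hL : ∀ x y, |deriv (deriv b) x - deriv (deriv b) y| ≤ L * |x - y|)
    (hbot : Tendsto (deriv b) atBot (𝓝 C₁)) (htop : Tendsto (deriv b) atTop (𝓝 C₂)) :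
    Tendsto (fun p : ℝ × ℝ => Pi1 (diffusedProfile b p) 0) (comap norm atTop) (𝓝 0) := by
  have hp := profile_diffusedProfile hc hb h1 hM hL
  have hb1 : Continuous (deriv b) := hb.continuous_deriv (by norm_num)
  have hK : ∀ y, |deriv b y| ≤ c⁻¹ := fun y => abs_le_inv_of_mem hc (h1 y).1 (h1 y).2
  have hd := deriv_diffusedProfile (hb.of_le (by norm_num)) hK
  -- The increment `b'(x + z) - b'(x)` vanishes at both infinities even when the limits `C₁` and
  -- `C₂` differ, so its Gaussian averages vanish too.
  have hdiff : ∀ z, Tendsto (fun p : ℝ × ℝ => gaussAvg (deriv b) p.1 (p.2 + z)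
      - gaussAvg (deriv b) p.1 p.2) (comap norm atTop) (𝓝 0) := fun z => by
    simp only [gaussAvg_add_sub hb1 hK]
    refine tendsto_gaussAvg (K := c⁻¹ + c⁻¹)
      (fun y => (abs_sub _ _).trans (add_le_add (hK _) (hK _))) ?_
    rw [cocompact_eq_atBot_atTop, tendsto_sup]
    constructor
    · have := (hbot.comp (tendsto_atBot_add_const_right _ z tendsto_id)).sub hbot
      rwa [sub_self] at this
    · have := (htop.comp (tendsto_atTop_add_const_right _ z tendsto_id)).sub htop
      rwa [sub_self] at this
  have hq : ∀ z, Tendsto (fun p : ℝ × ℝ => Pi1Integrand (diffusedProfile b p) 0 z)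
      (comap norm atTop) (𝓝 0) := fun z => by
    rcases eq_or_ne z 0 with rfl | hz
    · simp only [fun p => (hp p).pi1Integrand_eq, sub_self, zero_div]
      exact tendsto_const_nhds
    have h2 := ((hdiff z).norm.div_const (c ^ 2 * z ^ 2))
    rw [norm_zero, zero_div] at h2
    refine squeeze_zero_norm (fun p => ?_) h2
    rw [(hp p).pi1Integrand_eq, hd, norm_div, norm_pow, Real.norm_eq_abs (diffusedProfile b p z),
      sq_abs, norm_sub_rev]
    simp only [add_zero]
    have := (hp p).sq_le z
    gcongr
  have := tendsto_integral_symPi1 (f := fun _ => 0) hp fun z => by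
    have := (hq z).add (hq (-z))
    rwa [add_zero] at this
  simpa using this

/-! ### Transfer from the origin to an arbitrary critical point -/

section Translation

variable {b B : ℝ → ℝ} {a c M L : ℝ}

theorem deriv_eq_of_translate (hB : ∀ z, B z = b (a + z) - b a) (z : ℝ) :
    deriv B z = deriv b (a + z) := by
  rw [show B = fun z => b (a + z) - b a from funext hB, deriv_sub_const, deriv_comp_const_add]

theorem deriv_deriv_eq_of_translate (hB : ∀ z, B z = b (a + z) - b a) (z : ℝ) :
    deriv (deriv B) z = deriv (deriv b) (a + z) := by
  rw [funext (deriv_eq_of_translate hB), deriv_comp_const_add]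

theorem isPhi1_translate_iff (hB : ∀ z, B z = b (a + z) - b a) (k : ℤ) (φ : ℝ → ℝ) :
    IsPhi1 b k a φ ↔ IsPhi1 B k 0 fun z => φ (a + z) := by
  have h0 : B 0 = 0 := by rw [hB, add_zero, sub_self]
  have hd : deriv (fun z => φ (a + z)) = fun z => deriv φ (a + z) :=
    funext fun z => deriv_comp_const_add φ a z
  refine and_congr ?_ (and_congr ?_ (and_congr (by simp) (by simp [hd])))
  · refine ⟨fun h => h.comp (contDiff_const.add contDiff_id), fun h => ?_⟩
    have := h.comp (contDiff_id.sub (contDiff_const (c := a)))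
    simpa [Function.comp_def] using! this
  · simp only [h0, sub_zero, hd, hB]
    refine ⟨fun h y => (h (a + y)).comp_const_add a y, fun h y => ?_⟩
    have := (h (-a + y)).comp_const_add (-a) y
    simpa using! this

theorem HasPV.translate {f : ℝ → ℝ} {I : ℝ} (h : HasPV f 0 I) (a : ℝ) :
    HasPV (fun y => f (y - a)) a I := by
  have hS : ∀ (x : ℝ) (ε : ℝ), MeasurableSet {y : ℝ | ε < |y - x|} := fun x ε =>
    measurableSet_lt measurable_const (by fun_prop)
  have hind : ∀ ε : ℝ, {y : ℝ | ε < |y - a|}.indicator (fun y => f (y - a)) =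
      fun y => {y : ℝ | ε < |y - 0|}.indicator f (y - a) := fun ε => by
    funext y
    simp [indicator]
  refine ⟨fun ε hε => ?_, h.2.congr fun ε => ?_⟩
  · rw [← integrable_indicator_iff (hS a ε), hind]
    exact ((integrable_indicator_iff (hS 0 ε)).2 (h.1 ε hε)).comp_sub_right a
  · rw [← integral_indicator (hS a ε), ← integral_indicator (hS 0 ε), hind,
      integral_sub_right_eq_self (μ := volume) ({y : ℝ | ε < |y - 0|}.indicator f) a]

/-- Both sides are choices by `Classical.epsilon`; uniqueness of the solution at the origin
identifies them. -/
theorem phi1_eq_of_translate (h : Profile c M L B) (hB : ∀ z, B z = b (a + z) - b a) (k : ℤ) :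
    phi1 b k a = fun y => phi1 B k 0 (y - a) := by
  have hex : IsPhi1 b k a fun y => phi1 B k 0 (y - a) := by
    rw [isPhi1_translate_iff hB, h.phi1_eq]
    simpa using h.isPhi1_phiFn k
  have := Classical.epsilon_spec (p := IsPhi1 b k a) ⟨_, hex⟩
  change IsPhi1 b k a (phi1 b k a) at this
  have h2 := h.eq_phiFn_of_isPhi1 ((isPhi1_translate_iff hB k _).1 this)
  rw [h.phi1_eq, ← h2]
  simp

theorem pi1Integrand_eq_of_translate (hB : ∀ z, B z = b (a + z) - b a) :
    Pi1Integrand b a = fun y => Pi1Integrand B 0 (y - a) := by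
  funext y
  rw [Pi1Integrand, Pi1Integrand, deriv_eq_of_translate hB, deriv_eq_of_translate hB, hB, hB]
  simp

theorem pi2Integrand_eq_of_translate (h : Profile c M L B) (hB : ∀ z, B z = b (a + z) - b a)
    (k : ℤ) : Pi2Integrand b k a = fun y => Pi2Integrand B k 0 (y - a) := by
  funext y
  rw [Pi2Integrand, Pi2Integrand, phi1_eq_of_translate h hB, hB, hB]
  simp

theorem jWellDefined_of_translate (h : Profile c M L B) (hB : ∀ z, B z = b (a + z) - b a) (k : ℤ) :
    JWellDefined b k a := by
  have hb : b = fun y => B (y - a) + b a := by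
    funext y; rw [hB, add_sub_cancel, sub_add_cancel]
  have hphi : IsPhi1 b k a fun y => phi1 B k 0 (y - a) := by
    rw [isPhi1_translate_iff hB, h.phi1_eq]
    simpa using h.isPhi1_phiFn k
  refine ⟨?_, fun y => ?_, ⟨_, hphi, fun φ hφ => ?_⟩, fun y => ?_, ⟨∫ z, symPi1 B z / 2, ?_⟩, ?_⟩
  · rw [hb]
    exact (h.contDiff.comp (contDiff_id.sub contDiff_const)).add contDiff_const
  · have := h.deriv_pos (y - a)
    rwa [deriv_eq_of_translate hB, add_sub_cancel] at this
  · have := h.eq_phiFn_of_isPhi1 ((isPhi1_translate_iff hB k φ).1 hφ)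
    rw [h.phi1_eq, ← this]
    simp
  · rw [phi1_eq_of_translate h hB, h.phi1_eq]
    exact (h.phiFn_pos k _).ne'
  · rw [pi1Integrand_eq_of_translate hB]
    exact h.hasPV.translate a
  · rw [pi2Integrand_eq_of_translate h hB]
    exact (h.integrable_pi2Integrand k).comp_sub_right a

theorem J1_eq_of_translate (h : Profile c M L B) (hB : ∀ z, B z = b (a + z) - b a) (k : ℤ) :
    J1 b k a = J1 B k 0 := by
  have h1 : Pi1 b a = Pi1 B 0 := by
    rw [Pi1, pi1Integrand_eq_of_translate hB, Pi1]
    exact (h.hasPV.translate a).2.limUnder_eq.trans h.hasPV.2.limUnder_eq.symm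
  have h2 : Pi2 b k a = Pi2 B k 0 := by
    rw [Pi2, pi2Integrand_eq_of_translate h hB, Pi2]
    exact integral_sub_right_eq_self (μ := volume) (Pi2Integrand B k 0) a
  rw [J1, J1, h1, h2, deriv_eq_of_translate hB, add_zero]

theorem J2_eq_of_translate (hB : ∀ z, B z = b (a + z) - b a) : J2 b a = J2 B 0 := by
  rw [J2, J2, deriv_eq_of_translate hB, deriv_deriv_eq_of_translate hB, add_zero]

end Translation

/-! ### Compactness and conclusion -/

theorem Profile.abs_pi1_le {c M L : ℝ} {B : ℝ → ℝ} (h : Profile c M L B) :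
    |Pi1 B 0| ≤ symConst c M L / 2 * Real.pi := by
  rw [h.pi1_eq, ← integral_univ_inv_one_add_sq, ← integral_const_mul, ← Real.norm_eq_abs]
  refine norm_integral_le_of_norm_le (integrable_inv_one_add_sq.const_mul _)
    (Eventually.of_forall fun z => ?_)
  have := h.abs_symPi1_le z
  rw [Real.norm_eq_abs, abs_div, abs_two]
  linarith

theorem Profile.J_sq_pos {c M L : ℝ} {B : ℝ → ℝ} (h : Profile c M L B) {k : ℤ} (hk : k ≠ 0)
    (hs : ¬ IsRayleighEigenvalue B k 0) : 0 < J1 B k 0 ^ 2 + J2 B 0 ^ 2 := by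
  by_contra! hle
  have h1 : J1 B k 0 = 0 := by nlinarith [sq_nonneg (J1 B k 0), sq_nonneg (J2 B 0)]
  have h2 : J2 B 0 = 0 := by nlinarith [sq_nonneg (J1 B k 0), sq_nonneg (J2 B 0)]
  refine hs (h.isRayleighEigenvalue ?_ h1 hk)
  rw [J2, div_eq_zero_iff, mul_eq_zero] at h2
  rcases h2 with (h2 | h2) | h2
  · exact absurd h2 Real.pi_ne_zero
  · exact h2
  · exact absurd h2 (pow_ne_zero 3 (h.deriv_pos 0).ne')

theorem exists_pos_forall_le_of_finset {ι : Type*} (s : Finset ι) (f : ι → ℝ)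
    (hf : ∀ i ∈ s, 0 < f i) : ∃ δ, 0 < δ ∧ ∀ i ∈ s, δ ≤ f i := by
  rcases s.eq_empty_or_nonempty with rfl | hs
  · exact ⟨1, one_pos, by simp⟩
  · obtain ⟨i, hi, hmin⟩ := s.exists_min_image f hs
    exact ⟨f i, hf i hi, hmin⟩

/-- The uniform lower bound for all diffused profiles of a spectrally stable shear flow. -/
theorem exists_lower_bound_diffusedProfile {b : ℝ → ℝ} {c M L C₁ C₂ : ℝ} (hc : 0 < c)
    (hb : ContDiff ℝ 2 b) (h1 : ∀ y, c ≤ deriv b y ∧ deriv b y ≤ c⁻¹)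
    (hM : ∀ y, |deriv (deriv b) y| ≤ M)
    (hL : ∀ x y, |deriv (deriv b) x - deriv (deriv b) y| ≤ L * |x - y|)
    (hbot : Tendsto (deriv b) atBot (𝓝 C₁)) (htop : Tendsto (deriv b) atTop (𝓝 C₂))
    (hs : ∀ p : ℝ × ℝ, 0 ≤ p.1 → ∀ k : ℤ, k ≠ 0 →
      ¬ IsRayleighEigenvalue (diffusedProfile b p) k 0) :
    ∃ δ, 0 < δ ∧ ∀ p : ℝ × ℝ, 0 ≤ p.1 → ∀ k : ℤ, k ≠ 0 →
      δ * (k : ℝ) ^ 2 ≤ J1 (diffusedProfile b p) k 0 ^ 2 + J2 (diffusedProfile b p) 0 ^ 2 := by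
  have hp := profile_diffusedProfile hc hb h1 hM hL
  have hK : ∀ y, |deriv b y| ≤ c⁻¹ := fun y => abs_le_inv_of_mem hc (h1 y).1 (h1 y).2
  have hcont := continuous_deriv_diffusedProfile (hb.of_le (by norm_num)) hK
  have hc0 := coerciveConst_pos hc
  have hint : ∀ k : ℤ, k ≠ 0 → 1 ≤ |(k : ℝ)| := fun k hk => by
    rw [← Int.cast_abs]; exact_mod_cast Int.one_le_abs hk
  -- Outside radius `R` the coercive part dominates for every `k ≠ 0`, because `|k| ≥ 1`.
  obtain ⟨R, hR⟩ : ∃ R : ℝ, ∀ p : ℝ × ℝ, R ≤ ‖p‖ →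
      c⁻¹ * |Pi1 (diffusedProfile b p) 0| ≤ coerciveConst c / 2 := by
    have h2 := (tendsto_pi1_diffusedProfile hc hb h1 hM hL hbot htop).abs.const_mul c⁻¹
    rw [abs_zero, mul_zero] at h2
    have h3 := h2.eventually_le_const (half_pos hc0)
    rw [eventually_comap] at h3
    obtain ⟨R, hR⟩ := eventually_atTop.1 h3
    exact ⟨R, fun p hpR => hR _ hpR p rfl⟩
  -- For `|k| ≥ K` the uniform bound on `Π₁` makes the coercive part dominate at every scale and
  -- centre.
  obtain ⟨K, hKK⟩ := exists_nat_ge (c⁻¹ * (symConst c M L / 2 * Real.pi) / (coerciveConst c / 2))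
  have hcpt : IsCompact {p : ℝ × ℝ | p ∈ Metric.closedBall 0 R ∧ 0 ≤ p.1} :=
    (isCompact_closedBall 0 R).inter_right (isClosed_le continuous_const continuous_fst)
  -- One mode at a time, `δ` may depend on `k` and the factor `k²` is divided out. The compact set
  -- is a half ball, as stability is assumed for `σ ≥ 0`; the value `1` for `k = 0` only makes the
  -- choice total.
  have hloc : ∀ k : ℤ, ∃ δ : ℝ, 0 < δ ∧ (k ≠ 0 → ∀ p : ℝ × ℝ, ‖p‖ ≤ R → 0 ≤ p.1 →
      δ * (k : ℝ) ^ 2 ≤ J1 (diffusedProfile b p) k 0 ^ 2 + J2 (diffusedProfile b p) 0 ^ 2) := by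
    intro k
    by_cases hk : k = 0
    · exact ⟨1, one_pos, fun h => absurd hk h⟩
    rcases ({p : ℝ × ℝ | p ∈ Metric.closedBall 0 R ∧ 0 ≤ p.1}).eq_empty_or_nonempty with he | hne
    · refine ⟨1, one_pos, fun _ p hpR hp0 => ?_⟩
      have : p ∈ {p : ℝ × ℝ | p ∈ Metric.closedBall 0 R ∧ 0 ≤ p.1} := ⟨by simpa using hpR, hp0⟩
      rw [he] at this
      exact absurd this (notMem_empty p)
    have hb1 : ContDiff ℝ 1 (deriv b) := (contDiff_succ_iff_deriv (n := 1) (𝕜 := ℝ) |>.1 hb).2.2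
    have hJ2 : Continuous fun p : ℝ × ℝ => J2 (diffusedProfile b p) 0 := by
      refine (continuous_const.mul ?_).div ((hcont.comp (Continuous.prodMk_left 0)).pow 3)
        fun p => pow_ne_zero 3 ((hp p).deriv_pos 0).ne'
      simp only [deriv2_diffusedProfile hb hK hM]
      exact (continuous_gaussAvg (hb1.continuous_deriv le_rfl) hM).comp
        (f := fun p : ℝ × ℝ => (p.1, p.2 + 0)) (by fun_prop)
    have hF : Continuous fun p : ℝ × ℝ =>
        J1 (diffusedProfile b p) k 0 ^ 2 + J2 (diffusedProfile b p) 0 ^ 2 :=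
      ((continuous_J1 hp hcont k).pow 2).add (hJ2.pow 2)
    obtain ⟨p₀, hp₀, hmin⟩ := hcpt.exists_isMinOn hne hF.continuousOn
    have hk2 : 0 < (k : ℝ) ^ 2 := by positivity
    refine ⟨_, div_pos ((hp p₀).J_sq_pos hk (hs p₀ hp₀.2 k hk)) hk2, fun _ p hpR hp0 => ?_⟩
    rw [div_mul_cancel₀ _ hk2.ne']
    exact hmin ⟨by simpa using hpR, hp0⟩
  choose d hd0 hd using hloc
  obtain ⟨δ, hδ0, hδ⟩ := exists_pos_forall_le_of_finset (Finset.Icc (-(K : ℤ)) K) d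
    fun k _ => hd0 k
  refine ⟨min δ ((coerciveConst c / 2) ^ 2), lt_min hδ0 (by positivity), fun p hp0 k hk => ?_⟩
  by_cases hsmall : c⁻¹ * |Pi1 (diffusedProfile b p) 0| ≤ coerciveConst c / 2 * |(k : ℝ)|
  · calc _ ≤ (coerciveConst c / 2) ^ 2 * (k : ℝ) ^ 2 := by gcongr; exact min_le_right _ _
      _ ≤ J1 (diffusedProfile b p) k 0 ^ 2 := (hp p).le_J1_sq hk hsmall
      _ ≤ _ := le_add_of_nonneg_right (sq_nonneg _)
  · have hpR : ‖p‖ ≤ R := by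
      by_contra! h
      exact hsmall ((hR p h.le).trans (le_mul_of_one_le_right (half_pos hc0).le (hint k hk)))
    have hkK : k ∈ Finset.Icc (-(K : ℤ)) K := by
      rw [Finset.mem_Icc, ← abs_le]
      by_contra! h
      refine hsmall ?_
      have h2 : (K : ℝ) ≤ |(k : ℝ)| := by rw [← Int.cast_abs]; exact_mod_cast h.le
      have h3 := hKK.trans h2
      rw [div_le_iff₀ (half_pos hc0)] at h3
      have h4 := mul_le_mul_of_nonneg_left (hp p).abs_pi1_le (inv_pos.2 hc).le
      linarith
    calc _ ≤ d k * (k : ℝ) ^ 2 := by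
          gcongr; exact (min_le_left _ _).trans (hδ k hkK)
      _ ≤ _ := hd k hk p hpR hp0

/-- Stability at one viscosity `ν₀` covers every scale, since the flow at time `σ²/(2ν₀)` is the
average at scale `σ`. The bound therefore holds for all `ν > 0`. -/
theorem FlowAssumption.exists_lower_bound {ν₀ : ℝ} {bin : ℝ → ℝ} (hν₀ : 0 < ν₀)
    (h : FlowAssumption ν₀ bin) : ∃ δ : ℝ, 0 < δ ∧ ∀ ν : ℝ, 0 < ν → ∀ s : ℝ, 0 ≤ s →
      ∀ k : ℤ, k ≠ 0 → ∀ y' : ℝ, JWellDefined (heatFlow ν bin s) k y' ∧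
        δ * (k : ℝ) ^ 2 ≤ J1 (heatFlow ν bin s) k y' ^ 2 + J2 (heatFlow ν bin s) y' ^ 2 := by
  obtain ⟨c, hc, -, h1, C₁, C₂, -, -, -, hbot, htop⟩ := h.monotone_growth
  have hb := h.contDiff
  have hb1 : ContDiff ℝ 1 (deriv bin) := (contDiff_succ_iff_deriv (n := 1) (𝕜 := ℝ) |>.1 hb).2.2
  obtain ⟨hm0, g, hg, hg0, g', hg', hg'0, -⟩ := h.memH3
  obtain ⟨M, L, hM, hL⟩ := exists_bound_lipschitz_of_memSobolev (hb1.continuous_deriv le_rfl)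
    ⟨hm0, g, hg, hg0, g', hg', hg'0⟩
  obtain ⟨δ, hδ0, hδ⟩ := exists_lower_bound_diffusedProfile hc hb h1 hM hL hbot htop
    fun p hp0 k hk he => by
      have e : heatFlow ν₀ bin (p.1 ^ 2 / (2 * ν₀)) = gaussAvg bin p.1 := by
        rw [heatFlow_eq_gaussAvg hb.continuous (by positivity),
          mul_div_cancel₀ _ (by positivity), Real.sqrt_sq hp0]
      refine h.stable (p.1 ^ 2 / (2 * ν₀)) (by positivity) k hk
        (gaussAvg bin p.1 p.2 : ℂ) ?_
      rw [e]
      exact isRayleighEigenvalue_of_translate (fun _ => rfl) he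
  refine ⟨δ, hδ0, fun ν hν s hs k hk y' => ?_⟩
  have e := heatFlow_eq_gaussAvg (f := bin) hb.continuous (ν := ν) (t := s) (by positivity)
  set σ := √(2 * ν * s) with hσ
  have hp := profile_diffusedProfile hc hb h1 hM hL (σ, y')
  have ht : ∀ z, diffusedProfile bin (σ, y') z = gaussAvg bin σ (y' + z) - gaussAvg bin σ y' :=
    fun _ => rfl
  rw [e, J1_eq_of_translate hp ht, J2_eq_of_translate ht]
  exact ⟨jWellDefined_of_translate hp ht k, hδ (σ, y') (Real.sqrt_nonneg _) k hk⟩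

end ShearFlow

theorem lemma2p5 (bin : ℝ → ℝ) :
    ∃ δ : ℝ, 0 < δ ∧ ∀ ν : ℝ, 0 < ν → ShearFlow.FlowAssumption ν bin →
      ∀ s : ℝ, 0 ≤ s → ∀ k : ℤ, k ≠ 0 → ∀ y' : ℝ,
        ShearFlow.JWellDefined (ShearFlow.heatFlow ν bin s) k y' ∧
          δ * (k : ℝ) ^ 2 ≤
            ShearFlow.J1 (ShearFlow.heatFlow ν bin s) k y' ^ 2 +
              ShearFlow.J2 (ShearFlow.heatFlow ν bin s) y' ^ 2 := by
  -- The constant must be fixed before `ν`: any admissible viscosity supplies it, and if there is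
  -- none the claim is vacuous with `δ = 1`.
  by_cases hex : ∃ ν₀ : ℝ, 0 < ν₀ ∧ ShearFlow.FlowAssumption ν₀ bin
  · obtain ⟨ν₀, hν₀, h⟩ := hex
    obtain ⟨δ, hδ0, hδ⟩ := h.exists_lower_bound hν₀
    exact ⟨δ, hδ0, fun ν hν _ => hδ ν hν⟩
  · exact ⟨1, one_pos, fun ν hν h => absurd ⟨ν, hν, h⟩ hex⟩
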